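/- Let $n\ge 4$ and let $\mathbf a=(a_1,\dots,a_r)$, $\mathbf b=(b_1,\dots,b_s)$ be sequences of integers with $$2\le a_1\le\dots\le a_r,\qquad 1\le b_1\le\dots\le b_s,\qquad 1\le r<s<n .$$ Let $R=\mathbb C[x_0,\dots,x_n]=\bigoplus_d R_d$ (with $R_d=0$ for $d<0$), and for a sequence $\mathbf c=(c_1,\dots,c_t)$ of positive integers with $t<n$ let $M_{\mathbf c}=\bigoplus_{i=1}^t R(c_i)$, where $R(k)_d=R_{k+d}$. For $f=(f_1,\dots,f_t)\in (M_{\mathbf c})_0$, so that $f_i\in R_{c_i}$, let $J_f=\langle f_1,\dots,f_t\rangle$. Let $H_{\mathbf c}$ be the scheme parameterizing all complete intersections of multi-degree $\mathbf c$ in $\mathbb P^n$, that is, closed subschemes of codimension $t$ in $\mathbb P^n$ defined by $J_f$ for some $f\in (M_{\mathbf c})_0$. Let $o=[1:0:\dots:0]\in\mathbb P^n$ and $I_o=\langle x_1,\dots,x_n\rangle\subset R$. Let $\Gamma_o$ be the (Zariski closed) set of pairs $(o,X)$ with $X\in H_{\mathbf a}$, $o\in X$, and $X$ singular at $o$. Let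 $\Xi_o$ be the set of triples $(o,Z,X)$ with $Z\in H_{\mathbf b}$, $X\in H_{\mathbf a}$, $o\in Z\subset X$ (as subschemes), $X$ singular at $o$ and $Z$ smooth at $o$, and let $\alpha|_{\Xi_o}:\Xi_o\to\Gamma_o$ be $(o,Z,X)\mapsto(o,X)$. Put $N_{\mathbf a}=\bigoplus_{i=1}^{r-1}R(a_i)\oplus I_o(a_r)\subset M_{\mathbf a}$ and $$V=(I_oM_{\mathbf b})_0\times \operatorname{Hom}(M_{\mathbf b},N_{\mathbf a})_0,$$ where $\operatorname{Hom}(\ ,\ )_0$ denotes the finite-dimensional complex vector space of degree-preserving $R$-linear maps. For $(g,h)\in V$ let $$\delta_{(g,h)}(G,H)=H(g)+h(G)\qquad\bigl(G\in (M_{\mathbf b})_0,\ H\in\operatorname{Hom}(M_{\mathbf b},M_{\mathbf a})_0\bigr).$$ A property holds for general $(g,h)\in V$ if it holds on a non-empty Zariski open subset of $V$. Suppose $a_r\ge b_s$. Then the following conditions are equivalent: (i) the map $\alpha|_{\Xi_o}:\Xi_o\to\Gamma_o$ is dominant, i.e. its image is Zariski dense in $\Gamma_o$; (ii) for general $(g,h)\in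 V$, $\delta_{(g,h)}(V)=(I_oN_{\mathbf a})_0$; (iii) for general $(g,h)\in V$, $\dim_{\mathbb C}\bigl(M_{\mathbf a}/(J_gM_{\mathbf a}+I_o\,h(M_{\mathbf b}))\bigr)_0=n+r-s$; (iv) there exists $(g,h)\in V$ with $\dim_{\mathbb C}\bigl(M_{\mathbf a}/(J_gM_{\mathbf a}+I_o\,h(M_{\mathbf b}))\bigr)_0\le n+r-s$. -/

import Mathlib

noncomputable section

namespace IncidenceCI

/-! ## Zariski topology on a finite-dimensional complex vector space -/

/-- The algebra of polynomial functions on a complex vector space: the algebra of functions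
generated by the linear functionals. -/
def polyFun (W : Type*) [AddCommGroup W] [Module ℂ W] : Subalgebra ℂ (W → ℂ) :=
  Algebra.adjoin ℂ (Set.range fun φ : Module.Dual ℂ W => (φ : W → ℂ))

/-- The Zariski topology: the non-vanishing loci of polynomial functions are a basis. -/
abbrev zariski (W : Type*) [AddCommGroup W] [Module ℂ W] : TopologicalSpace W :=
  TopologicalSpace.generateFrom {U | ∃ p ∈ polyFun W, U = {w | p w ≠ 0}}

/-- A property holds for a general point of the vector space `W` if it holds on a non-empty
Zariski open subset (which is dense, since `W` is irreducible). -/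
def ForGeneral (W : Type*) [AddCommGroup W] [Module ℂ W] (P : W → Prop) : Prop :=
  ∃ U : Set W, @IsOpen W (zariski W) U ∧ U.Nonempty ∧ ∀ w ∈ U, P w

/-! ## Graded modules over the homogeneous coordinate ring of projective space -/

/-- `R = ℂ[x₀, …, xₙ]`. -/
abbrev R (n : ℕ) : Type := MvPolynomial (Fin (n + 1)) ℂ

/-- `R_d`, which is `0` for `d < 0`. -/
def homog (n : ℕ) (d : ℤ) : Submodule ℂ (R n) :=
  if 0 ≤ d then MvPolynomial.homogeneousSubmodule (Fin (n + 1)) ℂ d.toNat else ⊥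

/-- The graded piece `(M_c)_d` of `M_c = ⨁ R(cᵢ)`; the underlying module of `M_c` is
`Fin t → R n`. -/
def piece (n : ℕ) {t : ℕ} (c : Fin t → ℤ) (d : ℤ) : Submodule ℂ (Fin t → R n) :=
  Submodule.pi Set.univ fun i => homog n (c i + d)

/-- The degree `0` piece of a homogeneous submodule `K` of `M_c`. -/
def degZero (n : ℕ) {t : ℕ} (c : Fin t → ℤ) (K : Submodule (R n) (Fin t → R n)) :
    Submodule ℂ (Fin t → R n) :=
  K.restrictScalars ℂ ⊓ piece n c 0

/-- The degree `0` piece `(M_c / K)_0` for a homogeneous submodule `K` of `M_c`, i.e. the image of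
`(M_c)_0` in `M_c / K`. -/
def quotDegZero (n : ℕ) {t : ℕ} (c : Fin t → ℤ) (K : Submodule (R n) (Fin t → R n)) :
    Submodule ℂ ((Fin t → R n) ⧸ K) :=
  (piece n c 0).map (K.mkQ.restrictScalars ℂ)

/-- `Hom(M_b, N)_0` for a submodule `N` of `M_a`: the `R`-linear maps `M_b → M_a`
preserving degrees and with values in `N`. -/
def homZero (n : ℕ) {r s : ℕ} (b : Fin s → ℤ) (a : Fin r → ℤ)
    (N : Submodule (R n) (Fin r → R n)) :
    Submodule ℂ ((Fin s → R n) →ₗ[R n] (Fin r → R n)) where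
  carrier := {h | (∀ d : ℤ, ∀ f ∈ piece n b d, h f ∈ piece n a d) ∧ ∀ f, h f ∈ N}
  add_mem' := fun h k => ⟨fun d f hf => add_mem (h.1 d f hf) (k.1 d f hf),
    fun f => add_mem (h.2 f) (k.2 f)⟩
  zero_mem' := ⟨fun _ _ _ => zero_mem _, fun _ => zero_mem _⟩
  smul_mem' := fun z _ h => ⟨fun d f hf => Submodule.smul_mem _ z (h.1 d f hf),
    fun f => Submodule.smul_of_tower_mem N z (h.2 f)⟩

/-- `J_f`, the ideal generated by the components of `f`. -/
def J {n t : ℕ} (f : Fin t → R n) : Ideal (R n) := Ideal.span (Set.range f)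

/-- `I_o = ⟨x₁, …, xₙ⟩`, the homogeneous ideal of the point `o = [1 : 0 : … : 0]`. -/
def Io (n : ℕ) : Ideal (R n) := Ideal.span (Set.range fun j : Fin n => MvPolynomial.X j.succ)

/-- `N_a = R(a₁) ⊕ … ⊕ R(a_{r-1}) ⊕ I_o(a_r)`, as a submodule of `M_a`. -/
def Na (n r : ℕ) : Submodule (R n) (Fin r → R n) where
  carrier := {f | ∀ i : Fin r, (i : ℕ) + 1 = r → f i ∈ Io n}
  add_mem' := fun hf hg i hi => add_mem (hf i hi) (hg i hi)
  zero_mem' := fun _ _ => zero_mem _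
  smul_mem' := fun z _ hf i hi => Ideal.mul_mem_left _ z (hf i hi)

/-- `V = (I_o M_b)_0 × Hom(M_b, N_a)_0`. -/
def V (n : ℕ) {r s : ℕ} (a : Fin r → ℤ) (b : Fin s → ℤ) :
    Submodule ℂ ((Fin s → R n) × ((Fin s → R n) →ₗ[R n] (Fin r → R n))) :=
  (degZero n b (Io n • ⊤)).prod (homZero n b a (Na n r))

/-- `δ_{(g,h)} (G, H) = H(g) + h(G)`. -/
def delta {n r s : ℕ} (g : Fin s → R n) (h : (Fin s → R n) →ₗ[R n] (Fin r → R n)) :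
    ((Fin s → R n) × ((Fin s → R n) →ₗ[R n] (Fin r → R n))) →ₗ[ℂ] (Fin r → R n) where
  toFun := fun x => x.2 g + h x.1
  map_add' := fun x y => by
    simp only [Prod.fst_add, Prod.snd_add, LinearMap.add_apply, map_add]; abel
  map_smul' := fun z x => by
    simp only [Prod.smul_fst, Prod.smul_snd, LinearMap.smul_apply, LinearMap.map_smul_of_tower,
      RingHom.id_apply, smul_add]

/-- `dim (M_a / (J_g M_a + I_o h(M_b)))_0`. -/
def quotDim {n r s : ℕ} (a : Fin r → ℤ) (g : Fin s → R n)
    (h : (Fin s → R n) →ₗ[R n] (Fin r → R n)) : ℕ :=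
  Module.finrank ℂ
    (quotDegZero n a (J g • (⊤ : Submodule (R n) (Fin r → R n)) ⊔ Io n • LinearMap.range h))

/-! ## Complete intersections in projective space -/

/-- The saturation of a homogeneous ideal with respect to the irrelevant ideal. Two homogeneous
ideals define the same closed subscheme of `ℙⁿ` if and only if their saturations agree; a closed
subscheme is represented below by its (saturated) homogeneous ideal. -/
def saturation {n : ℕ} (I : Ideal (R n)) : Ideal (R n) :=
  ⨆ k : ℕ, I.colon (((Ideal.span (Set.range MvPolynomial.X)) ^ k : Ideal (R n)) : Set (R n))

/-- `(M_c)_0^{ci}`: those `f = (f₁, …, f_t)` in `(M_c)_0` for which `J_f` defines a complete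
intersection in `ℙⁿ`, that is, a closed subscheme of codimension `t`. -/
def ciLocus (n : ℕ) {t : ℕ} (c : Fin t → ℤ) : Set (piece n c 0) :=
  {f | (J (f : Fin t → R n)).height = t}

/-- The set of (closed points of the scheme parameterizing) complete intersections of
multi-degree `c` in `ℙⁿ`, each given by its saturated homogeneous ideal. -/
def H (n : ℕ) {t : ℕ} (c : Fin t → ℤ) : Type :=
  {I : Ideal (R n) // ∃ f ∈ ciLocus n c, I = saturation (J (f : Fin t → R n))}

/-- The surjection `q_c : (M_c)_0^{ci} → H_c` sending `f` to the complete intersection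
defined by `J_f`. -/
def q (n : ℕ) {t : ℕ} (c : Fin t → ℤ) (f : ciLocus n c) : H n c :=
  ⟨saturation (J (f.1 : Fin t → R n)), f.1, f.2, rfl⟩

/-- The Zariski topology on `H_c`. The morphism `q_c` is smooth and surjective, so a subset of
`H_c` is open if and only if its inverse image in `(M_c)_0^{ci}` is. -/
instance (n : ℕ) {t : ℕ} (c : Fin t → ℤ) : TopologicalSpace (H n c) :=
  TopologicalSpace.coinduced (q n c)
    (TopologicalSpace.induced (Subtype.val : ciLocus n c → piece n c 0) (zariski (piece n c 0)))

/-- The Zariski tangent space at `o` of the closed subscheme of `ℙⁿ` with homogeneous ideal `I`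
(assumed to pass through `o`), in the affine coordinates `x₁/x₀, …, xₙ/x₀` around `o`. -/
def tangentSpaceAtO {n : ℕ} (I : Ideal (R n)) : Submodule ℂ (Fin n → ℂ) where
  carrier := {v | ∀ F ∈ I, ∑ j : Fin n,
    MvPolynomial.eval (Pi.single 0 1) (MvPolynomial.pderiv j.succ F) * v j = 0}
  add_mem' := fun hv hw F hF => by
    simp only [Pi.add_apply, mul_add, Finset.sum_add_distrib, hv F hF, hw F hF, add_zero]
  zero_mem' := fun F _ => by simp
  smul_mem' := fun z v hv F hF => by
    simp only [Pi.smul_apply, smul_eq_mul, mul_left_comm _ z, ← Finset.mul_sum, hv F hF, mul_zero]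

/-- The fibre over `o` of the locus of critical points of the universal family over `H_c`:
the complete intersections `Y` of multi-degree `c` (of dimension `n - t`) that pass through `o`
and are singular there, i.e. `dim T_o Y > n - t`. -/
def Gamma (n : ℕ) {t : ℕ} (c : Fin t → ℤ) : Set (H n c) :=
  {Y | Y.1 ≤ Io n ∧ n < Module.finrank ℂ (tangentSpaceAtO Y.1) + t}

/-- `Ξ_o`: the pairs `(Z, X)` of complete intersections of multi-degrees `b` and `a` with
`o ∈ Z ⊆ X` as subschemes, `X` singular at `o`, and `Z` smooth at `o`. -/
def Xi (n : ℕ) {r s : ℕ} (a : Fin r → ℤ) (b : Fin s → ℤ) : Set (H n b × H n a) :=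
  {P | P.1.1 ≤ Io n ∧ P.2.1 ≤ P.1.1 ∧ P.2 ∈ Gamma n a ∧ P.1 ∉ Gamma n b}

/-- The restriction `Ξ_o → Γ_o`, `(Z, X) ↦ X`, of `α`. -/
def alphaXi (n : ℕ) {r s : ℕ} (a : Fin r → ℤ) (b : Fin s → ℤ) (P : Xi n a b) : Gamma n a :=
  ⟨P.1.2, P.2.2.2.1⟩

end IncidenceCI

end

open IncidenceCI

/-! Write `W` for `(I_o N_a)_0` and consider the quadratic map `V → W`, `(g, h) ↦ h(g)` (`pairing`).
Its differential at `(g, h)` is `δ_{(g,h)}`, so the theorem splits into a geometric comparison of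
this map with `Ξ_o → Γ_o`, a Jacobian criterion, and a dimension count.

Geometry. If `X = V(f)` is singular at `o`, some combination of the gradients of the `f_i` at `o`
vanishes. Replacing the last generator, which has the largest degree, by the corresponding
combination of the `f_i` (with powers of `x₀` to equalize degrees) moves `f` into `W`; this still
generates the same ideal when the coefficient of `f_r` is nonzero. If moreover `X` contains `Z =
V(g)` smooth at `o`, write the new tuple as `A g`: independence of the gradients of `g` forces the
last row of `A` to vanish at `o`, so `(g, A) ∈ V` and the tuple is a value of the quadratic map
(`exists_pairing_eq`). Conversely a general value `h(g)` gives a point of `Ξ_o`. Hence dominance of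
`Ξ_o → Γ_o` amounts to dominance of `V → W` (`pairing_dominant_of_denseRange`,
`denseRange_of_pairing_dominant`).

Jacobian criterion. In characteristic zero a polynomial map is dominant iff its differential is onto
at some point (`exists_surjective_differential_iff`), and surjectivity is an open condition. This
gives (i) ⇔ (ii).

Dimension count. The degree zero part of `J_g M_a + I_o h(M_b)` is the image of `δ` on `(I_o M_b)_0
× Hom(M_b, M_a)_0`. It equals `δ(V)` plus the span of the `s` vectors `x₀^{a_r - b_j} g_j` in the
last coordinate, which exist because `a_r ≥ b_s`. Since `(M_a)_0` has dimension `dim W + n + r`, the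
quotient has dimension at least `n + r - s + (dim W - dim δ(V))`, with equality when the gradients
of `g` are independent, because `δ(V) ⊆ W` has zero last gradient. So (iv) at a single point already
forces `δ(V) = W`, and (ii) gives (iii) for general `(g, h)`.

The commutative algebra behind this is that the local ring of the affine cone at its vertex has
depth `n + 1`. It shows that ideals of complete intersections are saturated, so that `X` determines
`J_f` and inclusions of schemes are inclusions of ideals (`mem_J_of_irr_pow_mul_mem`), and that
being a complete intersection holds for general members of the linear systems in use
(`height_J_eq`). -/

/-! ## Regular sequences in local rings of large depth -/

namespace LocalDepth

open IsLocalRing RingTheory.Sequence CategoryTheory Abelian Pointwise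

universe u

variable {A : Type u} [CommRing A] [IsLocalRing A] [IsNoetherianRing A]

/-- The vanishing of `Ext^i(A/𝔪, M)` for `i < k`. -/
def ExtVanish (A : Type u) [CommRing A] [IsLocalRing A] (M : Type u) [AddCommGroup M] [Module A M]
    (k : ℕ) : Prop :=
  ∀ i < k, Subsingleton (Ext (ModuleCat.of A (A ⧸ maximalIdeal A)) (ModuleCat.of A M) i)

variable {M : Type u} [AddCommGroup M] [Module A M] [Module.Finite A M]

/-- The degree zero group is `Hom(A/𝔪, M)`; for finite modules over a Noetherian ring it vanishes
exactly when the annihilator of `A/𝔪` contains an `M`-regular element. -/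
lemma ExtVanish.exists_regular {k : ℕ} (h : ExtVanish A M (k + 1)) :
    ∃ x ∈ maximalIdeal A, IsSMulRegular M x := by
  have h0 := h 0 k.succ_pos
  have : Subsingleton (ModuleCat.of A (A ⧸ maximalIdeal A) ⟶ ModuleCat.of A M) :=
    Ext.addEquiv₀.subsingleton_congr.mp h0
  have : Subsingleton ((A ⧸ maximalIdeal A) →ₗ[A] M) :=
    (ModuleCat.homAddEquiv (M := ModuleCat.of A (A ⧸ maximalIdeal A))
      (N := ModuleCat.of A M)).symm.subsingleton
  obtain ⟨x, hx, hr⟩ := IsSMulRegular.subsingleton_linearMap_iff.mp this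
  exact ⟨x, by rwa [Ideal.annihilator_quotient] at hx, hr⟩

-- In the long exact sequence of `0 → M → M → M/xM → 0`, the group `Ext^i(A/𝔪, M/xM)` lies between
-- `Ext^i(A/𝔪, M)` and `Ext^{i+1}(A/𝔪, M)`.
omit [IsNoetherianRing A] [Module.Finite A M] in
lemma ExtVanish.quotSMulTop {k : ℕ} (h : ExtVanish A M (k + 1)) {x : A}
    (hx : IsSMulRegular M x) : ExtVanish A (QuotSMulTop x M) k := by
  intro i hi
  have zero1 := AddCommGrpCat.isZero_of_iff_subsingleton.mpr (h i (by omega))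
  have zero2 := AddCommGrpCat.isZero_of_iff_subsingleton.mpr (h (i + 1) (by omega))
  have hx' : IsSMulRegular (ModuleCat.of A M) x := hx
  exact AddCommGrpCat.subsingleton_of_isZero <| ShortComplex.Exact.isZero_of_both_zeros
    ((Ext.covariant_sequence_exact₃' (ModuleCat.of A (A ⧸ maximalIdeal A))
      hx'.smulShortComplex_shortExact) i (i + 1) rfl)
    (zero1.eq_zero_of_src _) (zero2.eq_zero_of_tgt _)

/-- This is one direction of Rees's characterization of depth. -/
lemma ExtVanish.of_isRegular {rs : List A} (mem : ∀ r ∈ rs, r ∈ maximalIdeal A)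
    (reg : IsRegular A rs) : ExtVanish A A rs.length := by
  have key := (ModuleCat.exists_isRegular_tfae (maximalIdeal A) rs.length (ModuleCat.of A A) ?_).out
    0 3
  · refine key.mpr ⟨rs, rfl, mem, reg⟩ _ ?_ ?_ ?_
    · exact inferInstanceAs (Nontrivial (A ⧸ maximalIdeal A))
    · exact inferInstanceAs (Module.Finite A (A ⧸ maximalIdeal A))
    · rw [Module.support_eq_zeroLocus]
      exact (PrimeSpectrum.zeroLocus_anti_mono (by
        have := Ideal.annihilator_quotient (I := maximalIdeal A)
        intro x hx
        have h2 : x ∈ Module.annihilator A (A ⧸ maximalIdeal A) := by rw [this]; exact hx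
        exact h2))
  · rw [lt_top_iff_ne_top]
    intro h
    have h1 : (maximalIdeal A) • (⊤ : Submodule A A) = ⊤ := h
    rw [smul_eq_mul, Ideal.mul_top] at h1
    exact (maximalIdeal.isMaximal A).ne_top h1

-- An element of `q` outside `p` is a nonzerodivisor of the domain `A/p`; dividing by it lowers the
-- dimension by at least one, and `A/q` is a further quotient.
omit [IsLocalRing A] [IsNoetherianRing A] in
lemma ringKrullDim_quotient_add_one_le {p q : Ideal A} [hp : p.IsPrime] (h : p < q) :
    ringKrullDim (A ⧸ q) + 1 ≤ ringKrullDim (A ⧸ p) := by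
  obtain ⟨r, hrq, hrp⟩ := Set.exists_of_ssubset h
  have hr : Ideal.Quotient.mk p r ∈ nonZeroDivisors (A ⧸ p) :=
    mem_nonZeroDivisors_of_ne_zero (by rwa [Ne, Ideal.Quotient.eq_zero_iff_mem])
  refine le_trans ?_ (ringKrullDim_quotient_succ_le_of_nonZeroDivisor hr)
  gcongr
  let φ : (A ⧸ p) ⧸ Ideal.span {Ideal.Quotient.mk p r} →+* A ⧸ q :=
    Ideal.Quotient.lift _ (Ideal.Quotient.factor h.le) (by
      intro a ha
      have : Ideal.span {Ideal.Quotient.mk p r} ≤ RingHom.ker (Ideal.Quotient.factor h.le) := by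
        rw [Ideal.span_singleton_le_iff_mem, RingHom.mem_ker, Ideal.Quotient.factor_mk,
          Ideal.Quotient.eq_zero_iff_mem]
        exact hrq
      exact this ha)
  refine ringKrullDim_le_of_surjective φ ?_
  intro y
  obtain ⟨y, rfl⟩ := Ideal.Quotient.mk_surjective y
  exact ⟨Ideal.Quotient.mk _ (Ideal.Quotient.mk p y), rfl⟩

/-- If `p` is associated to `M` and `x ∈ 𝔪` is `M`-regular, then some prime strictly containing
`p` is associated to `M / xM`. -/
lemma exists_lt_associatedPrime {p : Ideal A} (hp : p ∈ associatedPrimes A M) {x : A}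
    (hxm : x ∈ maximalIdeal A) (hx : IsSMulRegular M x) :
    ∃ q ∈ associatedPrimes A (QuotSMulTop x M), p < q := by
  obtain ⟨hpp, u, hu⟩ := isAssociatedPrime_iff.mp (AssociatedPrimes.mem_iff.mp hp)
  have hmem : ∀ r, r ∈ p ↔ r • u = 0 := fun r => by
    rw [hu, Submodule.mem_colon_singleton, Submodule.mem_bot]
  have hu0 : u ≠ 0 := by
    rintro rfl
    exact hpp.ne_top (Ideal.eq_top_iff_one _ |>.mpr ((hmem 1).mpr (smul_zero _)))
  -- `N` is the part of `M` killed by `p`. If `N ⊆ xM`, regularity of `x` would give `N = xN`, hence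
  -- `N = 0` by Nakayama, contradicting `u ∈ N`. Thus `M/xM` has a nonzero element killed by `p` and
  -- by `x`, while `x ∉ p`.
  let N : Submodule A M := ⨅ r ∈ p, LinearMap.ker (LinearMap.lsmul A M r)
  have hN : ∀ v, v ∈ N ↔ ∀ r ∈ p, r • v = 0 := fun v => by simp [N]
  have huN : u ∈ N := (hN u).mpr fun r hr => (hmem r).mp hr
  have hex : ∃ v ∈ N, v ∉ x • (⊤ : Submodule A M) := by
    by_contra! hcon
    have hle : N ≤ Ideal.span {x} • N := by
      intro v hv
      obtain ⟨w, -, rfl⟩ := (Submodule.mem_smul_pointwise_iff_exists _ _ _).mp (hcon v hv)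
      refine Submodule.smul_mem_smul (Ideal.mem_span_singleton_self x) ((hN w).mpr fun r hr => ?_)
      have := (hN _).mp hv r hr
      rw [smul_comm] at this
      exact hx (by simpa using this)
    have hbot := Submodule.eq_bot_of_le_smul_of_le_jacobson_bot (Ideal.span {x}) N
      (IsNoetherian.noetherian N) hle (by
        rw [Ideal.span_singleton_le_iff_mem]
        exact (maximalIdeal_le_jacobson _) hxm)
    rw [hbot] at huN
    exact hu0 (by simpa using huN)
  obtain ⟨v, hvN, hv⟩ := hex
  let v' : QuotSMulTop x M := Submodule.Quotient.mk v
  have hv' : v' ≠ 0 := by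
    intro h
    exact hv ((Submodule.Quotient.mk_eq_zero _).mp h)
  obtain ⟨q, hq, hle⟩ := exists_le_isAssociatedPrime_of_isNoetherianRing A v' hv'
  have hpq : ∀ r ∈ p, r ∈ q := fun r hr => hle (by
    rw [Submodule.mem_colon_singleton, Submodule.mem_bot]
    have := (hN v).mp hvN r hr
    change (Submodule.Quotient.mk (r • v) : QuotSMulTop x M) = 0
    rw [this, Submodule.Quotient.mk_zero])
  have hxq : x ∈ q := hle (by
    rw [Submodule.mem_colon_singleton, Submodule.mem_bot]
    change (Submodule.Quotient.mk (x • v) : QuotSMulTop x M) = 0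
    exact (Submodule.Quotient.mk_eq_zero _).mpr
      (Submodule.smul_mem_pointwise_smul _ _ _ Submodule.mem_top))
  have hxp : x ∉ p := fun h => hu0 (hx (by simpa using (hmem x).mp h))
  exact ⟨q, hq, lt_of_le_of_ne hpq (fun h => hxp (h ▸ hxq))⟩

/-- Depth is at most `dim A/p` for every associated prime `p`: each division by a regular element
costs one unit of depth and replaces `p` by a strictly larger associated prime. -/
lemma le_ringKrullDim_quotient_of_mem_associatedPrimes (k : ℕ) {M : Type u} [AddCommGroup M]
    [Module A M] [Module.Finite A M] (h : ExtVanish A M k) {p : Ideal A}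
    (hp : p ∈ associatedPrimes A M) : (k : WithBot ℕ∞) ≤ ringKrullDim (A ⧸ p) := by
  induction k generalizing M p with
  | zero =>
    have : p.IsPrime := IsAssociatedPrime.isPrime hp
    simpa using ringKrullDim_nonneg_of_nontrivial
  | succ k ih =>
    obtain ⟨x, hxm, hx⟩ := h.exists_regular
    obtain ⟨q, hq, hlt⟩ := exists_lt_associatedPrime hp hxm hx
    have : p.IsPrime := IsAssociatedPrime.isPrime hp
    refine le_trans ?_ (ringKrullDim_quotient_add_one_le hlt)
    push_cast
    gcongr
    exact ih (h.quotSMulTop hx) hq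

/-- Krull's height theorem in `A/p`, whose maximal ideal is minimal over the images of `L`. -/
lemma ringKrullDim_quotient_le_length {p : Ideal A} [hp : p.IsPrime] {L : List A}
    (hL : ∀ x ∈ L, x ∈ maximalIdeal A)
    (h : maximalIdeal A ≤ (p ⊔ Ideal.ofList L).radical) :
    ringKrullDim (A ⧸ p) ≤ L.length := by
  classical
  have : IsLocalRing (A ⧸ p) :=
    IsLocalRing.of_surjective' (Ideal.Quotient.mk p) Ideal.Quotient.mk_surjective
  rw [← IsLocalRing.maximalIdeal_height_eq_ringKrullDim]
  let s : Finset (A ⧸ p) := (L.map (Ideal.Quotient.mk p)).toFinset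
  have hs : maximalIdeal (A ⧸ p) ∈ (Ideal.span (s : Set (A ⧸ p))).minimalPrimes := by
    refine ⟨⟨inferInstance, ?_⟩, ?_⟩
    · rw [Ideal.span_le]
      intro y hy
      simp only [s, List.coe_toFinset, List.mem_map, Set.mem_ofPred_eq] at hy
      obtain ⟨x, hx, rfl⟩ := hy
      exact (IsLocalRing.mem_maximalIdeal _).mpr (fun hu => by
        have hu' := (IsLocalHom.of_surjective (Ideal.Quotient.mk p)
          Ideal.Quotient.mk_surjective).map_nonunit x hu
        exact (IsLocalRing.mem_maximalIdeal x).mp (hL x hx) hu')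
    · rintro q ⟨hq, hsq⟩ -
      have h1 : maximalIdeal A ≤ q.comap (Ideal.Quotient.mk p) := by
        have hqp : (q.comap (Ideal.Quotient.mk p)).IsPrime := inferInstance
        refine h.trans (hqp.radical_le_iff.mpr (sup_le ?_ ?_))
        · intro x hx
          rw [Ideal.mem_comap, Ideal.Quotient.eq_zero_iff_mem.mpr hx]
          exact zero_mem _
        · rw [Ideal.ofList, Ideal.span_le]
          intro x hx
          refine hsq (Ideal.subset_span ?_)
          simp only [s, List.coe_toFinset, List.mem_map, Set.mem_ofPred_eq]
          exact ⟨x, hx, rfl⟩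
      intro y hy
      obtain ⟨x, rfl⟩ := Ideal.Quotient.mk_surjective y
      refine h1 ((IsLocalRing.mem_maximalIdeal _).mpr fun hu => ?_)
      exact (IsLocalRing.mem_maximalIdeal _).mp hy (hu.map _)
  have h2 := Ideal.height_le_card_of_mem_minimalPrimes_span_finset hs
  have h3 : s.card ≤ L.length := (List.toFinset_card_le _).trans (by simp)
  have h4 : (maximalIdeal (A ⧸ p)).height ≤ (L.length : ℕ∞) := h2.trans (by exact_mod_cast h3)
  exact_mod_cast h4

/-- A sequence in `𝔪` generating an `𝔪`-primary ideal modulo the annihilator of `M`, of length at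
most the depth of `M`, is `M`-regular. -/
theorem isWeaklyRegular_of_maximalIdeal_le_radical (L : List A) (k : ℕ) {M : Type u}
    [AddCommGroup M] [Module A M] [Module.Finite A M] (h : ExtVanish A M k)
    (hk : L.length ≤ k) (hL : ∀ x ∈ L, x ∈ maximalIdeal A)
    (hrad : maximalIdeal A ≤ (Module.annihilator A M ⊔ Ideal.ofList L).radical) :
    IsWeaklyRegular M L := by
  induction L generalizing M k with
  | nil => exact IsWeaklyRegular.nil A M
  | cons x L ih =>
    -- Otherwise `x` lies in an associated prime `p`. The remaining elements then already cut out
    -- the closed point of `A/p`, so `dim A/p` is below the depth bound `k`.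
    have hx : IsSMulRegular M x := by
      by_contra hx
      have hmem : x ∈ ⋃ p ∈ associatedPrimes A M, (p : Set A) := by
        rw [biUnion_associatedPrimes_eq_compl_regular A M]
        exact hx
      simp only [Set.mem_iUnion, exists_prop] at hmem
      obtain ⟨p, hp, hxp⟩ := hmem
      have : p.IsPrime := IsAssociatedPrime.isPrime hp
      have h1 := le_ringKrullDim_quotient_of_mem_associatedPrimes k h hp
      have h2 : ringKrullDim (A ⧸ p) ≤ L.length := by
        refine ringKrullDim_quotient_le_length (fun y hy => hL y (List.mem_cons_of_mem _ hy)) ?_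
        refine hrad.trans (Ideal.radical_mono (sup_le ?_ ?_))
        · have := IsAssociatedPrime.annihilator_le hp
          rw [Submodule.annihilator_top] at this
          exact this.trans le_sup_left
        · rw [Ideal.ofList_cons]
          refine sup_le ?_ le_sup_right
          rw [Ideal.span_singleton_le_iff_mem]
          exact Ideal.mem_sup_left hxp
      have h3 : ((k : ℕ) : WithBot ℕ∞) ≤ (L.length : ℕ) := h1.trans h2
      have h4 : k ≤ L.length := by exact_mod_cast h3
      simp at hk
      omega
    rw [isWeaklyRegular_cons_iff]
    obtain ⟨k, rfl⟩ : ∃ l, k = l + 1 := ⟨k - 1, by simp at hk; omega⟩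
    refine ⟨hx, ih k (h.quotSMulTop hx) (by simpa using hk)
      (fun y hy => hL y (List.mem_cons_of_mem _ hy)) (hrad.trans (Ideal.radical_mono ?_))⟩
    rw [Ideal.ofList_cons, ← sup_assoc]
    refine sup_le_sup_right (sup_le ?_ ?_) _
    · intro r hr
      rw [Module.mem_annihilator] at hr ⊢
      intro m
      obtain ⟨m, rfl⟩ := Submodule.Quotient.mk_surjective _ m
      rw [← Submodule.Quotient.mk_smul, hr m, Submodule.Quotient.mk_zero]
    · rw [Ideal.span_singleton_le_iff_mem, Module.mem_annihilator]
      intro m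
      obtain ⟨m, rfl⟩ := Submodule.Quotient.mk_surjective _ m
      rw [← Submodule.Quotient.mk_smul]
      exact (Submodule.Quotient.mk_eq_zero _).mpr
        (Submodule.smul_mem_pointwise_smul _ _ _ Submodule.mem_top)

omit [IsLocalRing A] [IsNoetherianRing A] in
lemma quotient_smul_regular_iff {J : Ideal A} {x : A} :
    IsSMulRegular (A ⧸ (J • ⊤ : Submodule A A)) x ↔ ∀ y, x * y ∈ J → y ∈ J := by
  rw [isSMulRegular_quotient_iff_mem_of_smul_mem]
  simp only [smul_eq_mul, Ideal.mul_top]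

omit [IsLocalRing A] [IsNoetherianRing A] in
/-- A prime containing a weakly regular sequence of length `t` has height at least `t`. -/
lemma length_le_height_of_isWeaklyRegular (L : List A) (h : IsWeaklyRegular A L) {p : Ideal A}
    [hp : p.IsPrime] (hL : Ideal.ofList L ≤ p) : (L.length : ℕ∞) ≤ p.height := by
  induction L using List.reverseRecOn generalizing p with
  | nil => simp
  | append_singleton L x ih =>
    rw [isWeaklyRegular_append_iff] at h
    obtain ⟨h1, h2⟩ := h
    rw [isWeaklyRegular_singleton_iff] at h2
    rw [Ideal.ofList_append, sup_le_iff] at hL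
    obtain ⟨q, hq, hqp⟩ := Ideal.exists_minimalPrimes_le hL.1
    have hqprime : q.IsPrime := hq.1.1
    -- A minimal prime `q` over the earlier elements consists of zero divisors modulo them, so the
    -- regular element `x` makes `q ⊂ p` strict.
    have hxq : x ∉ q := by
      refine h2.notMem_of_mem_minimalPrimes ?_
      rwa [smul_eq_mul, Ideal.mul_top, Ideal.annihilator_quotient]
    have hxp : x ∈ p := hL.2 (Ideal.subset_span (List.mem_singleton_self x))
    have hlt : q < p := lt_of_le_of_ne hqp (fun e => hxq (e ▸ hxp))
    have := ih h1 hq.1.2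
    rw [List.length_append, List.length_singleton]
    push_cast
    calc (L.length : ℕ∞) + 1 ≤ q.height + 1 := by gcongr
      _ ≤ p.height := Ideal.height_add_one_le_of_lt_of_isPrime hlt

lemma height_head_add_length_le {α : Type*} [Preorder α] (l : LTSeries α) {h : ℕ}
    (hh : (h : ℕ∞) ≤ Order.height l.head) : ((h + l.length : ℕ) : ℕ∞) ≤ Order.height l.last := by
  obtain ⟨p, hp, hlen⟩ := Order.exists_series_of_le_height l.head hh
  have := Order.length_le_height_last (p := p.smash l hp)
  rw [RelSeries.last_smash] at this
  simpa [← hlen] using this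

/-- In a local ring of dimension at most `d` and depth at least `d`, a sequence of length `t < d`
generating an ideal of height `t` has a further regular element. -/
theorem exists_regular_quotient_of_height {d : ℕ} (hd : ExtVanish A A d)
    (hdim : (maximalIdeal A).height ≤ d) (L : List A) (hL : ∀ x ∈ L, x ∈ maximalIdeal A)
    (hlt : L.length < d)
    (hht : ∀ p : Ideal A, p.IsPrime → Ideal.ofList L ≤ p → (L.length : ℕ∞) ≤ p.height) :
    ∃ x ∈ maximalIdeal A, ∀ y, x * y ∈ Ideal.ofList L → y ∈ Ideal.ofList L := by
  classical
  have hLm : Ideal.ofList L ≤ maximalIdeal A := Ideal.span_le.mpr hL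
  set J := Ideal.ofList L with hJ
  have hne : J ≠ ⊤ := fun h => (maximalIdeal.isMaximal A).ne_top (top_le_iff.mp (h ▸ hLm))
  have : Nontrivial (A ⧸ J) := Ideal.Quotient.nontrivial_iff.mpr hne
  have : IsLocalRing (A ⧸ J) :=
    IsLocalRing.of_surjective' (Ideal.Quotient.mk J) Ideal.Quotient.mk_surjective
  have hcomap : (maximalIdeal (A ⧸ J)).comap (Ideal.Quotient.mk J) = maximalIdeal A := by
    have := IsLocalHom.of_surjective (Ideal.Quotient.mk J) Ideal.Quotient.mk_surjective
    exact (IsLocalRing.local_hom_TFAE (Ideal.Quotient.mk J)).out 0 4 |>.mp this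
  -- A system of parameters of `A/J`, to be lifted to `A` and appended to `L`.
  obtain ⟨s, hs, hcard⟩ := Ideal.exists_finset_card_eq_height_of_isNoetherianRing
    (maximalIdeal (A ⧸ J))
  -- A maximal chain of primes in `A/J` pulls back to a chain in `A` whose bottom contains `J` and
  -- so has height at least `L.length`; splicing the two bounds the sum by `dim A ≤ d`.
  have hscard : s.card + L.length ≤ d := by
    obtain ⟨l, hl, hlen⟩ := Order.exists_series_of_height_eq_coe
      (⟨maximalIdeal (A ⧸ J), inferInstance⟩ : PrimeSpectrum (A ⧸ J)) (n := s.card) (by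
        rw [← PrimeSpectrum.height_eq_orderHeight]; exact hcard.symm)
    have hmono : StrictMono (PrimeSpectrum.comap (Ideal.Quotient.mk J)) := by
      intro p q hpq
      refine lt_of_le_of_ne (Ideal.comap_mono hpq.le) fun h => hpq.ne ?_
      exact PrimeSpectrum.comap_injective_of_surjective _ Ideal.Quotient.mk_surjective h
    have h1 := height_head_add_length_le (l.map _ hmono) (h := L.length) (by
      rw [← PrimeSpectrum.height_eq_orderHeight]
      refine hht _ inferInstance ?_
      intro x hx
      refine Ideal.mem_comap.mpr ?_
      rw [Ideal.Quotient.eq_zero_iff_mem.mpr hx]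
      exact zero_mem _)
    rw [LTSeries.last_map, hl, ← PrimeSpectrum.height_eq_orderHeight] at h1
    have h2 : ((L.length + s.card : ℕ) : ℕ∞) ≤ d := by
      refine le_trans ?_ hdim
      have h3 : (PrimeSpectrum.comap (Ideal.Quotient.mk J)
        ⟨maximalIdeal (A ⧸ J), inferInstance⟩).asIdeal = maximalIdeal A := hcomap
      rw [h3] at h1
      simpa [hlen] using h1
    have h3 : L.length + s.card ≤ d := by exact_mod_cast h2
    omega
  let L' : List A := s.toList.map Quotient.out
  have hmk : ∀ y : A ⧸ J, Ideal.Quotient.mk J (Quotient.out y) = y := fun y => Quotient.out_eq' y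
  have hL' : ∀ x ∈ L', x ∈ maximalIdeal A := by
    intro x hx
    obtain ⟨y, hy, rfl⟩ := List.mem_map.mp hx
    rw [← hcomap, Ideal.mem_comap, hmk]
    exact hs.1.2 (Ideal.subset_span (by simpa using hy))
  have hrad : maximalIdeal A ≤ (J ⊔ Ideal.ofList L').radical := by
    rw [Ideal.radical_eq_sInf]
    refine le_sInf ?_
    rintro q ⟨hJq, hq⟩
    have hq' : (q.map (Ideal.Quotient.mk J)).IsPrime :=
      Ideal.isPrime_map_quotientMk_of_isPrime (le_sup_left.trans hJq)
    have hcq : (q.map (Ideal.Quotient.mk J)).comap (Ideal.Quotient.mk J) = q := by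
      rw [Ideal.comap_map_of_surjective _ Ideal.Quotient.mk_surjective, ← RingHom.ker_eq_comap_bot,
        Ideal.mk_ker, sup_eq_left]
      exact le_sup_left.trans hJq
    rw [← hcomap, ← hcq]
    refine Ideal.comap_mono (hs.2 ⟨hq', Ideal.span_le.mpr ?_⟩ (le_maximalIdeal hq'.ne_top))
    intro y hy
    rw [← hmk y]
    refine Ideal.mem_map_of_mem _ (hJq (Ideal.mem_sup_right (Ideal.subset_span ?_)))
    exact List.mem_map.mpr ⟨y, by simpa using hy, rfl⟩
  -- If the list of lifted parameters is empty, `0` is appended so that there is a head element;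
  -- `L.length < d` leaves room for it, and the same argument applies.
  obtain ⟨x, L'', hlen, hxm, hsub⟩ : ∃ x L'', (L ++ x :: L'').length ≤ d ∧
      (∀ y ∈ L ++ x :: L'', y ∈ maximalIdeal A) ∧ Ideal.ofList L' ≤ Ideal.ofList (x :: L'') := by
    have hlenL' : L'.length = s.card := by simp [L']
    rcases hcase : L' with _ | ⟨x, L''⟩
    · refine ⟨0, [], by simp; omega, ?_, by simp⟩
      intro y hy
      rcases List.mem_append.mp hy with h | h
      · exact hL y h
      · rw [List.mem_singleton.mp h]; exact zero_mem _
    · refine ⟨x, L'', ?_, ?_, le_rfl⟩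
      · rw [List.length_append, ← hcase]; omega
      · intro y hy
        rcases List.mem_append.mp hy with h | h
        · exact hL y h
        · exact hL' y (hcase ▸ h)
  have hreg := isWeaklyRegular_of_maximalIdeal_le_radical (M := A) (L ++ x :: L'') d hd hlen hxm (by
    refine hrad.trans (Ideal.radical_mono ?_)
    rw [Ideal.ofList_append]
    exact (sup_le_sup_left hsub _).trans le_sup_right)
  rw [isWeaklyRegular_append_iff, isWeaklyRegular_cons_iff] at hreg
  exact ⟨x, hxm x (by simp), quotient_smul_regular_iff.mp hreg.2.1⟩

end LocalDepth

noncomputable section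

/-! ## Complete intersections in the polynomial ring -/

namespace IncidenceCI

open MvPolynomial RingTheory.Sequence LocalDepth

variable {n : ℕ}

/-- The irrelevant ideal `⟨x₀, …, xₙ⟩`. -/
abbrev irr (n : ℕ) : Ideal (R n) := Ideal.span (Set.range MvPolynomial.X)

lemma mem_irr_iff {F : R n} : F ∈ irr n ↔ coeff 0 F = 0 := by
  have := mem_pow_idealOfVars_iff' (R := ℂ) (σ := Fin (n + 1)) 1 F
  rw [pow_one] at this
  refine this.trans ⟨fun h => h 0 (by simp), fun h x hx => ?_⟩
  have : x = 0 := (Finsupp.degree_eq_zero_iff x).mp (by omega)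
  rwa [this]

instance irr_isMaximal : (irr n).IsMaximal := by
  have : irr n = RingHom.ker (constantCoeff : R n →+* ℂ) := by
    ext F
    rw [mem_irr_iff, RingHom.mem_ker, constantCoeff_eq]
  rw [this]
  exact RingHom.ker_isMaximal_of_surjective _ fun z => ⟨C z, by simp⟩

/-- Membership in an ideal generated by variables is tested on each monomial, and multiplying by one
variable does not affect divisibility by the preceding ones. -/
lemma isWeaklyRegular_X : IsWeaklyRegular (R n) (List.ofFn (X : Fin (n + 1) → R n)) := by
  rw [isWeaklyRegular_iff]
  intro i hi
  rw [quotient_smul_regular_iff]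
  have hi' : i < n + 1 := by simpa using hi
  have hspan : Ideal.ofList ((List.ofFn (X : Fin (n + 1) → R n)).take i) =
      Ideal.span ((X : Fin (n + 1) → R n) '' {j | (j : ℕ) < i}) := by
    rw [Ideal.ofList]
    congr 1
    ext y
    simp only [Set.mem_image, Set.mem_ofPred_eq, List.mem_take_iff_getElem, List.length_ofFn,
      List.getElem_ofFn]
    constructor
    · rintro ⟨j, hj, rfl⟩
      exact ⟨⟨j, by omega⟩, by simp; omega, rfl⟩
    · rintro ⟨j, hj, rfl⟩
      exact ⟨j, by have := j.2; omega, rfl⟩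
  rw [hspan]
  intro y hy
  rw [mem_ideal_span_X_image] at hy ⊢
  intro m hm
  rw [List.getElem_ofFn] at hy
  obtain ⟨j, hj, hne⟩ := hy (Finsupp.single ⟨i, hi'⟩ 1 + m) (by
    rw [mem_support_iff] at hm ⊢
    rwa [coeff_X_mul])
  refine ⟨j, hj, ?_⟩
  have hji : (⟨i, hi'⟩ : Fin (n + 1)) ≠ j := by
    rintro rfl
    simp at hj
  simpa [Finsupp.single_apply, hji] using hne

/-- The local ring of the vertex of the affine cone. -/
abbrev Loc (n : ℕ) : Type := Localization.AtPrime (irr n)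

lemma map_mem_maximalIdeal {F : R n} :
    algebraMap (R n) (Loc n) F ∈ IsLocalRing.maximalIdeal (Loc n) ↔ F ∈ irr n :=
  IsLocalization.AtPrime.to_map_mem_maximal_iff (Loc n) (irr n) F

/-- The variables remain a regular sequence after localization, so the vertex of the cone has depth
at least `n + 1`. -/
lemma extVanish_loc : ExtVanish (Loc n) (Loc n) (n + 1) := by
  have h := isWeaklyRegular_X.isRegular_of_isLocalization_of_mem (Loc n) (irr n)
    (rs := List.ofFn (X : Fin (n + 1) → R n)) (by
      intro r hr
      obtain ⟨i, rfl⟩ := (List.mem_ofFn' _ _).mp hr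
      exact Ideal.subset_span ⟨i, rfl⟩)
  have h2 := ExtVanish.of_isRegular (by
    intro r hr
    obtain ⟨x, hx, rfl⟩ := List.mem_map.mp hr
    obtain ⟨i, rfl⟩ := (List.mem_ofFn' _ _).mp hx
    exact map_mem_maximalIdeal.mpr (Ideal.subset_span ⟨i, rfl⟩)) h
  simpa using h2

lemma height_maximalIdeal_loc_le : (IsLocalRing.maximalIdeal (Loc n)).height ≤ (n + 1 : ℕ) := by
  rw [← Localization.AtPrime.map_eq_maximalIdeal]
  rw [IsLocalization.height_map_of_disjoint (irr n).primeCompl (irr n)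
    (Set.disjoint_left.mpr fun _ h1 h2 => h1 h2)]
  refine (Ideal.height_le_spanFinrank _ (irr_isMaximal (n := n)).ne_top).trans ?_
  have h1 := Submodule.spanFinrank_span_le_ncard_of_finite (R := R n)
    (s := Set.range (X : Fin (n + 1) → R n)) (Set.finite_range _)
  have h2 : (Set.range (X : Fin (n + 1) → R n)).ncard ≤ n + 1 := by
    rw [← Nat.card_coe_set_eq]
    exact (Finite.card_range_le _).trans (by simp)
  exact_mod_cast h1.trans h2

/-- The images of `f` in the local ring, as a list. -/
def locList {t : ℕ} (f : Fin t → R n) : List (Loc n) :=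
  (List.ofFn f).map (algebraMap (R n) (Loc n))

lemma length_locList {t : ℕ} (f : Fin t → R n) : (locList f).length = t := by simp [locList]

lemma ofList_ofFn {A : Type*} [CommRing A] {t : ℕ} (f : Fin t → A) :
    Ideal.ofList (List.ofFn f) = Ideal.span (Set.range f) := by
  rw [Ideal.ofList]
  congr 1
  ext y
  simp [List.mem_ofFn']

lemma ofList_locList {t : ℕ} (f : Fin t → R n) :
    Ideal.ofList (locList f) = (J f).map (algebraMap (R n) (Loc n)) := by
  rw [locList, ← Ideal.map_ofList, ofList_ofFn, J]

/-- All members of the family are homogeneous of positive degree. -/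
def PosHomog {t : ℕ} (f : Fin t → R n) : Prop := ∀ i, ∃ e : ℕ, 0 < e ∧ (f i).IsHomogeneous e

lemma PosHomog.mem_irr {t : ℕ} {f : Fin t → R n} (h : PosHomog f) (i : Fin t) : f i ∈ irr n := by
  obtain ⟨e, he, hf⟩ := h i
  rw [mem_irr_iff]
  exact hf.coeff_eq_zero (by simp; omega)

lemma PosHomog.J_le_irr {t : ℕ} {f : Fin t → R n} (h : PosHomog f) : J f ≤ irr n :=
  Ideal.span_le.mpr (by rintro _ ⟨i, rfl⟩; exact h.mem_irr i)

attribute [local instance] MvPolynomial.gradedAlgebra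

lemma PosHomog.J_isHomogeneous {t : ℕ} {f : Fin t → R n} (h : PosHomog f) :
    (J f).IsHomogeneous (homogeneousSubmodule (Fin (n + 1)) ℂ) := by
  refine Ideal.homogeneous_span _ _ ?_
  rintro _ ⟨i, rfl⟩
  obtain ⟨e, -, hf⟩ := h i
  exact ⟨e, hf⟩

lemma PosHomog.locList_mem {t : ℕ} {f : Fin t → R n} (h : PosHomog f) :
    ∀ x ∈ locList f, x ∈ IsLocalRing.maximalIdeal (Loc n) := by
  intro x hx
  obtain ⟨y, hy, rfl⟩ := List.mem_map.mp hx
  obtain ⟨i, rfl⟩ := (List.mem_ofFn' _ _).mp hy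
  exact map_mem_maximalIdeal.mpr (h.mem_irr i)

lemma homogeneousComponent_mul_of_isHomogeneous (w F : R n) {e : ℕ} (hF : F.IsHomogeneous e)
    (k : ℕ) : homogeneousComponent (k + e) (w * F) = homogeneousComponent k w * F := by
  conv_lhs => rw [← sum_homogeneousComponent w, Finset.sum_mul, map_sum]
  conv_rhs => rw [← sum_homogeneousComponent w, map_sum, Finset.sum_mul]
  refine Finset.sum_congr rfl fun i _ => ?_
  have h1 := homogeneousComponent_isHomogeneous i w
  rw [homogeneousComponent_of_mem (h1.mul hF), homogeneousComponent_of_mem h1]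
  by_cases h : k = i
  · simp [h]
  · rw [if_neg h, if_neg (by omega), zero_mul]

/-- The homogeneous ideal of a complete intersection of positive dimension is saturated. -/
theorem mem_J_of_irr_pow_mul_mem {t : ℕ} {f : Fin t → R n} (hf : PosHomog f)
    (hht : (J f).height = t) (htn : t ≤ n) {F : R n} {e : ℕ} (hF : F.IsHomogeneous e) {k : ℕ}
    (hk : ∀ s ∈ irr n ^ k, F * s ∈ J f) : F ∈ J f := by
  -- As `t ≤ n` is less than the depth, some `x` in the maximal ideal is regular modulo `J_f`
  -- locally; the factor `x ^ k` can then be cancelled from `x ^ k F ∈ J_f`.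
  obtain ⟨x, hx, hreg⟩ := exists_regular_quotient_of_height (A := Loc n) (d := n + 1) extVanish_loc
    height_maximalIdeal_loc_le (locList f) hf.locList_mem (by rw [length_locList]; omega) (by
      intro p hp hle
      rw [length_locList, ← hht, ← IsLocalization.height_under (irr n).primeCompl p]
      refine Ideal.height_mono ?_
      rw [ofList_locList] at hle
      exact Ideal.map_le_iff_le_comap.mp hle)
  rw [ofList_locList] at hreg
  have hpow : x ^ k * algebraMap (R n) (Loc n) F ∈ (J f).map (algebraMap (R n) (Loc n)) := by
    have hxk : x ^ k ∈ (irr n ^ k).map (algebraMap (R n) (Loc n)) := by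
      rw [Ideal.map_pow, Localization.AtPrime.map_eq_maximalIdeal]
      exact Ideal.pow_mem_pow hx k
    have hle : (irr n ^ k).map (algebraMap (R n) (Loc n)) * Ideal.span {algebraMap _ (Loc n) F} ≤
        (J f).map (algebraMap (R n) (Loc n)) := by
      rw [← Set.image_singleton, ← Ideal.map_span, ← Ideal.map_mul]
      refine Ideal.map_mono (Ideal.mul_le.mpr ?_)
      intro s hs y hy
      obtain ⟨c, rfl⟩ := Ideal.mem_span_singleton'.mp hy
      have := Ideal.mul_mem_left _ c (hk s hs)
      convert this using 1
      ring
    exact hle (Ideal.mul_mem_mul hxk (Ideal.mem_span_singleton_self _))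
  have hmem : algebraMap (R n) (Loc n) F ∈ (J f).map (algebraMap (R n) (Loc n)) := by
    have : ∀ j : ℕ, x ^ j * algebraMap (R n) (Loc n) F ∈ (J f).map (algebraMap (R n) (Loc n)) →
        algebraMap (R n) (Loc n) F ∈ (J f).map (algebraMap (R n) (Loc n)) := by
      intro j
      induction j with
      | zero => simp
      | succ j ih =>
        intro h
        rw [pow_succ', mul_assoc] at h
        exact ih (hreg _ h)
    exact this k hpow
  obtain ⟨⟨⟨y, hy⟩, ⟨w, hw⟩⟩, hz⟩ :=
    (IsLocalization.mem_map_algebraMap_iff (irr n).primeCompl (Loc n)).mp hmem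
  simp only at hz
  rw [← map_mul] at hz
  have hinj : Function.Injective (algebraMap (R n) (Loc n)) :=
    IsLocalization.injective _ (irr n).primeCompl_le_nonZeroDivisors
  have hFw : w * F ∈ J f := by
    rw [mul_comm, hinj hz]
    exact hy
  -- Descent from the local ring: the denominator `w` has nonzero constant term, so the degree `e`
  -- component of `w F` is a nonzero multiple of `F`, and `J_f` is homogeneous.
  have hw0 : coeff 0 w ≠ 0 := fun h => hw (mem_irr_iff.mpr h)
  have hcomp := homogeneousComponent_mem_of_mem hf.J_isHomogeneous hFw (0 + e)
  rw [homogeneousComponent_mul_of_isHomogeneous _ _ hF, homogeneousComponent_zero] at hcomp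
  have := Ideal.mul_mem_left _ (C (coeff 0 w)⁻¹) hcomp
  rwa [← mul_assoc, ← C_mul, inv_mul_cancel₀ hw0, C_1, one_mul] at this

/-- A homogeneous family that is part of a system of parameters defines a complete intersection. -/
theorem height_J_eq {t m : ℕ} {f : Fin t → R n} (hf : PosHomog f) (l : Fin m → R n)
    (hl : PosHomog l) (htm : t + m ≤ n + 1) {N : ℕ} (hN : irr n ^ N ≤ J f ⊔ J l) :
    (J f).height = t := by
  have hne : J f ≠ ⊤ := fun h => (irr_isMaximal (n := n)).ne_top (top_le_iff.mp (h ▸ hf.J_le_irr))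
  apply le_antisymm
  · refine (Ideal.height_le_spanFinrank _ hne).trans ?_
    have h1 := Submodule.spanFinrank_span_le_ncard_of_finite (R := R n)
      (s := Set.range f) (Set.finite_range _)
    have h2 : (Set.range f).ncard ≤ t := by
      rw [← Nat.card_coe_set_eq]
      exact (Finite.card_range_le _).trans (by simp)
    exact_mod_cast h1.trans h2
  -- Together `f` and `l` are at most `n + 1` elements generating an ideal primary to the maximal
  -- ideal, hence form a regular sequence; its initial part `f` is regular too.
  · have hreg := isWeaklyRegular_of_maximalIdeal_le_radical (A := Loc n) (M := Loc n)
      (locList f ++ locList l) (n + 1) extVanish_loc (by simpa [length_locList] using htm) (by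
        intro x hx
        rcases List.mem_append.mp hx with h | h
        · exact hf.locList_mem x h
        · exact hl.locList_mem x h) (by
        rw [Ideal.ofList_append, ofList_locList, ofList_locList, ← Ideal.map_sup]
        refine le_trans ?_ (Ideal.radical_mono le_sup_right)
        intro x hx
        refine ⟨N, Ideal.map_mono hN ?_⟩
        rw [Ideal.map_pow, Localization.AtPrime.map_eq_maximalIdeal]
        exact Ideal.pow_mem_pow hx N)
    rw [isWeaklyRegular_append_iff] at hreg
    rw [Ideal.height_eq_inf_minimalPrimes]
    refine le_iInf₂ fun p hp => ?_
    have hpp : p.IsPrime := hp.1.1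
    -- A minimal prime of a homogeneous ideal is homogeneous, so it lies in `irr n` and keeps its
    -- height in the localization.
    have hcore : (p.homogeneousCore (homogeneousSubmodule (Fin (n + 1)) ℂ)).toIdeal = p := by
      refine le_antisymm (Ideal.toIdeal_homogeneousCore_le _ _) (hp.2 ⟨hpp.homogeneousCore, ?_⟩
        (Ideal.toIdeal_homogeneousCore_le _ _))
      rw [← hf.J_isHomogeneous.toIdeal_homogeneousCore_eq_self]
      exact Ideal.homogeneousCore_mono _ hp.1.2
    have hhom : p.IsHomogeneous (homogeneousSubmodule (Fin (n + 1)) ℂ) :=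
      (Ideal.IsHomogeneous.iff_eq _ _).mpr hcore
    have hpm : p ≤ irr n := by
      intro F hF
      rw [mem_irr_iff]
      by_contra h0
      have := homogeneousComponent_mem_of_mem hhom hF 0
      rw [homogeneousComponent_zero] at this
      exact hpp.ne_top (Ideal.eq_top_of_isUnit_mem _ this ((Ne.isUnit h0).map C))
    have hdisj : Disjoint ((irr n).primeCompl : Set (R n)) (p : Set (R n)) :=
      Set.disjoint_left.mpr fun _ h1 h2 => h1 (hpm h2)
    have hq : (p.map (algebraMap (R n) (Loc n))).IsPrime :=
      IsLocalization.isPrime_of_isPrime_disjoint (irr n).primeCompl (Loc n) p hpp hdisj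
    have := length_le_height_of_isWeaklyRegular (locList f) hreg.1
      (p := p.map (algebraMap (R n) (Loc n))) (by
        rw [ofList_locList]
        exact Ideal.map_mono hp.1.2)
    rwa [length_locList, IsLocalization.height_map_of_disjoint (irr n).primeCompl p hdisj] at this

end IncidenceCI

end

noncomputable section

/-! ## The Jacobian criterion for algebraic independence -/

namespace JacobianCriterion

open MvPolynomial

variable {ι κ : Type*} [Fintype ι] [Fintype κ]

/-- The Jacobian of a family of polynomials at a point. -/
def jac (F : κ → MvPolynomial ι ℂ) (x : ι → ℂ) : (ι → ℂ) →ₗ[ℂ] (κ → ℂ) where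
  toFun y k := ∑ j, eval x (pderiv j (F k)) * y j
  map_add' y z := by ext k; simp [mul_add, Finset.sum_add_distrib]
  map_smul' c y := by ext k; simp [Finset.mul_sum, mul_left_comm]

omit [Fintype ι] in
lemma pderiv_aeval (F : κ → MvPolynomial ι ℂ) (Q : MvPolynomial κ ℂ) (j : ι) :
    pderiv j (aeval F Q) = ∑ k, aeval F (pderiv k Q) * pderiv j (F k) := by
  classical
  induction Q using MvPolynomial.induction_on with
  | C a => simp [algebraMap_eq]
  | add p q hp hq => simp only [map_add, hp, hq, add_mul, Finset.sum_add_distrib]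
  | mul_X p k hp =>
    have h : ∀ l, aeval F (pderiv l (p * X k)) =
        aeval F (pderiv l p) * F k + if l = k then aeval F p else 0 := by
      intro l
      rw [Derivation.leibniz, pderiv_X]
      by_cases hl : l = k
      · subst hl
        simp [mul_comm, add_comm]
      · rw [Pi.single_eq_of_ne (Ne.symm hl)]
        simp [hl, mul_comm]
    have e : aeval F (p * X k) = aeval F p * F k := by rw [map_mul, aeval_X]
    have e2 : pderiv j (aeval F p * F k) =
        aeval F p * pderiv j (F k) + F k * pderiv j (aeval F p) := by
      rw [Derivation.leibniz, smul_eq_mul, smul_eq_mul]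
    have hs : ∑ l, aeval F (pderiv l (p * X k)) * pderiv j (F l) =
        ∑ l, (aeval F (pderiv l p) * F k * pderiv j (F l) +
          if l = k then aeval F p * pderiv j (F l) else 0) :=
      Finset.sum_congr rfl fun l _ => by rw [h l, add_mul, ite_mul, zero_mul]
    rw [e, e2, hp, hs,
      Finset.sum_add_distrib, Finset.sum_ite_eq' Finset.univ k, if_pos (Finset.mem_univ k),
      Finset.mul_sum, add_comm]
    refine congrArg₂ (· + ·) (Finset.sum_congr rfl fun l _ => ?_) rfl
    rw [← mul_assoc, mul_comm (F k)]

/-- If the Jacobian is surjective at a point, then the polynomials are algebraically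
independent. -/
theorem algebraicIndependent_of_surjective_jac (F : κ → MvPolynomial ι ℂ) {x : ι → ℂ}
    (hx : Function.Surjective (jac F x)) : AlgebraicIndependent ℂ F := by
  classical
  choose S hS using fun l : κ => hx (Pi.single l 1)
  -- The columns are the differential of `F` applied to constant preimages of the standard basis
  -- vectors, so the matrix specializes to the identity at `x`.
  let Mat : Matrix κ κ (MvPolynomial ι ℂ) := fun k l => ∑ j, pderiv j (F k) * C (S l j)
  have hdet : Mat.det ≠ 0 := by
    intro h
    have h1 : (Mat.map (eval x)) = 1 := by
      ext k l
      have := congrFun (hS l) k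
      simp only [jac, LinearMap.coe_mk, AddHom.coe_mk] at this
      rw [Matrix.map_apply, Matrix.one_apply, map_sum]
      simp only [map_mul, eval_C, this, Pi.single_apply]
    have h2 := congrArg (eval x) h
    rw [RingHom.map_det, RingHom.mapMatrix_apply, h1] at h2
    simp at h2
  rw [algebraicIndependent_iff]
  suffices ∀ D : ℕ, ∀ Q : MvPolynomial κ ℂ, (∀ m ∈ Q.support, m.degree ≤ D) →
      aeval F Q = 0 → Q = 0 from
    fun Q hQ => this (Q.support.sup Finsupp.degree) Q (fun m hm => Finset.le_sup hm) hQ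
  have hconst : ∀ Q : MvPolynomial κ ℂ, (∀ m, m ≠ 0 → coeff m Q = 0) → aeval F Q = 0 →
      Q = 0 := by
    intro Q h h0
    have hQ : Q = C (coeff 0 Q) := by
      ext m
      rw [coeff_C]
      split_ifs with hm
      · rw [hm]
      · exact h m (Ne.symm hm)
    rw [hQ, aeval_C, algebraMap_eq, C_eq_zero] at h0
    rw [hQ, h0, C_0]
  intro D
  induction D with
  | zero =>
    intro Q hQ h0
    refine hconst Q (fun m hm => ?_) h0
    by_contra h
    have := hQ m (mem_support_iff.mpr h)
    exact hm ((Finsupp.degree_eq_zero_iff m).mp (by omega))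
  | succ D ih =>
    intro Q hQ h0
    -- By the chain rule the partial derivatives of a relation, evaluated at `F`, form a row vector
    -- killed by `Mat`. They are therefore relations of smaller degree, and vanish by induction.
    have hvec : (fun k => aeval F (pderiv k Q)) = 0 := by
      refine Matrix.eq_zero_of_vecMul_eq_zero hdet ?_
      ext1 l
      simp only [Matrix.vecMul, dotProduct, Mat, Finset.mul_sum, Pi.zero_apply]
      rw [Finset.sum_comm]
      refine Finset.sum_eq_zero fun j _ => ?_
      have := pderiv_aeval F Q j
      rw [h0, map_zero] at this
      simp only [← mul_assoc, ← Finset.sum_mul]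
      rw [← this, zero_mul]
    have hp : ∀ k, pderiv k Q = 0 := by
      intro k
      refine ih _ ?_ (congrFun hvec k)
      intro m hm
      rw [mem_support_iff, coeff_pderiv] at hm
      have := hQ (m + Finsupp.single k 1) (mem_support_iff.mpr (left_ne_zero_of_mul hm))
      rw [map_add, Finsupp.degree_single] at this
      omega
    refine hconst Q (fun m hm => ?_) h0
    obtain ⟨k, hk⟩ : ∃ k, m k ≠ 0 := by
      by_contra! h
      exact hm (Finsupp.ext h)
    have h1 := congrArg (coeff (m - Finsupp.single k 1)) (hp k)
    rw [coeff_pderiv, coeff_zero] at h1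
    have h2 : m - Finsupp.single k 1 + Finsupp.single k 1 = m :=
      tsub_add_cancel_of_le (by rw [Finsupp.single_le_iff]; omega)
    rw [h2] at h1
    exact (mul_eq_zero.mp h1).resolve_right (by norm_cast)

/-- Let `p` be a nonzero polynomial of least degree over `ℂ[T]` killing `s`. In characteristic zero
`p'` is nonzero of smaller degree, so `p'(s) ≠ 0`, and `0 = D(p(s)) = p'(s) D(s)`. -/
lemma derivation_eq_zero_of_isTranscendenceBasis {S K : Type*} [CommRing S] [IsDomain S]
    [Algebra ℂ S] [Field K] [Algebra S K] [FaithfulSMul S K] [Algebra ℂ K] [IsScalarTower ℂ S K]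
    {T : Set S} (hT : IsTranscendenceBasis ℂ ((↑) : T → S)) (D : Derivation ℂ S K)
    (hD : ∀ τ ∈ T, D τ = 0) : D = 0 := by
  classical
  have halg := hT.isAlgebraic
  rw [Subtype.range_coe] at halg
  have hker : ∀ c ∈ Algebra.adjoin ℂ T, D c = 0 := by
    intro c hc
    induction hc using Algebra.adjoin_induction with
    | mem x hx => exact hD x hx
    | algebraMap r => exact D.map_algebraMap r
    | add x y _ _ hx hy => rw [map_add, hx, hy, add_zero]
    | mul x y _ _ hx hy => rw [Derivation.leibniz, hx, hy, smul_zero, smul_zero, add_zero]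
  have hchain : ∀ (s : S) (p : Polynomial (Algebra.adjoin ℂ T)),
      D (Polynomial.aeval s p) = algebraMap S K (Polynomial.aeval s p.derivative) * D s := by
    intro s p
    induction p using Polynomial.induction_on' with
    | add p q hp hq => simp only [map_add, hp, hq, add_mul]
    | monomial m c =>
      rw [Polynomial.aeval_monomial, Polynomial.derivative_monomial, Polynomial.aeval_monomial,
        Derivation.leibniz, Derivation.leibniz_pow]
      have : D (algebraMap (Algebra.adjoin ℂ T) S c) = 0 := hker _ c.2
      rw [this, smul_zero, add_zero]
      simp only [nsmul_eq_mul]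
      simp only [Algebra.smul_def, map_mul, map_pow, map_natCast]
      ring
  ext s
  obtain ⟨p0, hp0, hp0s⟩ := halg.isAlgebraic s
  have hex : ∃ d : ℕ, ∃ p : Polynomial (Algebra.adjoin ℂ T), p ≠ 0 ∧ Polynomial.aeval s p = 0 ∧
      p.natDegree = d := ⟨_, p0, hp0, hp0s, rfl⟩
  obtain ⟨p, hp, hps, hdeg⟩ := Nat.find_spec hex
  have hder : Polynomial.aeval s p.derivative ≠ 0 := by
    intro h
    have hpos : p.natDegree ≠ 0 := by
      intro h0
      rw [Polynomial.eq_C_of_natDegree_eq_zero h0, Polynomial.aeval_C] at hps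
      have : p.coeff 0 = 0 := Subtype.ext hps
      rw [Polynomial.eq_C_of_natDegree_eq_zero h0, this, Polynomial.C_0] at hp
      exact hp rfl
    have hlt := Polynomial.natDegree_derivative_lt hpos
    rw [hdeg] at hlt
    have : CharZero (Algebra.adjoin ℂ T) := 
      charZero_of_injective_algebraMap (algebraMap ℂ (Algebra.adjoin ℂ T)).injective
    have : IsAddTorsionFree (Algebra.adjoin ℂ T) := .of_isCancelMulZero_charZero
    refine Nat.find_min hex hlt ⟨p.derivative, ?_, h, rfl⟩
    intro h0
    have := Polynomial.derivative_eq_zero.mp h0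
    exact hpos this
  have := hchain s p
  rw [hps, map_zero] at this
  rcases mul_eq_zero.mp this.symm with h | h
  · exact absurd ((FaithfulSMul.algebraMap_injective S K) (h.trans (map_zero _).symm)) hder
  · simpa using h

/-- The Jacobian of algebraically independent polynomials is surjective at some point. -/
theorem exists_surjective_jac_of_algebraicIndependent (K : Type*) [Field K]
    [Algebra (MvPolynomial ι ℂ) K] [IsFractionRing (MvPolynomial ι ℂ) K] [Algebra ℂ K]
    [IsScalarTower ℂ (MvPolynomial ι ℂ) K] (F : κ → MvPolynomial ι ℂ)
    (hF : AlgebraicIndependent ℂ F) : ∃ x, Function.Surjective (jac F x) := by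
  classical
  have hinj := hF.injective
  -- Completing `F` to a transcendence basis makes the Jacobian matrix square, as all transcendence
  -- bases have the cardinality of `ι`.
  obtain ⟨T, hFT, hT⟩ := exists_isTranscendenceBasis_superset (R := ℂ) (A := MvPolynomial ι ℂ)
    (s := Set.range F) hF.coe_range
  have hX : IsTranscendenceBasis ℂ (X : ι → MvPolynomial ι ℂ) := IsTranscendenceBasis.mvPolynomial ι ℂ
  have hcard := hX.lift_cardinalMk_eq hT
  have : FaithfulSMul (MvPolynomial ι ℂ) K :=
    (faithfulSMul_iff_algebraMap_injective _ _).mpr (IsFractionRing.injective _ K)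
  have hfin : Finite T := by
    rw [← Cardinal.lt_aleph0_iff_finite]
    have h1 : Cardinal.lift.{_} (Cardinal.mk ι) < Cardinal.aleph0 := by
      rw [Cardinal.lift_lt_aleph0]
      exact Cardinal.lt_aleph0_of_finite ι
    rw [hcard, Cardinal.lift_lt_aleph0] at h1
    exact h1
  have : Fintype T := Fintype.ofFinite T
  have hcard' : Fintype.card ι = Fintype.card T := by
    simpa using hcard
  let Ψ : (ι → K) →ₗ[K] (T → K) :=
    { toFun := fun y τ => ∑ j, algebraMap (MvPolynomial ι ℂ) K (pderiv j (τ : MvPolynomial ι ℂ)) * y j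
      map_add' := fun y z => by ext k; simp [mul_add, Finset.sum_add_distrib]
      map_smul' := fun c y => by
        ext k
        simp only [Pi.smul_apply, smul_eq_mul, RingHom.id_apply, Finset.mul_sum]
        exact Finset.sum_congr rfl fun j _ => mul_left_comm _ _ _ }
  have hDer : ∀ (y : ι → K) (s : MvPolynomial ι ℂ),
      mkDerivation ℂ y s = ∑ j, algebraMap (MvPolynomial ι ℂ) K (pderiv j s) * y j := by
    intro y s
    induction s using MvPolynomial.induction_on with
    | C a => simp [derivation_C]
    | add p q hp hq => simp only [map_add, hp, hq, add_mul, Finset.sum_add_distrib]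
    | mul_X p k hp =>
      rw [Derivation.leibniz, hp, mkDerivation_X]
      simp only [Derivation.leibniz, pderiv_X, smul_eq_mul, map_add, map_mul, add_mul,
        Finset.sum_add_distrib, Algebra.smul_def]
      congr 1
      · rw [Finset.sum_eq_single k]
        · simp
        · intro j _ hj
          rw [Pi.single_eq_of_ne (Ne.symm hj)]
          simp
        · simp
      · rw [Finset.mul_sum]
        exact Finset.sum_congr rfl fun j _ => by ring
  -- A kernel vector `y` defines the derivation `∑ y_j ∂_j`, which kills the transcendence basis and
  -- hence is zero.
  have hΨ : Function.Injective Ψ := by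
    rw [← LinearMap.ker_eq_bot, LinearMap.ker_eq_bot']
    intro y hy
    have hD := derivation_eq_zero_of_isTranscendenceBasis hT (mkDerivation ℂ y) (by
      intro τ hτ
      rw [hDer]
      exact congrFun hy ⟨τ, hτ⟩)
    ext j
    have := mkDerivation_X ℂ y j
    rw [hD] at this
    simpa using this.symm
  have hsurj : Function.Surjective Ψ :=
    (LinearMap.injective_iff_surjective_of_finrank_eq_finrank (by
      rw [Module.finrank_fintype_fun_eq_card, Module.finrank_fintype_fun_eq_card, hcard'])).mp hΨ
  choose Y hY using fun k : κ => hsurj (Pi.single ⟨F k, hFT ⟨k, rfl⟩⟩ 1)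
  -- Clearing denominators turns the right inverse over the fraction field into polynomial
  -- identities, which specialize wherever `d` is nonzero.
  obtain ⟨d, hd⟩ := IsLocalization.exist_integer_multiples_of_finite (nonZeroDivisors (MvPolynomial ι ℂ))
    (fun p : κ × ι => Y p.1 p.2)
  choose Z hZ using hd
  have hd0 : (d : MvPolynomial ι ℂ) ≠ 0 := nonZeroDivisors.ne_zero d.2
  have hrel : ∀ k l, ∑ j, pderiv j (F l) * Z (k, j) = if l = k then (d : MvPolynomial ι ℂ) else 0 := by
    intro k l
    apply IsFractionRing.injective (MvPolynomial ι ℂ) K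
    have h1 := congrFun (hY k) ⟨F l, hFT ⟨l, rfl⟩⟩
    simp only [Ψ, LinearMap.coe_mk, AddHom.coe_mk] at h1
    rw [map_sum]
    simp only [map_mul, hZ, Algebra.smul_def]
    simp only [mul_left_comm _ (algebraMap (MvPolynomial ι ℂ) K (d : MvPolynomial ι ℂ))]
    rw [← Finset.mul_sum, h1, Pi.single_apply]
    simp only [Subtype.mk.injEq, hinj.eq_iff]
    split_ifs <;> simp
  obtain ⟨x, hx⟩ : ∃ x, eval x (d : MvPolynomial ι ℂ) ≠ 0 := by
    by_contra! h
    exact hd0 (MvPolynomial.funext fun x => by rw [h x, map_zero])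
  refine ⟨x, fun v => ⟨fun j => ∑ k, eval x (Z (k, j)) * ((eval x (d : MvPolynomial ι ℂ))⁻¹ * v k), ?_⟩⟩
  ext l
  simp only [jac, LinearMap.coe_mk, AddHom.coe_mk, Finset.mul_sum]
  rw [Finset.sum_comm]
  simp only [← mul_assoc, ← Finset.sum_mul]
  have h2 : ∀ k, ∑ j, eval x (pderiv j (F l)) * eval x (Z (k, j)) =
      if l = k then eval x (d : MvPolynomial ι ℂ) else 0 := by
    intro k
    have := congrArg (eval x) (hrel k l)
    rw [map_sum] at this
    simp only [map_mul] at this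
    rw [this]
    split_ifs <;> simp
  simp only [h2, ite_mul, zero_mul, Finset.sum_ite_eq, Finset.mem_univ, if_true]
  field_simp

end JacobianCriterion

end

noncomputable section

/-! ## Polynomial functions and the Zariski topology -/

namespace IncidenceCI

variable {W W' : Type*} [AddCommGroup W] [Module ℂ W] [AddCommGroup W'] [Module ℂ W']

lemma dual_mem_polyFun (φ : Module.Dual ℂ W) : (fun w => φ w) ∈ polyFun W :=
  Algebra.subset_adjoin ⟨φ, rfl⟩

lemma const_mem_polyFun (z : ℂ) : (fun _ : W => z) ∈ polyFun W :=
  (polyFun W).algebraMap_mem z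

lemma polyFun_mul {p q : W → ℂ} (hp : p ∈ polyFun W) (hq : q ∈ polyFun W) :
    (fun w => p w * q w) ∈ polyFun W := mul_mem hp hq

lemma polyFun_add {p q : W → ℂ} (hp : p ∈ polyFun W) (hq : q ∈ polyFun W) :
    (fun w => p w + q w) ∈ polyFun W := add_mem hp hq

lemma polyFun_sum {ι : Type*} (s : Finset ι) {p : ι → W → ℂ} (hp : ∀ i ∈ s, p i ∈ polyFun W) :
    (fun w => ∑ i ∈ s, p i w) ∈ polyFun W := by
  have := sum_mem hp
  convert this
  simp

lemma polyFun_prod {ι : Type*} (s : Finset ι) {p : ι → W → ℂ} (hp : ∀ i ∈ s, p i ∈ polyFun W) :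
    (fun w => ∏ i ∈ s, p i w) ∈ polyFun W := by
  have := prod_mem hp
  convert this
  simp

lemma polyFun_det {ι : Type*} [Fintype ι] [DecidableEq ι] {M : W → Matrix ι ι ℂ}
    (h : ∀ i j, (fun w => M w i j) ∈ polyFun W) : (fun w => (M w).det) ∈ polyFun W := by
  simp only [Matrix.det_apply']
  exact polyFun_sum _ fun σ _ => polyFun_mul (const_mem_polyFun _) (polyFun_prod _ fun i _ => h _ _)

lemma polyFun_comp {φ : W' → W} (hφ : ∀ ψ : Module.Dual ℂ W, (fun w => ψ (φ w)) ∈ polyFun W')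
    {p : W → ℂ} (hp : p ∈ polyFun W) : (fun w => p (φ w)) ∈ polyFun W' := by
  induction hp using Algebra.adjoin_induction with
  | mem x hx => obtain ⟨ψ, rfl⟩ := hx; exact hφ ψ
  | algebraMap r => exact const_mem_polyFun r
  | add x y _ _ hx hy => exact polyFun_add hx hy
  | mul x y _ _ hx hy => exact polyFun_mul hx hy

lemma polyFun_comp_linear (φ : W' →ₗ[ℂ] W) {p : W → ℂ} (hp : p ∈ polyFun W) :
    (fun w => p (φ w)) ∈ polyFun W' :=
  polyFun_comp (fun ψ => dual_mem_polyFun (ψ ∘ₗ φ)) hp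

lemma exists_polyFun_extension (S : Submodule ℂ W) {p : S → ℂ} (hp : p ∈ polyFun S) :
    ∃ P ∈ polyFun W, ∀ s : S, P s = p s := by
  induction hp using Algebra.adjoin_induction with
  | mem x hx =>
    obtain ⟨ψ, rfl⟩ := hx
    obtain ⟨φ, hφ⟩ := LinearMap.exists_extend ψ
    exact ⟨_, dual_mem_polyFun φ, fun s => LinearMap.congr_fun hφ s⟩
  | algebraMap r => exact ⟨_, const_mem_polyFun r, fun s => rfl⟩
  | add x y _ _ hx hy =>
    obtain ⟨P, hP, hP'⟩ := hx
    obtain ⟨Q, hQ, hQ'⟩ := hy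
    exact ⟨_, polyFun_add hP hQ, fun s => by simp [hP', hQ']⟩
  | mul x y _ _ hx hy =>
    obtain ⟨P, hP, hP'⟩ := hx
    obtain ⟨Q, hQ, hQ'⟩ := hy
    exact ⟨_, polyFun_mul hP hQ, fun s => by simp [hP', hQ']⟩

lemma isOpen_ne_zero {p : W → ℂ} (hp : p ∈ polyFun W) :
    @IsOpen W (zariski W) {w | p w ≠ 0} :=
  TopologicalSpace.isOpen_generateFrom_of_mem ⟨p, hp, rfl⟩

lemma exists_polyFun_of_isOpen {U : Set W} (hU : @IsOpen W (zariski W) U) {x : W} (hx : x ∈ U) :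
    ∃ p ∈ polyFun W, p x ≠ 0 ∧ ∀ y, p y ≠ 0 → y ∈ U := by
  induction hU with
  | basic s hs =>
    obtain ⟨p, hp, rfl⟩ := hs
    exact ⟨p, hp, hx, fun y hy => hy⟩
  | univ => exact ⟨_, const_mem_polyFun 1, one_ne_zero, fun y _ => trivial⟩
  | inter s t _ _ hs ht =>
    obtain ⟨p, hp, hpx, hps⟩ := hs hx.1
    obtain ⟨q, hq, hqx, hqt⟩ := ht hx.2
    exact ⟨_, polyFun_mul hp hq, mul_ne_zero hpx hqx, fun y hy =>
      ⟨hps y (left_ne_zero_of_mul hy), hqt y (right_ne_zero_of_mul hy)⟩⟩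
  | sUnion S _ hS =>
    obtain ⟨s, hs, hxs⟩ := hx
    obtain ⟨p, hp, hpx, hps⟩ := hS s hs hxs
    exact ⟨p, hp, hpx, fun y hy => ⟨s, hs, hps y hy⟩⟩

lemma polyFun_line {p : W → ℂ} (hp : p ∈ polyFun W) (x y : W) :
    ∃ P : Polynomial ℂ, ∀ t : ℂ, P.eval t = p (x + t • y) := by
  induction hp using Algebra.adjoin_induction with
  | mem p hp =>
    obtain ⟨ψ, rfl⟩ := hp
    exact ⟨Polynomial.C (ψ x) + Polynomial.C (ψ y) * Polynomial.X, fun t => by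
      simp only [Polynomial.eval_add, Polynomial.eval_mul, Polynomial.eval_C, Polynomial.eval_X,
        map_add, map_smul, smul_eq_mul, mul_comm]⟩
  | algebraMap r => exact ⟨Polynomial.C r, fun t => by simp [Pi.algebraMap_apply]⟩
  | add p q _ _ hp hq =>
    obtain ⟨P, hP⟩ := hp
    obtain ⟨Q, hQ⟩ := hq
    exact ⟨P + Q, fun t => by simp [hP, hQ]⟩
  | mul p q _ _ hp hq =>
    obtain ⟨P, hP⟩ := hp
    obtain ⟨Q, hQ⟩ := hq
    exact ⟨P * Q, fun t => by simp [hP, hQ]⟩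

/-- Irreducibility of `W`, by restriction to the line through `x` and `y`, where both functions
become nonzero polynomials in one variable. -/
lemma exists_mul_ne_zero {p q : W → ℂ} (hp : p ∈ polyFun W) (hq : q ∈ polyFun W) {x y : W}
    (hx : p x ≠ 0) (hy : q y ≠ 0) : ∃ z, p z ≠ 0 ∧ q z ≠ 0 := by
  obtain ⟨P, hP⟩ := polyFun_line hp x (y - x)
  obtain ⟨Q, hQ⟩ := polyFun_line hq x (y - x)
  have hP0 : P ≠ 0 := by
    rintro rfl
    exact hx (by simpa using (hP 0).symm)
  have hQ0 : Q ≠ 0 := by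
    rintro rfl
    exact hy (by simpa using (hQ 1).symm)
  obtain ⟨t, ht⟩ : ∃ t, (P * Q).eval t ≠ 0 := by
    by_contra! h
    exact mul_ne_zero hP0 hQ0 (Polynomial.funext fun t => by rw [h t, Polynomial.eval_zero])
  rw [Polynomial.eval_mul] at ht
  exact ⟨_, by rw [← hP]; exact left_ne_zero_of_mul ht, by rw [← hQ]; exact right_ne_zero_of_mul ht⟩

lemma ForGeneral.of_polyFun {P : W → Prop} {p : W → ℂ} (hp : p ∈ polyFun W) {x : W} (hx : p x ≠ 0)
    (h : ∀ y, p y ≠ 0 → P y) : ForGeneral W P :=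
  ⟨_, isOpen_ne_zero hp, ⟨x, hx⟩, h⟩

lemma ForGeneral.exists_polyFun {P : W → Prop} (h : ForGeneral W P) :
    ∃ p ∈ polyFun W, (∃ x, p x ≠ 0) ∧ ∀ y, p y ≠ 0 → P y := by
  obtain ⟨U, hU, ⟨x, hx⟩, hP⟩ := h
  obtain ⟨p, hp, hpx, hpU⟩ := exists_polyFun_of_isOpen hU hx
  exact ⟨p, hp, ⟨x, hpx⟩, fun y hy => hP y (hpU y hy)⟩

lemma ForGeneral.and {P Q : W → Prop} (hP : ForGeneral W P) (hQ : ForGeneral W Q) :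
    ForGeneral W fun w => P w ∧ Q w := by
  obtain ⟨p, hp, ⟨x, hx⟩, hP⟩ := hP.exists_polyFun
  obtain ⟨q, hq, ⟨y, hy⟩, hQ⟩ := hQ.exists_polyFun
  obtain ⟨z, hz, hz'⟩ := exists_mul_ne_zero hp hq hx hy
  exact .of_polyFun (polyFun_mul hp hq) (mul_ne_zero hz hz') fun y hy =>
    ⟨hP y (left_ne_zero_of_mul hy), hQ y (right_ne_zero_of_mul hy)⟩

lemma ForGeneral.mono {P Q : W → Prop} (hP : ForGeneral W P) (h : ∀ w, P w → Q w) :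
    ForGeneral W Q := by
  obtain ⟨U, hU, hne, hP⟩ := hP
  exact ⟨U, hU, hne, fun w hw => h w (hP w hw)⟩

lemma ForGeneral.exists {P : W → Prop} (hP : ForGeneral W P) : ∃ w, P w := by
  obtain ⟨U, hU, ⟨w, hw⟩, hP⟩ := hP
  exact ⟨w, hP w hw⟩

/-- Surjectivity is an open condition on families of linear maps with polynomial coefficients. -/
lemma exists_polyFun_surjective {X V : Type*} [AddCommGroup X] [Module ℂ X] [AddCommGroup V]
    [Module ℂ V] [FiniteDimensional ℂ W] (L : X → V →ₗ[ℂ] W)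
    (hL : ∀ v (ψ : Module.Dual ℂ W), (fun x => ψ (L x v)) ∈ polyFun X) {x : X}
    (hx : Function.Surjective (L x)) :
    ∃ p ∈ polyFun X, p x ≠ 0 ∧ ∀ y, p y ≠ 0 → Function.Surjective (L y) := by
  -- With a right inverse `σ` of `L x` fixed, `det (L y ∘ σ)` is polynomial in `y`, equals `1` at
  -- `x`, and detects surjectivity where it is nonzero.
  obtain ⟨σ, hσ⟩ := (L x).exists_rightInverse_of_surjective (LinearMap.range_eq_top.mpr hx)
  let b := Module.finBasis ℂ W
  refine ⟨fun y => (LinearMap.toMatrix b b (L y ∘ₗ σ)).det, ?_, ?_, ?_⟩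
  · refine polyFun_det fun i j => ?_
    simp only [LinearMap.toMatrix_apply, LinearMap.comp_apply]
    exact hL (σ (b j)) (b.coord i)
  · simp only [hσ, LinearMap.toMatrix_id, Matrix.det_one]
    exact one_ne_zero
  · intro y hy
    have hu : IsUnit (L y ∘ₗ σ) := by
      have h1 : IsUnit (LinearMap.toMatrix b b (L y ∘ₗ σ)) :=
        (Matrix.isUnit_iff_isUnit_det _).mpr (Ne.isUnit hy)
      exact (LinearMap.isUnit_toMatrix_iff b).mp h1
    have hs : Function.Surjective (L y ∘ₗ σ) := ((Module.End.isUnit_iff _).mp hu).2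
    intro w
    obtain ⟨w', hw'⟩ := hs w
    exact ⟨σ w', hw'⟩

lemma exists_mvPolynomial_of_polyFun {κ : Type*} (b : Module.Basis κ ℂ W) [Finite κ] {p : W → ℂ}
    (hp : p ∈ polyFun W) : ∃ Q : MvPolynomial κ ℂ, ∀ w, p w = MvPolynomial.eval (b.repr w) Q := by
  have := Fintype.ofFinite κ
  induction hp using Algebra.adjoin_induction with
  | mem p hp =>
    obtain ⟨ψ, rfl⟩ := hp
    refine ⟨∑ k, MvPolynomial.C (ψ (b k)) * MvPolynomial.X k, fun w => ?_⟩
    have h := congrArg ψ (b.sum_repr w)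
    rw [map_sum] at h
    refine h.symm.trans ?_
    simp [mul_comm]
  | algebraMap r => exact ⟨MvPolynomial.C r, fun w => by simp [Pi.algebraMap_apply]⟩
  | add p q _ _ hp hq =>
    obtain ⟨P, hP⟩ := hp
    obtain ⟨Q, hQ⟩ := hq
    exact ⟨P + Q, fun t => by simp [hP, hQ]⟩
  | mul p q _ _ hp hq =>
    obtain ⟨P, hP⟩ := hp
    obtain ⟨Q, hQ⟩ := hq
    exact ⟨P * Q, fun t => by simp [hP, hQ]⟩

lemma eval_mem_polyFun {κ : Type*} (b : Module.Basis κ ℂ W) (Q : MvPolynomial κ ℂ) :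
    (fun w => MvPolynomial.eval (b.repr w) Q) ∈ polyFun W := by
  induction Q using MvPolynomial.induction_on with
  | C a => simpa using const_mem_polyFun a
  | add p q hp hq => simpa using polyFun_add hp hq
  | mul_X p k hp => simpa using polyFun_mul hp (dual_mem_polyFun (b.coord k))

lemma eval_aeval_eq {ι κ : Type*} (F : κ → MvPolynomial ι ℂ) (x : ι → ℂ)
    (Q : MvPolynomial κ ℂ) : MvPolynomial.eval x (MvPolynomial.aeval F Q) =
      MvPolynomial.eval (fun k => MvPolynomial.eval x (F k)) Q := by
  induction Q using MvPolynomial.induction_on with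
  | C a => simp [MvPolynomial.algebraMap_eq]
  | add p q hp hq => rw [map_add, map_add, map_add, hp, hq]
  | mul_X p k hp => rw [map_mul, map_mul, map_mul, hp, MvPolynomial.aeval_X, MvPolynomial.eval_X]

-- Algebraic relations among the coordinates of `x ↦ B(x, x)` are the same as polynomial functions
-- on `W` vanishing on its image.
open MvPolynomial in
lemma algebraicIndependent_iff_of_eval {V ι κ : Type*} [AddCommGroup V] [Module ℂ V] [Fintype ι]
    [Fintype κ] (v : Module.Basis ι ℂ V) (w : Module.Basis κ ℂ W) (B : V →ₗ[ℂ] V →ₗ[ℂ] W)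
    (F : κ → MvPolynomial ι ℂ)
    (hF : ∀ (x : ι → ℂ) (k), eval x (F k) = w.repr (B (∑ i, x i • v i) (∑ i, x i • v i)) k) :
    AlgebraicIndependent ℂ F ↔ ∀ p ∈ polyFun W, (∀ x, p (B x x) = 0) → p = 0 := by
  rw [algebraicIndependent_iff]
  constructor
  · intro h p hp h0
    obtain ⟨Q, hQ⟩ := exists_mvPolynomial_of_polyFun w hp
    have : Q = 0 := by
      refine h Q (MvPolynomial.funext fun x => ?_)
      have h2 := h0 (∑ i, x i • v i)
      have e : (fun k => eval x (F k)) = w.repr (B (∑ i, x i • v i) (∑ i, x i • v i)) :=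
        funext (hF x)
      rw [hQ] at h2
      rw [eval_aeval_eq, e, h2, map_zero]
    ext z
    rw [hQ, this, map_zero, Pi.zero_apply]
  · intro h Q hQ
    have h1 := h _ (eval_mem_polyFun w Q) (by
      intro x
      have h2 := congrArg (eval (v.repr x)) hQ
      have e : (fun k => eval (v.repr x) (F k)) = w.repr (B x x) :=
        funext fun k => by rw [hF, v.sum_repr]
      rwa [eval_aeval_eq, map_zero, e] at h2)
    refine MvPolynomial.funext fun x => ?_
    have h2 : eval (w.repr (∑ k, x k • w k)) Q = 0 := congrFun h1 (∑ k, x k • w k)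
    rw [map_zero]
    rw [w.repr_sum_self] at h2
    exact h2

open MvPolynomial JacobianCriterion in
/-- The quadratic map `x ↦ B(x, x)` is dominant if and only if its differential
`y ↦ B(x, y) + B(y, x)` is surjective at some point. -/
theorem exists_surjective_differential_iff {V : Type*} [AddCommGroup V] [Module ℂ V]
    [FiniteDimensional ℂ V] [FiniteDimensional ℂ W] (B : V →ₗ[ℂ] V →ₗ[ℂ] W) :
    (∃ x, Function.Surjective fun y => B x y + B y x) ↔
      ∀ p ∈ polyFun W, (∀ x, p (B x x) = 0) → p = 0 := by
  classical
  let v := Module.finBasis ℂ V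
  let w := Module.finBasis ℂ W
  let F : Fin (Module.finrank ℂ W) → MvPolynomial (Fin (Module.finrank ℂ V)) ℂ := fun k =>
    ∑ i, ∑ j, C (w.coord k (B (v i) (v j))) * (X i * X j)
  have hB : ∀ (k) (x y : Fin (Module.finrank ℂ V) → ℂ),
      w.coord k (B (∑ i, x i • v i) (∑ j, y j • v j)) =
        ∑ i, ∑ j, w.coord k (B (v i) (v j)) * (x i * y j) := by
    intro k x y
    simp only [map_sum, LinearMap.sum_apply, map_smul, LinearMap.smul_apply, smul_eq_mul,
      Finset.mul_sum]
    rw [Finset.sum_comm]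
    exact Finset.sum_congr rfl fun i _ => Finset.sum_congr rfl fun j _ => by ring
  have hF : ∀ (x : Fin (Module.finrank ℂ V) → ℂ) (k),
      eval x (F k) = w.repr (B (∑ i, x i • v i) (∑ i, x i • v i)) k := by
    intro x k
    rw [← Module.Basis.coord_apply, hB]
    simp [F]
  have hjac : ∀ (x y : Fin (Module.finrank ℂ V) → ℂ) (k), jac F x y k =
      w.repr (B (∑ i, x i • v i) (∑ i, y i • v i) + B (∑ i, y i • v i) (∑ i, x i • v i)) k := by
    intro x y k
    rw [← Module.Basis.coord_apply, map_add, hB, hB]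
    have hp : ∀ l, eval x (pderiv l (F k)) = ∑ i, ∑ j, w.coord k (B (v i) (v j)) *
        ((if i = l then x j else 0) + (if j = l then x i else 0)) := by
      intro l
      simp only [F, map_sum, Derivation.leibniz, pderiv_C, pderiv_X,
        smul_eq_mul, map_mul, eval_C, map_add, eval_X, Pi.single_apply]
      refine Finset.sum_congr rfl fun i _ => Finset.sum_congr rfl fun j _ => ?_
      by_cases h1 : i = l <;> by_cases h2 : j = l <;> simp [h1, h2]
    simp only [jac, LinearMap.coe_mk, AddHom.coe_mk, hp, Finset.sum_mul]
    rw [Finset.sum_comm, ← Finset.sum_add_distrib]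
    refine Finset.sum_congr rfl fun i _ => ?_
    rw [Finset.sum_comm, ← Finset.sum_add_distrib]
    refine Finset.sum_congr rfl fun j _ => ?_
    simp only [mul_add, add_mul, Finset.sum_add_distrib, mul_ite, mul_zero, ite_mul, zero_mul,
      Finset.sum_ite_eq, Finset.mem_univ, if_true]
    ring
  rw [← algebraicIndependent_iff_of_eval v w B F hF]
  have hsurj : ∀ x : Fin (Module.finrank ℂ V) → ℂ, Function.Surjective (jac F x) ↔
      Function.Surjective fun y => B (∑ i, x i • v i) y + B y (∑ i, x i • v i) := by
    intro x
    constructor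
    · intro h z
      obtain ⟨y, hy⟩ := h (w.repr z)
      refine ⟨∑ i, y i • v i, w.repr.injective (Finsupp.ext fun k => ?_)⟩
      rw [← hjac, hy]
    · intro h z
      obtain ⟨y, hy⟩ := h (∑ k, z k • w k)
      refine ⟨v.repr y, funext fun k => ?_⟩
      rw [hjac, v.sum_repr]
      simp only at hy
      rw [hy, w.repr_sum_self]
  constructor
  · rintro ⟨x, hx⟩
    refine algebraicIndependent_of_surjective_jac F (x := v.repr x) ((hsurj _).mpr ?_)
    rwa [v.sum_repr]
  · intro h
    obtain ⟨x, hx⟩ := exists_surjective_jac_of_algebraicIndependent 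
      (FractionRing (MvPolynomial (Fin (Module.finrank ℂ V)) ℂ)) F h
    exact ⟨_, (hsurj x).mp hx⟩

end IncidenceCI

end

noncomputable section

/-! ## Homogeneous elements, the point `o` and gradients -/

namespace IncidenceCI

open MvPolynomial

variable {n : ℕ}

lemma homog_of_nonneg {d : ℤ} (hd : 0 ≤ d) :
    homog n d = homogeneousSubmodule (Fin (n + 1)) ℂ d.toNat := if_pos hd

lemma homog_of_neg {d : ℤ} (hd : d < 0) : homog n d = ⊥ := if_neg (not_le.mpr hd)

lemma mem_homog {d : ℤ} {F : R n} :
    F ∈ homog n d ↔ (0 ≤ d ∧ F.IsHomogeneous d.toNat) ∨ F = 0 := by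
  rcases lt_or_ge d 0 with hd | hd
  · rw [homog_of_neg hd, Submodule.mem_bot]
    exact ⟨Or.inr, fun h => h.resolve_left fun h => absurd h.1 (not_le.mpr hd)⟩
  · rw [homog_of_nonneg hd, mem_homogeneousSubmodule]
    refine ⟨fun h => Or.inl ⟨hd, h⟩, ?_⟩
    rintro (h | rfl)
    · exact h.2
    · exact isHomogeneous_zero _ _ _

lemma mem_homog_of_isHomogeneous {d : ℕ} {F : R n} (h : F.IsHomogeneous d) {e : ℤ} (he : e = d) :
    F ∈ homog n e := by
  subst he
  exact mem_homog.mpr (Or.inl ⟨by omega, by simpa using h⟩)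

instance (d : ℤ) : FiniteDimensional ℂ (homog n d) := by
  rw [← Submodule.fg_iff_finiteDimensional]
  rcases lt_or_ge d 0 with hd | hd
  · rw [homog_of_neg hd]
    exact Submodule.fg_bot
  · rw [homog_of_nonneg hd]
    exact homogeneousSubmodule_fg _ _ _

lemma homog_mul {d e : ℤ} {F G : R n} (hF : F ∈ homog n d) (hG : G ∈ homog n e) :
    F * G ∈ homog n (d + e) := by
  rcases mem_homog.mp hF with ⟨hd, hF⟩ | rfl
  · rcases mem_homog.mp hG with ⟨he, hG⟩ | rfl
    · exact mem_homog_of_isHomogeneous (hF.mul hG) (by push_cast; omega)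
    · simp
  · simp

lemma X_pow_mem_homog (i : Fin (n + 1)) {d : ℤ} (hd : 0 ≤ d) :
    (X i : R n) ^ d.toNat ∈ homog n d :=
  mem_homog_of_isHomogeneous (isHomogeneous_X_pow i _) (by omega)

lemma X_mem_homog (i : Fin (n + 1)) : (X i : R n) ∈ homog n 1 :=
  mem_homog_of_isHomogeneous (isHomogeneous_X ℂ i) (by simp)

/-- The homogeneous component of degree `d`. -/
def comp (n : ℕ) (d : ℤ) : R n →ₗ[ℂ] R n :=
  if 0 ≤ d then homogeneousComponent d.toNat else 0

lemma comp_mem (d : ℤ) (F : R n) : comp n d F ∈ homog n d := by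
  rw [comp]
  split_ifs with hd
  · rw [homog_of_nonneg hd]
    exact homogeneousComponent_mem _ _
  · exact zero_mem _

lemma comp_eq_self {d : ℤ} {F : R n} (hF : F ∈ homog n d) : comp n d F = F := by
  rcases mem_homog.mp hF with ⟨hd, hF⟩ | rfl
  · rw [comp, if_pos hd]
    exact homogeneousComponent_eq_self hF
  · exact map_zero _

lemma comp_of_isHomogeneous {k : ℕ} {F : R n} (hF : F.IsHomogeneous k) (d : ℤ) :
    comp n d F = if d = k then F else 0 := by
  rw [comp]
  split_ifs with h1 h2 h2
  · subst h2
    exact homogeneousComponent_eq_self (by simpa using hF)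
  · rw [homogeneousComponent_of_mem hF, if_neg (by omega)]
  · omega
  · rfl

lemma comp_mul {d e : ℤ} (c : R n) {F : R n} (hF : F ∈ homog n e) :
    comp n d (c * F) = comp n (d - e) c * F := by
  rcases mem_homog.mp hF with ⟨he, hF⟩ | rfl
  · conv_lhs => rw [← sum_homogeneousComponent c, Finset.sum_mul, map_sum]
    conv_rhs => rw [← sum_homogeneousComponent c, map_sum, Finset.sum_mul]
    refine Finset.sum_congr rfl fun i _ => ?_
    have h1 := homogeneousComponent_isHomogeneous i c
    rw [comp_of_isHomogeneous (h1.mul hF), comp_of_isHomogeneous h1]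
    by_cases h : d - e = i
    · rw [if_pos h, if_pos (by push_cast; omega)]
    · rw [if_neg h, if_neg (by push_cast; omega), zero_mul]
  · simp

lemma mem_piece_zero {t : ℕ} {c : Fin t → ℤ} {f : Fin t → R n} :
    f ∈ piece n c 0 ↔ ∀ i, f i ∈ homog n (c i) := by
  simp [piece, Submodule.mem_pi]

instance {t : ℕ} (c : Fin t → ℤ) (d : ℤ) : FiniteDimensional ℂ (piece n c d) := by
  let φ : piece n c d →ₗ[ℂ] (∀ i, homog n (c i + d)) :=
    LinearMap.pi fun i => (LinearMap.proj i ∘ₗ (piece n c d).subtype).codRestrict _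
      fun f => (Submodule.mem_pi.mp f.2) i (Set.mem_univ i)
  refine FiniteDimensional.of_injective φ fun f g h => ?_
  ext1
  funext i
  exact congrArg Subtype.val (congrFun h i)

lemma mem_J_iff {t : ℕ} {f : Fin t → R n} {F : R n} :
    F ∈ J f ↔ ∃ c : Fin t → R n, ∑ i, c i * f i = F := by
  rw [J, Ideal.mem_span_range_iff_exists_fun]

lemma mem_J_self {t : ℕ} (f : Fin t → R n) (i : Fin t) : f i ∈ J f := Ideal.subset_span ⟨i, rfl⟩

/-- A homogeneous element of `J_f` is a combination of the generators with homogeneous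
coefficients. -/
lemma exists_homog_coeffs {t : ℕ} {c : Fin t → ℤ} {f : Fin t → R n} (hf : f ∈ piece n c 0)
    (d : ℤ) {F : R n} (hF : F ∈ J f) :
    ∃ u : Fin t → R n, (∀ i, u i ∈ homog n (d - c i)) ∧ ∑ i, u i * f i = comp n d F := by
  obtain ⟨u, rfl⟩ := mem_J_iff.mp hF
  refine ⟨fun i => comp n (d - c i) (u i), fun i => comp_mem _ _, ?_⟩
  rw [map_sum]
  exact Finset.sum_congr rfl fun i _ => (comp_mul _ (mem_piece_zero.mp hf i)).symm

lemma comp_mem_J {t : ℕ} {c : Fin t → ℤ} {f : Fin t → R n} (hf : f ∈ piece n c 0)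
    (d : ℤ) {F : R n} (hF : F ∈ J f) : comp n d F ∈ J f := by
  obtain ⟨u, -, hu⟩ := exists_homog_coeffs hf d hF
  exact mem_J_iff.mpr ⟨u, hu⟩

lemma posHomog_of_mem_piece {t : ℕ} {c : Fin t → ℤ} (hc : ∀ i, 1 ≤ c i) {f : Fin t → R n}
    (hf : f ∈ piece n c 0) : PosHomog f := by
  intro i
  have := hc i
  rcases mem_homog.mp (mem_piece_zero.mp hf i) with ⟨_, h⟩ | h
  · exact ⟨(c i).toNat, by omega, h⟩
  · exact ⟨1, one_pos, h ▸ isHomogeneous_zero _ _ _⟩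

/-! ### The point `o` -/

/-- Evaluation at `(1, 0, …, 0)`. -/
def ev (n : ℕ) : R n →ₐ[ℂ] ℂ := aeval (Pi.single 0 1)

lemma ev_eq (F : R n) : ev n F = eval (Pi.single 0 1) F := by
  rw [ev, aeval_def, eval₂_eq_eval_map]
  simp [Algebra.algebraMap_self, map_id]

/-- The derivative in the direction of the `j`-th affine coordinate at `(1, 0, …, 0)`. -/
def dv (n : ℕ) (j : Fin n) : R n →ₗ[ℂ] ℂ :=
  (ev n).toLinearMap ∘ₗ (pderiv j.succ : Derivation ℂ (R n) (R n)).toLinearMap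

lemma dv_apply (j : Fin n) (F : R n) : dv n j F = eval (Pi.single 0 1) (pderiv j.succ F) :=
  ev_eq _

lemma dv_mul (j : Fin n) (F G : R n) : dv n j (F * G) = ev n F * dv n j G + ev n G * dv n j F := by
  change ev n (pderiv j.succ (F * G)) = ev n F * ev n (pderiv j.succ G) +
    ev n G * ev n (pderiv j.succ F)
  rw [Derivation.leibniz, map_add, smul_eq_mul, smul_eq_mul, map_mul, map_mul]

@[simp] lemma ev_X_zero : ev n (X 0) = 1 := by simp [ev]

@[simp] lemma ev_X_succ (j : Fin n) : ev n (X j.succ) = 0 := by simp [ev]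

lemma dv_X_zero_pow_mul (j : Fin n) (k : ℕ) (F : R n) : dv n j (X 0 ^ k * F) = dv n j F := by
  have h : dv n j (X 0 ^ k) = 0 := by
    change ev n (pderiv j.succ (X 0 ^ k)) = 0
    rw [Derivation.leibniz_pow, pderiv_X, Pi.single_eq_of_ne (Fin.succ_ne_zero j).symm]
    simp
  rw [dv_mul, h]
  simp

lemma dv_X_succ (j k : Fin n) : dv n j (X k.succ) = if k = j then 1 else 0 := by
  change ev n (pderiv j.succ (X k.succ)) = _
  rw [pderiv_X]
  by_cases h : k = j
  · subst h
    simp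
  · rw [Pi.single_eq_of_ne (fun e => h (Fin.succ_injective _ e)), map_zero, if_neg h]

lemma mem_Io_iff {F : R n} : F ∈ Io n ↔ ∀ m ∈ F.support, ∃ j : Fin n, m j.succ ≠ 0 := by
  have : Io n = Ideal.span ((X : Fin (n + 1) → R n) '' Set.range Fin.succ) := by
    rw [Io, ← Set.range_comp]
    rfl
  rw [this, mem_ideal_span_X_image]
  simp only [Set.exists_range_iff]

lemma ev_eq_zero_of_mem_Io {F : R n} (h : F ∈ Io n) : ev n F = 0 := by
  have : Io n ≤ RingHom.ker (ev n) := Ideal.span_le.mpr (by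
    rintro _ ⟨j, rfl⟩
    exact ev_X_succ j)
  exact this h

lemma mem_Io_of_X_zero_pow_mul_mem {k : ℕ} {F : R n} (h : X 0 ^ k * F ∈ Io n) : F ∈ Io n := by
  induction k with
  | zero => simpa using h
  | succ k ih =>
    refine ih ?_
    rw [pow_succ', mul_assoc, mem_Io_iff] at h
    rw [mem_Io_iff]
    intro m hm
    obtain ⟨j, hj⟩ := h (Finsupp.single 0 1 + m) (by
      rw [mem_support_iff] at hm ⊢
      rwa [coeff_X_mul])
    refine ⟨j, ?_⟩
    simpa [Finsupp.single_apply, (Fin.succ_ne_zero j).symm] using hj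

lemma eq_single_of_degree {m : Fin (n + 1) →₀ ℕ} {d : ℕ} (hm : m.degree = d)
    (h : ∀ j : Fin n, m j.succ = 0) : m = Finsupp.single 0 d := by
  rw [Finsupp.degree_eq_sum, Fin.sum_univ_succ, Finset.sum_eq_zero fun j _ => h j, add_zero] at hm
  ext i
  refine Fin.cases ?_ (fun j => ?_) i
  · simp [hm]
  · simp [h j]

lemma ev_of_isHomogeneous {d : ℕ} {F : R n} (hF : F.IsHomogeneous d) :
    ev n F = coeff (Finsupp.single 0 d) F := by
  rw [ev_eq, eval_eq']
  have hs : ∀ m : Fin (n + 1) →₀ ℕ, m.degree = d → m ≠ Finsupp.single 0 d →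
      ∏ i, (Pi.single 0 1 : Fin (n + 1) → ℂ) i ^ m i = 0 := by
    intro m hm hne
    obtain ⟨j, hj⟩ : ∃ j : Fin n, m j.succ ≠ 0 := by
      by_contra! h
      exact hne (eq_single_of_degree hm h)
    refine Finset.prod_eq_zero (Finset.mem_univ j.succ) ?_
    rw [Pi.single_eq_of_ne (Fin.succ_ne_zero j), zero_pow hj]
  rw [Finset.sum_eq_single (Finsupp.single 0 d)]
  · have : ∏ i, (Pi.single 0 1 : Fin (n + 1) → ℂ) i ^ (Finsupp.single 0 d : _ →₀ ℕ) i = 1 := by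
      refine Finset.prod_eq_one fun i _ => ?_
      by_cases hi : i = 0
      · subst hi
        simp
      · rw [Finsupp.single_eq_of_ne hi, pow_zero]
    rw [this, mul_one]
  · intro m hm hne
    rw [hs m ?_ hne, mul_zero]
    by_contra h
    exact (mem_support_iff.mp hm) (hF.coeff_eq_zero h)
  · intro h
    rw [notMem_support_iff.mp h, zero_mul]

/-- The only monomial of degree `d` outside `I_o` is `x₀^d`, and its coefficient is the value at
`(1, 0, …, 0)`. -/
lemma mem_Io_of_ev_eq_zero {d : ℤ} {F : R n} (hF : F ∈ homog n d) (h : ev n F = 0) :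
    F ∈ Io n := by
  rcases mem_homog.mp hF with ⟨_, hF⟩ | rfl
  · rw [mem_Io_iff]
    intro m hm
    by_contra! hj
    have hdeg : m.degree = d.toNat := by
      by_contra h
      exact (mem_support_iff.mp hm) (hF.coeff_eq_zero h)
    rw [ev_of_isHomogeneous hF, ← eq_single_of_degree hdeg hj] at h
    exact mem_support_iff.mp hm h
  · exact zero_mem _

/-- The monomials of degree `d` in `I_o` but outside `I_o²` are `x₀^{d-1} x_j`, and their
coefficients are the affine partial derivatives at `o`. -/
lemma mem_Io_sq_of_eq_zero {d : ℤ} {F : R n} (hF : F ∈ homog n d) (h : ev n F = 0)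
    (h' : ∀ j, dv n j F = 0) : F ∈ Io n * Io n := by
  rcases mem_homog.mp hF with ⟨_, hFh⟩ | rfl
  · rw [F.as_sum]
    refine Ideal.sum_mem _ fun m hm => ?_
    have hdeg : m.degree = d.toNat := by
      by_contra h
      exact (mem_support_iff.mp hm) (hFh.coeff_eq_zero h)
    obtain ⟨j, hj⟩ := mem_Io_iff.mp (mem_Io_of_ev_eq_zero hF h) m hm
    obtain ⟨m', hmj⟩ : ∃ m' : Fin (n + 1) →₀ ℕ, m' + Finsupp.single j.succ 1 = m :=
      ⟨m - Finsupp.single j.succ 1, tsub_add_cancel_of_le (by rw [Finsupp.single_le_iff]; omega)⟩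
    have hdeg' : m'.degree + 1 = d.toNat := by
      rw [← hdeg]
      conv_rhs => rw [← hmj, map_add, Finsupp.degree_single]
    by_cases hi : ∃ i : Fin n, m' i.succ ≠ 0
    · rw [← hmj, monomial_add_single, pow_one]
      refine Ideal.mul_mem_mul ?_ (Ideal.subset_span ⟨j, rfl⟩)
      rw [mem_Io_iff]
      intro m'' hm''
      obtain rfl := Finset.mem_singleton.mp (support_monomial_subset hm'')
      exact hi
    · push Not at hi
      exfalso
      have hs := eq_single_of_degree (d := d.toNat - 1) (by omega) hi
      have h1 := h' j
      have hp : (pderiv j.succ F).IsHomogeneous (d.toNat - 1) := hFh.pderiv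
      change ev n (pderiv j.succ F) = 0 at h1
      rw [ev_of_isHomogeneous hp, coeff_pderiv, ← hs, hmj] at h1
      exact (mem_support_iff.mp hm) ((mul_eq_zero.mp h1).resolve_right (by norm_cast))
  · exact zero_mem _

lemma dv_eq_zero_of_mem_Io_sq {F : R n} (h : F ∈ Io n * Io n) (j : Fin n) : dv n j F = 0 := by
  induction h using Submodule.mul_induction_on' with
  | mem_mul_mem x hx y hy =>
    rw [dv_mul, ev_eq_zero_of_mem_Io hx, ev_eq_zero_of_mem_Io hy]
    ring
  | add x _ y _ hx hy => rw [map_add, hx, hy, add_zero]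

/-- The matrix of the gradients at `o` of the members of a family. -/
def grad {t : ℕ} (f : Fin t → R n) : Matrix (Fin t) (Fin n) ℂ := fun i j => dv n j (f i)

end IncidenceCI

end

noncomputable section

/-! ## Coordinates for the graded modules -/

namespace IncidenceCI

open MvPolynomial

variable {n r s : ℕ}

lemma forGeneral_surjective {X W : Type*} [AddCommGroup X] [Module ℂ X] [AddCommGroup W]
    [Module ℂ W] [FiniteDimensional ℂ W] (B : X →ₗ[ℂ] X →ₗ[ℂ] W) {x : X}
    (hx : Function.Surjective fun y => B x y + B y x) :
    ForGeneral X fun x => Function.Surjective fun y => B x y + B y x := by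
  obtain ⟨p, hp, hpx, hps⟩ := exists_polyFun_surjective (fun x => B x + B.flip x)
    (fun v ψ => dual_mem_polyFun (ψ ∘ₗ (B.flip v + B v))) hx
  exact .of_polyFun hp hpx hps

lemma mem_ideal_smul_top_iff {t : ℕ} (I : Ideal (R n)) {f : Fin t → R n} :
    f ∈ I • (⊤ : Submodule (R n) (Fin t → R n)) ↔ ∀ i, f i ∈ I := by
  constructor
  · intro h i
    induction h using Submodule.smul_induction_on' with
    | smul x hx y _ => exact Ideal.mul_mem_right _ _ hx
    | add x _ y _ hx hy => exact add_mem hx hy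
  · intro h
    have : f = ∑ i, f i • (Pi.single i 1 : Fin t → R n) := (pi_eq_sum_univ' f).trans (by
      refine Finset.sum_congr rfl fun i _ => ?_
      congr 1)
    rw [this]
    exact sum_mem fun i _ => Submodule.smul_mem_smul (h i) Submodule.mem_top

lemma single_mul {t : ℕ} (i : Fin t) (x y : R n) :
    (Pi.single i (x * y) : Fin t → R n) = x • Pi.single i y := by
  funext k
  rw [Pi.smul_apply, smul_eq_mul]
  by_cases h : k = i
  · subst h
    rw [Pi.single_eq_same, Pi.single_eq_same]
  · rw [Pi.single_eq_of_ne h, Pi.single_eq_of_ne h, mul_zero]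

lemma single_mem_Na {i : Fin r} {x : R n} (h : (i : ℕ) + 1 = r → x ∈ Io n) :
    (Pi.single i x : Fin r → R n) ∈ Na n r := by
  intro k hk
  by_cases hki : k = i
  · subst hki
    simpa using h hk
  · rw [Pi.single_eq_of_ne hki]
    exact zero_mem _

lemma mem_Io_smul_Na_iff {f : Fin r → R n} :
    f ∈ Io n • Na n r ↔ ∀ i, f i ∈ Io n ∧ ((i : ℕ) + 1 = r → f i ∈ Io n * Io n) := by
  constructor
  · intro h i
    induction h using Submodule.smul_induction_on' with
    | smul x hx y hy =>
      exact ⟨Ideal.mul_mem_right _ _ hx, fun hi => Ideal.mul_mem_mul hx (hy i hi)⟩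
    | add x _ y _ hx hy =>
      exact ⟨add_mem hx.1 hy.1, fun hi => add_mem (hx.2 hi) (hy.2 hi)⟩
  · intro h
    have : f = ∑ i, (Pi.single i (f i) : Fin r → R n) := (Finset.univ_sum_single f).symm
    rw [this]
    refine sum_mem fun i _ => ?_
    by_cases hi : (i : ℕ) + 1 = r
    · have key : ∀ x ∈ Io n * Io n, (Pi.single i x : Fin r → R n) ∈ Io n • Na n r := by
        intro x hx
        induction hx using Submodule.mul_induction_on' with
        | mem_mul_mem x hx y hy =>
          rw [single_mul]
          exact Submodule.smul_mem_smul hx (single_mem_Na fun _ => hy)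
        | add x _ y _ hx hy =>
          rw [Pi.single_add]
          exact add_mem hx hy
      exact key _ ((h i).2 hi)
    · rw [← mul_one (f i), single_mul]
      exact Submodule.smul_mem_smul (h i).1 (single_mem_Na fun h => absurd h hi)

/-- Membership in `(I_o N_a)_0` by the vanishing of values and of the last gradient. -/
lemma mem_degZero_Io_Na_iff {a : Fin r → ℤ} {f : Fin r → R n} :
    f ∈ degZero n a (Io n • Na n r) ↔ f ∈ piece n a 0 ∧ (∀ i, ev n (f i) = 0) ∧
      ∀ i : Fin r, (i : ℕ) + 1 = r → ∀ j, dv n j (f i) = 0 := by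
  rw [degZero, Submodule.mem_inf, Submodule.restrictScalars_mem, mem_Io_smul_Na_iff]
  constructor
  · rintro ⟨h, hp⟩
    exact ⟨hp, fun i => ev_eq_zero_of_mem_Io (h i).1,
      fun i hi => dv_eq_zero_of_mem_Io_sq ((h i).2 hi)⟩
  · rintro ⟨hp, h1, h2⟩
    exact ⟨fun i => ⟨mem_Io_of_ev_eq_zero (mem_piece_zero.mp hp i) (h1 i),
      fun hi => mem_Io_sq_of_eq_zero (mem_piece_zero.mp hp i) (h1 i) (h2 i hi)⟩, hp⟩

lemma mem_degZero_Io_top_iff {t : ℕ} {c : Fin t → ℤ} {f : Fin t → R n} :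
    f ∈ degZero n c (Io n • ⊤) ↔ f ∈ piece n c 0 ∧ ∀ i, ev n (f i) = 0 := by
  rw [degZero, Submodule.mem_inf, Submodule.restrictScalars_mem, mem_ideal_smul_top_iff]
  constructor
  · rintro ⟨h, hp⟩
    exact ⟨hp, fun i => ev_eq_zero_of_mem_Io (h i)⟩
  · rintro ⟨hp, h1⟩
    exact ⟨fun i => mem_Io_of_ev_eq_zero (mem_piece_zero.mp hp i) (h1 i), hp⟩

/-- The entries of the matrix of a linear map. -/
def entry (h : (Fin s → R n) →ₗ[R n] (Fin r → R n)) (i : Fin r) (j : Fin s) : R n :=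
  h (Pi.single j 1) i

lemma apply_eq_sum_entry (h : (Fin s → R n) →ₗ[R n] (Fin r → R n)) (f : Fin s → R n) (i : Fin r) :
    h f i = ∑ j, entry h i j * f j := by
  conv_lhs => rw [← Finset.univ_sum_single f, map_sum, Finset.sum_apply]
  refine Finset.sum_congr rfl fun j _ => ?_
  rw [entry, ← mul_one (f j), single_mul, map_smul, Pi.smul_apply, smul_eq_mul, mul_one, mul_comm]

lemma entry_mulVecLin (M : Matrix (Fin r) (Fin s) (R n)) (i : Fin r) (j : Fin s) :
    entry M.mulVecLin i j = M i j := by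
  simp [entry]

lemma single_mem_piece {t : ℕ} (c : Fin t → ℤ) (j : Fin t) :
    (Pi.single j 1 : Fin t → R n) ∈ piece n c (-c j) := by
  rw [piece, Submodule.mem_pi]
  intro i _
  by_cases h : i = j
  · subst h
    rw [Pi.single_eq_same]
    exact mem_homog_of_isHomogeneous (isHomogeneous_one _ _) (by simp)
  · rw [Pi.single_eq_of_ne h]
    exact zero_mem _

lemma mem_homZero_iff {a : Fin r → ℤ} {b : Fin s → ℤ} {N : Submodule (R n) (Fin r → R n)}
    {h : (Fin s → R n) →ₗ[R n] (Fin r → R n)} :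
    h ∈ homZero n b a N ↔ (∀ i j, entry h i j ∈ homog n (a i - b j)) ∧ ∀ f, h f ∈ N := by
  change (_ ∧ _) ↔ _
  refine and_congr_left fun _ => ⟨fun H i j => ?_, fun H d f hf => ?_⟩
  · have := H _ _ (single_mem_piece b j)
    exact Submodule.mem_pi.mp this i (Set.mem_univ i)
  · rw [piece, Submodule.mem_pi] at hf ⊢
    intro i _
    rw [apply_eq_sum_entry]
    refine sum_mem fun j _ => ?_
    have := homog_mul (H i j) (hf j (Set.mem_univ j))
    rwa [show a i - b j + (b j + d) = a i + d by ring] at this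

lemma mem_homZero_top_iff {a : Fin r → ℤ} {b : Fin s → ℤ}
    {h : (Fin s → R n) →ₗ[R n] (Fin r → R n)} :
    h ∈ homZero n b a ⊤ ↔ ∀ i j, entry h i j ∈ homog n (a i - b j) := by
  rw [mem_homZero_iff]
  simp

lemma mem_homZero_Na_iff {a : Fin r → ℤ} {b : Fin s → ℤ}
    {h : (Fin s → R n) →ₗ[R n] (Fin r → R n)} :
    h ∈ homZero n b a (Na n r) ↔ (∀ i j, entry h i j ∈ homog n (a i - b j)) ∧
      ∀ i : Fin r, (i : ℕ) + 1 = r → ∀ j, ev n (entry h i j) = 0 := by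
  rw [mem_homZero_iff]
  refine and_congr_right fun H => ⟨fun h1 i hi j => ev_eq_zero_of_mem_Io (h1 _ i hi),
    fun h1 f i hi => ?_⟩
  rw [apply_eq_sum_entry]
  exact Ideal.sum_mem _ fun j _ => Ideal.mul_mem_right _ _
    (mem_Io_of_ev_eq_zero (H i j) (h1 i hi j))

lemma mem_V_iff {a : Fin r → ℤ} {b : Fin s → ℤ} {g : Fin s → R n}
    {h : (Fin s → R n) →ₗ[R n] (Fin r → R n)} :
    (g, h) ∈ V n a b ↔ g ∈ degZero n b (Io n • ⊤) ∧ h ∈ homZero n b a (Na n r) := Iff.rfl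

instance (a : Fin r → ℤ) (b : Fin s → ℤ) (N : Submodule (R n) (Fin r → R n)) :
    FiniteDimensional ℂ (homZero n b a N) := by
  let φ : homZero n b a N →ₗ[ℂ] (∀ j, piece n a (-b j)) :=
    { toFun := fun h j => ⟨h.1 (Pi.single j 1), h.2.1 _ _ (single_mem_piece b j)⟩
      map_add' := fun _ _ => rfl
      map_smul' := fun _ _ => rfl }
  refine FiniteDimensional.of_injective φ fun h k hhk => ?_
  ext1
  refine LinearMap.pi_ext' fun j => LinearMap.ext_ring ?_
  exact congrArg Subtype.val (congrFun hhk j)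

instance {t : ℕ} (c : Fin t → ℤ) (K : Submodule (R n) (Fin t → R n)) :
    FiniteDimensional ℂ (degZero n c K) :=
  Submodule.finiteDimensional_of_le (inf_le_right : _ ≤ piece n c 0)

instance (a : Fin r → ℤ) (b : Fin s → ℤ) : FiniteDimensional ℂ (V n a b) := by
  rw [FiniteDimensional, Module.Finite.iff_fg]
  exact Submodule.FG.prod (Module.Finite.iff_fg.mp inferInstance)
    (Module.Finite.iff_fg.mp inferInstance)

lemma apply_mem_piece {a : Fin r → ℤ} {b : Fin s → ℤ} {h : (Fin s → R n) →ₗ[R n] (Fin r → R n)}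
    (hh : ∀ i j, entry h i j ∈ homog n (a i - b j)) {g : Fin s → R n} (hg : g ∈ piece n b 0) :
    h g ∈ piece n a 0 := by
  rw [mem_piece_zero] at hg ⊢
  intro i
  rw [apply_eq_sum_entry]
  refine sum_mem fun j _ => ?_
  have := homog_mul (hh i j) (hg j)
  rwa [sub_add_cancel] at this

/-- In the last coordinate both the entries of `h` and the `g_j` vanish at `o`, so by the product
rule the gradient of their sum of products vanishes as well. -/
lemma apply_mem_W {a : Fin r → ℤ} {b : Fin s → ℤ} {h : (Fin s → R n) →ₗ[R n] (Fin r → R n)}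
    (hh : h ∈ homZero n b a (Na n r)) {g : Fin s → R n} (hg : g ∈ degZero n b (Io n • ⊤)) :
    h g ∈ degZero n a (Io n • Na n r) := by
  rw [mem_homZero_Na_iff] at hh
  rw [mem_degZero_Io_top_iff] at hg
  rw [mem_degZero_Io_Na_iff]
  refine ⟨apply_mem_piece hh.1 hg.1, fun i => ?_, fun i hi k => ?_⟩
  · rw [apply_eq_sum_entry, map_sum]
    exact Finset.sum_eq_zero fun j _ => by rw [map_mul, hg.2, mul_zero]
  · rw [apply_eq_sum_entry, map_sum]
    exact Finset.sum_eq_zero fun j _ => by rw [dv_mul, hg.2, hh.2 i hi, zero_mul, zero_mul, add_zero]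

/-- The bilinear map `(g, h), (g', h') ↦ h'(g)`, with values in `(I_o N_a)_0`. -/
def pairing (n : ℕ) {r s : ℕ} (a : Fin r → ℤ) (b : Fin s → ℤ) :
    V n a b →ₗ[ℂ] V n a b →ₗ[ℂ] degZero n a (Io n • Na n r) :=
  LinearMap.mk₂ ℂ (fun x y => ⟨y.1.2 x.1.1, apply_mem_W y.2.2 x.2.1⟩)
    (fun _ _ _ => Subtype.ext (map_add _ _ _))
    (fun _ _ _ => Subtype.ext (LinearMap.map_smul_of_tower _ _ _))
    (fun _ _ _ => rfl) (fun _ _ _ => rfl)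

lemma coe_pairing {a : Fin r → ℤ} {b : Fin s → ℤ} (x y : V n a b) :
    (pairing n a b x y : Fin r → R n) = y.1.2 x.1.1 := rfl

lemma delta_eq_pairing {a : Fin r → ℤ} {b : Fin s → ℤ} (x y : V n a b) :
    delta x.1.1 x.1.2 y.1 = ((pairing n a b x y + pairing n a b y x :
      degZero n a (Io n • Na n r)) : Fin r → R n) := by
  rw [Submodule.coe_add, coe_pairing, coe_pairing]
  rfl

lemma map_delta_le {a : Fin r → ℤ} {b : Fin s → ℤ} (x : V n a b) :
    (V n a b).map (delta x.1.1 x.1.2) ≤ degZero n a (Io n • Na n r) := by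
  intro w hw
  rw [Submodule.mem_map] at hw
  obtain ⟨y, hy, rfl⟩ := hw
  have := delta_eq_pairing x ⟨y, hy⟩
  rw [this]
  exact SetLike.coe_mem _

lemma map_delta_eq_iff {a : Fin r → ℤ} {b : Fin s → ℤ} (x : V n a b) :
    (V n a b).map (delta x.1.1 x.1.2) = degZero n a (Io n • Na n r) ↔
      Function.Surjective fun y => pairing n a b x y + pairing n a b y x := by
  constructor
  · intro h w
    have hw : (w : Fin r → R n) ∈ (V n a b).map (delta x.1.1 x.1.2) := by
      rw [h]
      exact w.2
    rw [Submodule.mem_map] at hw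
    obtain ⟨y, hy, hyw⟩ := hw
    have := delta_eq_pairing x ⟨y, hy⟩
    exact ⟨⟨y, hy⟩, Subtype.ext (by rw [← this, ← hyw])⟩
  · intro h
    refine le_antisymm (map_delta_le x) fun w hw => ?_
    obtain ⟨y, hy⟩ := h ⟨w, hw⟩
    rw [Submodule.mem_map]
    refine ⟨y.1, y.2, ?_⟩
    rw [delta_eq_pairing x y]
    exact congrArg Subtype.val hy

/-- Surjectivity of `δ` onto `(I_o N_a)_0` at one point implies it at the general point. -/
lemma forGeneral_map_delta_eq {a : Fin r → ℤ} {b : Fin s → ℤ} {x : V n a b}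
    (hx : (V n a b).map (delta x.1.1 x.1.2) = degZero n a (Io n • Na n r)) :
    ForGeneral (V n a b) fun p =>
      (V n a b).map (delta p.1.1 p.1.2) = degZero n a (Io n • Na n r) := by
  have h1 := (map_delta_eq_iff x).mp hx
  have h2 := forGeneral_surjective (X := V n a b) (W := degZero n a (Io n • Na n r)) (pairing n a b)
    (x := x)
  have h3 := h2 h1
  refine h3.mono fun y hy => ?_
  exact (map_delta_eq_iff y).mpr hy

end IncidenceCI

end

noncomputable section

/-! ## Saturations, tangent spaces, and the locus `Γ_o` -/

namespace IncidenceCI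

open MvPolynomial

variable {n t : ℕ}

lemma mem_saturation_iff {I : Ideal (R n)} {F : R n} :
    F ∈ saturation I ↔ ∃ k, ∀ s ∈ irr n ^ k, F * s ∈ I := by
  rw [saturation, Submodule.mem_iSup_of_directed]
  · simp only [Submodule.mem_colon, SetLike.mem_coe, smul_eq_mul]
  · refine (monotone_nat_of_le_succ fun k F hF => ?_).directed_le
    rw [Submodule.mem_colon] at hF ⊢
    exact fun s hs => hF s (Ideal.pow_le_pow_right k.le_succ hs)

lemma le_saturation (I : Ideal (R n)) : I ≤ saturation I := fun _ hF =>
  mem_saturation_iff.mpr ⟨0, fun s _ => Ideal.mul_mem_right s _ hF⟩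

lemma saturation_mono {I K : Ideal (R n)} (h : I ≤ K) : saturation I ≤ saturation K := by
  intro F hF
  obtain ⟨k, hk⟩ := mem_saturation_iff.mp hF
  exact mem_saturation_iff.mpr ⟨k, fun s hs => h (hk s hs)⟩

lemma exists_X_zero_pow_mul_mem {I : Ideal (R n)} {F : R n} (hF : F ∈ saturation I) :
    ∃ k, X 0 ^ k * F ∈ I := by
  obtain ⟨k, hk⟩ := mem_saturation_iff.mp hF
  have h0 : (X 0 : R n) ∈ irr n := Ideal.subset_span ⟨0, rfl⟩
  exact ⟨k, mul_comm F _ ▸ hk _ (Ideal.pow_mem_pow h0 k)⟩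

/-- The ideal of a complete intersection of positive dimension is saturated. -/
lemma mem_J_of_mem_saturation {c : Fin t → ℤ} (hc : ∀ i, 1 ≤ c i) (ht : t ≤ n) {f : Fin t → R n}
    (hf : f ∈ piece n c 0) (hht : (J f).height = t) {d : ℤ} {F : R n} (hF : F ∈ homog n d)
    (h : F ∈ saturation (J f)) : F ∈ J f := by
  obtain ⟨k, hk⟩ := mem_saturation_iff.mp h
  rcases mem_homog.mp hF with ⟨_, hF⟩ | hF
  · exact mem_J_of_irr_pow_mul_mem (posHomog_of_mem_piece hc hf) hht ht hF hk
  · exact hF ▸ zero_mem _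

lemma J_le_Io_iff {c : Fin t → ℤ} {f : Fin t → R n} (hf : f ∈ piece n c 0) :
    J f ≤ Io n ↔ ∀ i, ev n (f i) = 0 := by
  refine ⟨fun h i => ev_eq_zero_of_mem_Io (h (mem_J_self f i)), fun h => Ideal.span_le.mpr ?_⟩
  rintro _ ⟨i, rfl⟩
  exact mem_Io_of_ev_eq_zero (mem_piece_zero.mp hf i) (h i)

lemma saturation_le_Io_iff {I : Ideal (R n)} : saturation I ≤ Io n ↔ I ≤ Io n := by
  refine ⟨(le_saturation I).trans, fun h F hF => ?_⟩
  obtain ⟨k, hk⟩ := exists_X_zero_pow_mul_mem hF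
  exact mem_Io_of_X_zero_pow_mul_mem (h hk)

/-- Up to a power of `x₀`, which does not change derivatives at `o`, an element of the saturation is
a combination of the `f_i`; as these vanish at `o`, its gradient is a combination of theirs. -/
lemma tangentSpaceAtO_saturation {f : Fin t → R n} (hf : ∀ i, ev n (f i) = 0) :
    tangentSpaceAtO (saturation (J f)) = LinearMap.ker (grad f).mulVecLin := by
  ext v
  rw [LinearMap.mem_ker, Matrix.mulVecLin_apply]
  constructor
  · intro h
    funext i
    have := h (f i) (le_saturation _ (mem_J_self f i))
    simp only [← dv_apply] at this
    exact this
  · intro h F hF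
    obtain ⟨k, hk⟩ := exists_X_zero_pow_mul_mem hF
    obtain ⟨u, hu⟩ := mem_J_iff.mp hk
    have hF : ∀ j, dv n j F = ∑ i, ev n (u i) * grad f i j := by
      intro j
      rw [← dv_X_zero_pow_mul j k, ← hu, map_sum]
      exact Finset.sum_congr rfl fun i _ => by rw [dv_mul, hf i, zero_mul, add_zero]; rfl
    simp only [← dv_apply, hF, Finset.sum_mul]
    rw [Finset.sum_comm]
    refine Finset.sum_eq_zero fun i _ => ?_
    have := congrFun h i
    simp only [Matrix.mulVec, dotProduct, Pi.zero_apply] at this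
    simp only [mul_assoc]
    rw [← Finset.mul_sum, this, mul_zero]

/-- Rank-nullity: the kernel is larger than expected exactly when the rank is less than the number
of rows. -/
lemma lt_finrank_ker_mulVecLin_add_iff (M : Matrix (Fin t) (Fin n) ℂ) :
    n < Module.finrank ℂ (LinearMap.ker M.mulVecLin) + t ↔ ¬ LinearIndependent ℂ M.row := by
  have h1 := LinearMap.finrank_range_add_finrank_ker M.mulVecLin
  rw [Module.finrank_fin_fun] at h1
  have h2 : Module.finrank ℂ (LinearMap.range M.mulVecLin) =
    Set.finrank ℂ (Set.range M.row) := M.rank_eq_finrank_span_row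
  rw [linearIndependent_iff_card_eq_finrank_span, Fintype.card_fin, ← h2]
  have h3 : Module.finrank ℂ (LinearMap.range M.mulVecLin) ≤ t := by
    have := M.rank_le_card_height
    rwa [Fintype.card_fin] at this
  omega

/-- The Jacobian criterion for singularity at `o`. -/
lemma q_mem_Gamma_iff {c : Fin t → ℤ} (f : ciLocus n c) :
    q n c f ∈ Gamma n c ↔ (∀ i, ev n (f.1.1 i) = 0) ∧ ¬ LinearIndependent ℂ (grad f.1.1).row := by
  change (saturation (J f.1.1) ≤ Io n ∧ _ < Module.finrank ℂ (tangentSpaceAtO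
    (saturation (J f.1.1))) + t) ↔ _
  rw [saturation_le_Io_iff, J_le_Io_iff f.1.2]
  refine and_congr_right fun h => ?_
  rw [tangentSpaceAtO_saturation h, lt_finrank_ker_mulVecLin_add_iff]

lemma not_linearIndependent_row_iff (M : Matrix (Fin t) (Fin n) ℂ) :
    ¬ LinearIndependent ℂ M.row ↔ ∃ l : Fin t → ℂ, l ≠ 0 ∧ ∀ j, ∑ i, l i * M i j = 0 := by
  rw [Fintype.not_linearIndependent_iff]
  constructor
  · rintro ⟨l, h, i, hi⟩
    refine ⟨l, fun h => hi (congrFun h i), fun j => ?_⟩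
    simpa using congrFun h j
  · rintro ⟨l, hl, h⟩
    obtain ⟨i, hi⟩ := Function.ne_iff.mp hl
    exact ⟨l, funext fun j => by simpa using h j, i, hi⟩

/-- Since `t ≤ n`, each generator has the property that lying in the saturation means lying in the
ideal, so the scheme determines `J_f` itself. -/
lemma q_eq_q_iff {c : Fin t → ℤ} (hc : ∀ i, 1 ≤ c i) (ht : t ≤ n) {f f' : ciLocus n c} :
    q n c f = q n c f' ↔ J f.1.1 = J f'.1.1 := by
  constructor
  · intro h
    have h : saturation (J f.1.1) = saturation (J f'.1.1) := congrArg Subtype.val h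
    apply le_antisymm
    · refine Ideal.span_le.mpr ?_
      rintro _ ⟨i, rfl⟩
      exact mem_J_of_mem_saturation hc ht f'.1.2 f'.2 (mem_piece_zero.mp f.1.2 i)
        (h ▸ le_saturation _ (mem_J_self _ i))
    · refine Ideal.span_le.mpr ?_
      rintro _ ⟨i, rfl⟩
      exact mem_J_of_mem_saturation hc ht f.1.2 f.2 (mem_piece_zero.mp f'.1.2 i)
        (h ▸ le_saturation _ (mem_J_self _ i))
  · intro h
    exact Subtype.ext (congrArg saturation h)

end IncidenceCI

end

noncomputable section

/-! ## General complete intersections -/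

namespace IncidenceCI

open MvPolynomial

variable {n t : ℕ}

lemma irr_pow_le_of_homog_le {I : Ideal (R n)} {N : ℕ} (h : ∀ F ∈ homog n N, F ∈ I) :
    irr n ^ N ≤ I := by
  have : irr n = idealOfVars (Fin (n + 1)) ℂ := rfl
  rw [this, pow_idealOfVars_eq_span, Ideal.span_le]
  rintro _ ⟨m, hm, rfl⟩
  exact h _ (mem_homog_of_isHomogeneous (isHomogeneous_monomial 1 hm) rfl)

lemma homog_mem_irr_pow {N : ℕ} {F : R n} (h : F ∈ homog n N) : F ∈ irr n ^ N := by
  refine (mem_pow_idealOfVars_iff' (R := ℂ) N F).mpr fun m hm => ?_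
  rcases mem_homog.mp h with ⟨_, h⟩ | h
  · refine h.coeff_eq_zero ?_
    simp only [Int.toNat_natCast]
    omega
  · rw [h, coeff_zero]

/-- Being the quotient of finite length by `f` and given linear forms is an open condition. -/
lemma forGeneral_height_of_point {c : Fin t → ℤ} (hc : ∀ i, 1 ≤ c i) {m : ℕ} (htm : t + m ≤ n + 1)
    {S : Submodule ℂ (Fin t → R n)} (hS : S ≤ piece n c 0) {f : Fin t → R n} (hf : f ∈ S)
    {l : Fin m → R n} (hl : ∀ k, l k ∈ homog n 1) {N : ℕ} (hN : irr n ^ N ≤ J f ⊔ J l) :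
    ForGeneral S fun f => (J f.1).height = t := by
  -- The degree `N` part of `J_f + J_l` is the image of this map, which depends on `f` in an affine
  -- way. Surjectivity onto `R_N` is thus open, and implies that `irr n ^ N` lies in the ideal.
  let L : S → ((∀ i, homog n (N - c i)) × (Fin m → homog n (N - 1))) →ₗ[ℂ] homog n N := fun f =>
    { toFun := fun u => ⟨∑ i, (u.1 i : R n) * f.1 i + ∑ k, (u.2 k : R n) * l k, by
        refine add_mem (sum_mem fun i _ => ?_) (sum_mem fun k _ => ?_)
        · have := homog_mul (u.1 i).2 (mem_piece_zero.mp (hS f.2) i)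
          rwa [sub_add_cancel] at this
        · have := homog_mul (u.2 k).2 (hl k)
          rwa [sub_add_cancel] at this⟩
      map_add' := fun u v => Subtype.ext (by
        simp only [Prod.fst_add, Prod.snd_add, Pi.add_apply, Submodule.coe_add, add_mul,
          Finset.sum_add_distrib]
        abel)
      map_smul' := fun z u => Subtype.ext (by
        simp [Finset.smul_sum, smul_add]) }
  have hL : ∀ v (ψ : Module.Dual ℂ (homog n N)), (fun x => ψ (L x v)) ∈ polyFun S := by
    intro v ψ
    let A : S →ₗ[ℂ] homog n N :=
      { toFun := fun f => L f v - L 0 v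
        map_add' := fun f g => Subtype.ext (by
          simp [L, mul_add, Finset.sum_add_distrib])
        map_smul' := fun z f => Subtype.ext (by
          simp [L, Finset.smul_sum]) }
    have : (fun x => ψ (L x v)) = fun x => (ψ ∘ₗ A) x + ψ (L 0 v) := by
      funext x
      simp [A]
    rw [this]
    exact polyFun_add (dual_mem_polyFun _) (const_mem_polyFun _)
  have hsurj : Function.Surjective (L ⟨f, hf⟩) := by
    rintro ⟨F, hF⟩
    obtain ⟨G, hG, K, hK, hGK⟩ := Submodule.mem_sup.mp (hN (homog_mem_irr_pow hF))
    obtain ⟨u, hu, huG⟩ := exists_homog_coeffs (hS hf) N hG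
    obtain ⟨v, hv, hvK⟩ := exists_homog_coeffs (c := fun _ => 1) (mem_piece_zero.mpr hl) N hK
    refine ⟨(fun i => ⟨u i, hu i⟩, fun k => ⟨v k, hv k⟩), Subtype.ext ?_⟩
    change ∑ i, u i * f i + ∑ k, v k * l k = F
    rw [huG, hvK, ← map_add, hGK, comp_eq_self hF]
  obtain ⟨p, hp, hpf, hps⟩ := exists_polyFun_surjective L hL hsurj
  refine .of_polyFun hp hpf fun g hg => ?_
  refine height_J_eq (posHomog_of_mem_piece hc (hS g.2)) l
    (posHomog_of_mem_piece (c := fun _ => 1) (fun _ => le_rfl) (mem_piece_zero.mpr hl)) htm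
    (N := N) (irr_pow_le_of_homog_le fun F hF => ?_)
  obtain ⟨u, hu⟩ := hps g hg ⟨F, hF⟩
  rw [show F = (L g u : R n) from (congrArg Subtype.val hu).symm]
  exact Submodule.add_mem_sup (mem_J_iff.mpr ⟨fun i => u.1 i, rfl⟩)
    (mem_J_iff.mpr ⟨fun i => u.2 i, rfl⟩)

/-- If a linear system contains a power of each of `x₁, …, x_t`, then its general member is a
complete intersection. -/
lemma forGeneral_height {c : Fin t → ℤ} (hc : ∀ i, 1 ≤ c i) (ht : t ≤ n)
    {S : Submodule ℂ (Fin t → R n)} (hS : S ≤ piece n c 0)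
    (h : (fun i => X (i.castLE ht).succ ^ (c i).toNat) ∈ S) :
    ForGeneral S fun f => (J f.1).height = t := by
  let f : Fin t → R n := fun i => X (i.castLE ht).succ ^ (c i).toNat
  -- The forms `x₀, x_{t+1}, …, x_n` complete the powers of `x₁, …, x_t` to an ideal whose radical
  -- contains all variables.
  let l : Fin (n - t + 1) → R n :=
    Fin.cons (X 0) fun k => X (⟨t + k, by omega⟩ : Fin n).succ
  have hrad : irr n ≤ (J f ⊔ J l).radical := by
    refine Ideal.span_le.mpr ?_
    rintro _ ⟨j, rfl⟩
    induction j using Fin.cases with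
    | zero => exact Ideal.le_radical (Ideal.mem_sup_right (mem_J_self l 0))
    | succ j =>
      by_cases hj : (j : ℕ) < t
      · exact ⟨(c ⟨j, hj⟩).toNat, Ideal.mem_sup_left (mem_J_self f ⟨j, hj⟩)⟩
      · refine Ideal.le_radical (Ideal.mem_sup_right ?_)
        have := mem_J_self l (Fin.succ ⟨j - t, by omega⟩)
        simp only [l, Fin.cons_succ] at this
        convert this using 3
        ext
        simp
        omega
  obtain ⟨N, hN⟩ := Ideal.exists_pow_le_of_le_radical_of_fg hrad (IsNoetherian.noetherian _)
  refine forGeneral_height_of_point hc (m := n - t + 1) (by omega) hS h (l := l) (fun k => ?_) hN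
  induction k using Fin.cases with
  | zero => exact X_mem_homog 0
  | succ k => exact X_mem_homog _

lemma grad_row_linear_polyFun {S : Submodule ℂ (Fin t → R n)} (i : Fin t) (j : Fin n) :
    (fun f : S => grad f.1 i j) ∈ polyFun S :=
  dual_mem_polyFun
    { toFun := fun f : S => dv n j (f.1 i)
      map_add' := fun _ _ => map_add _ _ _
      map_smul' := fun z f => (dv n j).map_smul z (f.1 i) }

lemma linearIndependent_row_of_submatrix {M : Matrix (Fin t) (Fin n) ℂ} (ht : t ≤ n)
    (h : (M.submatrix id (Fin.castLE ht)).det ≠ 0) : LinearIndependent ℂ M.row := by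
  by_contra hM
  obtain ⟨l, hl, hM⟩ := (not_linearIndependent_row_iff M).mp hM
  exact h (Matrix.exists_vecMul_eq_zero_iff.mp ⟨l, hl, funext fun j => hM _⟩)

lemma dv_X_zero_pow_mul_X (j k : Fin n) (e : ℕ) :
    dv n j (X 0 ^ e * X k.succ) = if k = j then 1 else 0 := by
  rw [dv_X_zero_pow_mul, dv_X_succ]

lemma X_zero_pow_mul_X_mem_homog {d : ℤ} (hd : 1 ≤ d) (k : Fin n) :
    (X 0 ^ (d - 1).toNat * X k.succ : R n) ∈ homog n d := by
  have := homog_mul (X_pow_mem_homog (0 : Fin (n + 1)) (d := d - 1) (by omega)) (X_mem_homog k.succ)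
  rwa [sub_add_cancel] at this

lemma forGeneral_linearIndependent_grad {c : Fin t → ℤ} (hc : ∀ i, 1 ≤ c i) (ht : t ≤ n) :
    ForGeneral (degZero n c (Io n • ⊤)) fun f => LinearIndependent ℂ (grad f.1).row := by
  -- The gradients of `x₀^{c_i - 1} x_i` at `o` are standard basis vectors.
  let f : Fin t → R n := fun i => X 0 ^ (c i - 1).toNat * X (i.castLE ht).succ
  have hf : f ∈ degZero n c (Io n • ⊤) := mem_degZero_Io_top_iff.mpr
    ⟨mem_piece_zero.mpr fun i => X_zero_pow_mul_X_mem_homog (hc i) _, fun i => by simp [f]⟩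
  refine .of_polyFun (x := ⟨f, hf⟩)
    (p := fun f => ((grad f.1).submatrix id (Fin.castLE ht)).det)
    (polyFun_det fun i j => grad_row_linear_polyFun i _) ?_
    fun g hg => linearIndependent_row_of_submatrix ht hg
  have : (grad f).submatrix id (Fin.castLE ht) = 1 := by
    ext i j
    simp [grad, f, dv_X_zero_pow_mul_X, Matrix.one_apply, Fin.ext_iff]
  simp [this]

lemma forGeneral_height_Io {c : Fin t → ℤ} (hc : ∀ i, 1 ≤ c i) (ht : t ≤ n) :
    ForGeneral (degZero n c (Io n • ⊤)) fun f => (J f.1).height = t := by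
  refine forGeneral_height hc ht inf_le_right (mem_degZero_Io_top_iff.mpr
    ⟨mem_piece_zero.mpr fun i => X_pow_mem_homog _ (by linarith [hc i]), fun i => ?_⟩)
  have : (c i).toNat ≠ 0 := by have := hc i; omega
  simp [this]

lemma forGeneral_height_Io_Na {c : Fin t → ℤ} (hc : ∀ i, 2 ≤ c i) (ht : t ≤ n) :
    ForGeneral (degZero n c (Io n • Na n t)) fun f => (J f.1).height = t := by
  refine forGeneral_height (fun i => by linarith [hc i]) ht inf_le_right (mem_degZero_Io_Na_iff.mpr
    ⟨mem_piece_zero.mpr fun i => X_pow_mem_homog _ (by linarith [hc i]), fun i => ?_, fun i _ j => ?_⟩)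
  · have : (c i).toNat ≠ 0 := by have := hc i; omega
    simp [this]
  -- Degree at least two is needed here: a power of a coordinate has zero gradient at `o` only from
  -- the square on.
  · obtain ⟨e, he⟩ : ∃ e, (c i).toNat = e + 2 := ⟨(c i).toNat - 2, by have := hc i; omega⟩
    rw [he, pow_succ, dv_mul]
    simp

end IncidenceCI

end

noncomputable section

/-! ## Changes of generators -/

namespace IncidenceCI

open MvPolynomial

variable {n t : ℕ}

/-- A matrix with entries of degrees `a_i - b_j`. -/
def IsGradedMatrix {r s : ℕ} (a : Fin r → ℤ) (b : Fin s → ℤ) (A : Matrix (Fin r) (Fin s) (R n)) :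
    Prop := ∀ i j, A i j ∈ homog n (a i - b j)

lemma IsGradedMatrix.mul {r s u : ℕ} {a : Fin r → ℤ} {b : Fin s → ℤ} {c : Fin u → ℤ}
    {A : Matrix (Fin r) (Fin s) (R n)} {B : Matrix (Fin s) (Fin u) (R n)}
    (hA : IsGradedMatrix a b A) (hB : IsGradedMatrix b c B) : IsGradedMatrix a c (A * B) := by
  intro i j
  rw [Matrix.mul_apply]
  refine sum_mem fun k _ => ?_
  have := homog_mul (hA i k) (hB k j)
  rwa [sub_add_sub_cancel] at this

lemma IsGradedMatrix.mulVec_mem {r s : ℕ} {a : Fin r → ℤ} {b : Fin s → ℤ}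
    {A : Matrix (Fin r) (Fin s) (R n)} (hA : IsGradedMatrix a b A) {g : Fin s → R n}
    (hg : g ∈ piece n b 0) : A.mulVec g ∈ piece n a 0 := by
  rw [mem_piece_zero] at hg ⊢
  intro i
  change ∑ j, A i j * g j ∈ homog n (a i)
  refine sum_mem fun j _ => ?_
  have := homog_mul (hA i j) (hg j)
  rwa [sub_add_cancel] at this

lemma J_mulVec_le {r s : ℕ} (A : Matrix (Fin r) (Fin s) (R n)) (g : Fin s → R n) :
    J (A.mulVec g) ≤ J g := by
  refine Ideal.span_le.mpr ?_
  rintro _ ⟨i, rfl⟩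
  exact mem_J_iff.mpr ⟨A i, rfl⟩

lemma exists_isGradedMatrix {r s : ℕ} {a : Fin r → ℤ} {b : Fin s → ℤ} {f : Fin r → R n}
    {g : Fin s → R n} (hf : f ∈ piece n a 0) (hg : g ∈ piece n b 0) (h : J f ≤ J g) :
    ∃ A, IsGradedMatrix a b A ∧ A.mulVec g = f := by
  have : ∀ i, ∃ u : Fin s → R n, (∀ j, u j ∈ homog n (a i - b j)) ∧ ∑ j, u j * g j = f i := by
    intro i
    have := exists_homog_coeffs hg (a i) (h (mem_J_self f i))
    rwa [comp_eq_self (mem_piece_zero.mp hf i)] at this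
  choose A hA hAf using this
  exact ⟨A, hA, funext hAf⟩

/-- The generators of a complete intersection are minimal: there is no relation with an invertible
coefficient. -/
lemma coeff_eq_zero_of_relation {c : Fin t → ℤ} (hc : ∀ i, 1 ≤ c i) {f : Fin t → R n}
    (hf : f ∈ piece n c 0) (hht : (J f).height = t) {u : Fin t → R n} (hu : ∑ i, u i * f i = 0)
    {j : Fin t} {z : ℂ} (hz : u j = C z) : z = 0 := by
  by_contra hz0
  -- A unit coefficient lets `f_j` be eliminated, leaving `t - 1` generators for an ideal of height
  -- `t`, against Krull's height theorem.
  have hspan : J f = Ideal.span ((Finset.univ.erase j).image f : Set (R n)) := by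
    refine le_antisymm (Ideal.span_le.mpr ?_) (Ideal.span_mono ?_)
    · rintro _ ⟨i, rfl⟩
      by_cases hij : i = j
      · subst hij
        rw [← Finset.add_sum_erase _ _ (Finset.mem_univ i), hz] at hu
        have : f i = -(C z⁻¹ * ∑ k ∈ Finset.univ.erase i, u k * f k) := by
          rw [← mul_neg, ← eq_neg_of_add_eq_zero_left hu, ← mul_assoc, ← C_mul,
            inv_mul_cancel₀ hz0, C_1, one_mul]
        rw [SetLike.mem_coe, this]
        refine neg_mem (Ideal.mul_mem_left _ _ (Ideal.sum_mem _ fun k hk => ?_))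
        exact Ideal.mul_mem_left _ _ (Ideal.subset_span (Finset.mem_coe.mpr
          (Finset.mem_image_of_mem f hk)))
      · exact Ideal.subset_span (Finset.mem_coe.mpr
          (Finset.mem_image_of_mem f (Finset.mem_erase.mpr ⟨hij, Finset.mem_univ i⟩)))
    · intro x hx
      obtain ⟨i, -, rfl⟩ := Finset.mem_image.mp (Finset.mem_coe.mp hx)
      exact ⟨i, rfl⟩
  have hne : J f ≠ ⊤ := fun h => (irr_isMaximal (n := n)).ne_top
    (top_le_iff.mp (h ▸ (posHomog_of_mem_piece hc hf).J_le_irr))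
  have h1 := (J f).height_le_spanFinrank hne
  have h2 : (J f).spanFinrank ≤ t - 1 := by
    rw [hspan]
    refine (Submodule.spanFinrank_span_le_ncard_of_finite (Finset.finite_toSet _)).trans ?_
    rw [Set.ncard_coe_finset]
    refine Finset.card_image_le.trans ?_
    rw [Finset.card_erase_of_mem (Finset.mem_univ j), Finset.card_univ, Fintype.card_fin]
  rw [hht] at h1
  have h3 : t ≤ (J f).spanFinrank := by exact_mod_cast h1
  have := j.2
  omega

/-- A graded matrix mapping a complete intersection to itself has determinant one. -/
lemma det_eq_one_of_mulVec_eq {c : Fin t → ℤ} (hc : ∀ i, 1 ≤ c i) (hmono : Monotone c)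
    {f : Fin t → R n} (hf : f ∈ piece n c 0) (hht : (J f).height = t)
    {A : Matrix (Fin t) (Fin t) (R n)} (hA : IsGradedMatrix c c A) (hAf : A.mulVec f = f) :
    A.det = 1 := by
  -- Here the entry has degree at most zero, so it is a constant. Each row of `A - 1` is a relation
  -- among the generators, whose constant coefficients vanish by minimality. Thus `A` is lower
  -- triangular with ones on the diagonal.
  have key : ∀ i j, c i ≤ c j → A i j = (1 : Matrix (Fin t) (Fin t) (R n)) i j := by
    intro i j hij
    have hu : ∑ k, (A i k - (1 : Matrix (Fin t) (Fin t) (R n)) i k) * f k = 0 := by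
      have h1 := congrFun hAf i
      have h2 := congrFun (Matrix.one_mulVec f) i
      simp only [Matrix.mulVec, dotProduct] at h1 h2
      simp only [sub_mul, Finset.sum_sub_distrib, h1, h2, sub_self]
    have h1 : ∃ z, A i j = C z := by
      rcases mem_homog.mp (hA i j) with ⟨h0, h⟩ | h
      · rw [show (c i - c j).toNat = 0 by omega] at h
        exact ⟨_, totalDegree_eq_zero_iff_eq_C.mp (Nat.le_zero.mp h.totalDegree_le)⟩
      · exact ⟨0, by rw [h, C_0]⟩
    obtain ⟨z, hz⟩ := h1
    have h2 : (1 : Matrix (Fin t) (Fin t) (R n)) i j = C (if i = j then 1 else 0) := by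
      rw [Matrix.one_apply]
      split_ifs <;> simp
    have h3 : A i j - (1 : Matrix (Fin t) (Fin t) (R n)) i j = C (z - if i = j then 1 else 0) := by
      rw [hz, h2, C_sub]
    have := coeff_eq_zero_of_relation hc hf hht hu h3
    rw [← sub_eq_zero, h3, this, C_0]
  rw [Matrix.det_of_isLowerTriangular A]
  · exact Finset.prod_eq_one fun i _ => by rw [key i i le_rfl, Matrix.one_apply_eq]
  · intro i j hij
    have hij : i < j := hij
    rw [key i j (hmono hij.le), Matrix.one_apply_ne hij.ne]

lemma J_mulVec_eq_of_isUnit_det {A : Matrix (Fin t) (Fin t) (R n)} (hA : IsUnit A.det)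
    (f : Fin t → R n) : J (A.mulVec f) = J f := by
  refine le_antisymm (J_mulVec_le A f) ?_
  have := J_mulVec_le A⁻¹ (A.mulVec f)
  rwa [Matrix.mulVec_mulVec, Matrix.nonsing_inv_mul A hA, Matrix.one_mulVec] at this

/-- Two systems of generators of a complete intersection differ by an invertible graded matrix. -/
lemma exists_isUnit_det_of_J_eq {c : Fin t → ℤ} (hc : ∀ i, 1 ≤ c i) (hmono : Monotone c)
    {f f' : Fin t → R n} (hf : f ∈ piece n c 0) (hht : (J f).height = t)
    (hf' : f' ∈ piece n c 0) (h : J f = J f') :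
    ∃ A : Matrix (Fin t) (Fin t) (R n), IsGradedMatrix c c A ∧ A.mulVec f = f' ∧
      IsUnit A.det := by
  obtain ⟨A, hA, hAf⟩ := exists_isGradedMatrix hf' hf h.ge
  obtain ⟨B, hB, hBf⟩ := exists_isGradedMatrix hf hf' h.le
  refine ⟨A, hA, hAf, ?_⟩
  have := det_eq_one_of_mulVec_eq hc hmono hf hht (hB.mul hA)
    (by rw [← Matrix.mulVec_mulVec, hAf, hBf])
  rw [Matrix.det_mul, mul_comm] at this
  exact .of_mul_eq_one _ this

end IncidenceCI

end

noncomputable section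

/-! ## Normal forms of singular complete intersections -/

namespace IncidenceCI

open MvPolynomial

variable {n r s : ℕ}

lemma ev_mulVec_eq_zero (A : Matrix (Fin r) (Fin s) (R n)) {g : Fin s → R n}
    (hg : ∀ j, ev n (g j) = 0) (i : Fin r) : ev n (A.mulVec g i) = 0 := by
  change ev n (∑ j, A i j * g j) = 0
  rw [map_sum]
  exact Finset.sum_eq_zero fun j _ => by rw [map_mul, hg, mul_zero]

lemma grad_mulVec (A : Matrix (Fin r) (Fin s) (R n)) {g : Fin s → R n}
    (hg : ∀ j, ev n (g j) = 0) : grad (A.mulVec g) = (A.map (ev n)) * grad g := by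
  ext i k
  change dv n k (∑ j, A i j * g j) = ∑ j, ev n (A i j) * dv n k (g j)
  rw [map_sum]
  exact Finset.sum_congr rfl fun j _ => by rw [dv_mul, hg, zero_mul, add_zero]

/-- The matrix replacing the `e`-th generator by the combination of all generators with constant
coefficients `l` (up to powers of `x₀`). -/
def normalMatrix (n : ℕ) (a : Fin r → ℤ) (e : Fin r) (l : Fin r → ℂ) :
    Matrix (Fin r) (Fin r) (R n) :=
  (1 : Matrix (Fin r) (Fin r) (R n)).updateRow e fun k => C (l k) * X 0 ^ (a e - a k).toNat

lemma isGradedMatrix_normalMatrix {a : Fin r → ℤ} {e : Fin r} (he : ∀ k, a k ≤ a e)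
    (l : Fin r → ℂ) : IsGradedMatrix a a (normalMatrix n a e l) := by
  intro i k
  by_cases hi : i = e
  · subst hi
    rw [normalMatrix, Matrix.updateRow_self]
    have := homog_mul (mem_homog_of_isHomogeneous (isHomogeneous_C (Fin (n + 1)) (l k)) (e := 0) rfl)
      (X_pow_mem_homog (0 : Fin (n + 1)) (d := a i - a k) (by linarith [he k]))
    rwa [zero_add] at this
  · rw [normalMatrix, Matrix.updateRow_ne hi, Matrix.one_apply]
    split_ifs with h
    · subst h
      exact mem_homog_of_isHomogeneous (isHomogeneous_one _ _) (by simp)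
    · exact zero_mem _

lemma det_normalMatrix (a : Fin r → ℤ) (e : Fin r) (l : Fin r → ℂ) :
    (normalMatrix n a e l).det = C (l e) := by
  rw [normalMatrix, ← Matrix.cramer_transpose_apply, Matrix.transpose_one, Matrix.cramer_one]
  simp

lemma normalMatrix_mulVec_ne {a : Fin r → ℤ} {e i : Fin r} (h : i ≠ e) (l : Fin r → ℂ)
    (f : Fin r → R n) : (normalMatrix n a e l).mulVec f i = f i := by
  rw [Matrix.mulVec, normalMatrix, Matrix.updateRow_ne h]
  exact congrFun (Matrix.one_mulVec f) i

lemma normalMatrix_mulVec_self (a : Fin r → ℤ) (e : Fin r) (l : Fin r → ℂ)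
    (f : Fin r → R n) : (normalMatrix n a e l).mulVec f e =
      ∑ k, C (l k) * X 0 ^ (a e - a k).toNat * f k := by
  rw [Matrix.mulVec, normalMatrix, Matrix.updateRow_self]
  rfl

lemma dv_normalMatrix_mulVec_self {a : Fin r → ℤ} {e : Fin r} (l : Fin r → ℂ)
    (f : Fin r → R n) (j : Fin n) :
    dv n j ((normalMatrix n a e l).mulVec f e) = ∑ k, l k * grad f k j := by
  rw [normalMatrix_mulVec_self, map_sum]
  refine Finset.sum_congr rfl fun k _ => ?_
  rw [mul_assoc, C_mul', map_smul, dv_X_zero_pow_mul, smul_eq_mul]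
  rfl

/-- Powers of `x₀` do not affect gradients at `o`, so the new last generator has gradient `∑ l_k
grad f_k = 0`. -/
lemma normalMatrix_mulVec_mem {a : Fin r → ℤ} {e : Fin r} (hae : ∀ k, a k ≤ a e)
    (he : (e : ℕ) + 1 = r) {l : Fin r → ℂ} {f : Fin r → R n} (hf : f ∈ piece n a 0)
    (hf0 : ∀ i, ev n (f i) = 0) (hl : ∀ j, ∑ k, l k * grad f k j = 0) :
    (normalMatrix n a e l).mulVec f ∈ degZero n a (Io n • Na n r) := by
  refine mem_degZero_Io_Na_iff.mpr ⟨(isGradedMatrix_normalMatrix hae l).mulVec_mem hf,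
    ev_mulVec_eq_zero _ hf0, fun i hi j => ?_⟩
  obtain rfl : i = e := Fin.ext (by omega)
  rw [dv_normalMatrix_mulVec_self, hl]

/-- The cofactors annihilating the rows of a matrix with dependent rows. -/
def cofactors (hr : r ≤ n) (e : Fin r) (M : Matrix (Fin r) (Fin n) ℂ) : Fin r → ℂ :=
  (M.submatrix id (Fin.castLE hr)).adjugate e

/-- By Cramer's rule the sum is the determinant of the leading minor with its `e`-th column replaced
by the `j`-th column of `M`; dependent rows make it zero. Unlike an arbitrary relation among the
rows, this one is polynomial in `M`. -/
lemma sum_cofactors_mul (hr : r ≤ n) (e : Fin r) {M : Matrix (Fin r) (Fin n) ℂ}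
    (hM : ¬ LinearIndependent ℂ M.row) (j : Fin n) : ∑ i, cofactors hr e M i * M i j = 0 := by
  obtain ⟨l, hl, h⟩ := (not_linearIndependent_row_iff M).mp hM
  have h1 := congrFun (Matrix.cramer_eq_adjugate_mulVec (M.submatrix id (Fin.castLE hr))
    (fun i => M i j)) e
  refine h1.symm.trans ?_
  rw [Matrix.cramer_apply]
  refine Matrix.exists_vecMul_eq_zero_iff.mp ⟨l, hl, funext fun k => ?_⟩
  by_cases hk : k = e
  · subst hk
    simpa [Matrix.vecMul, dotProduct] using h j
  · simpa [Matrix.vecMul, dotProduct, hk] using h (Fin.castLE hr k)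

lemma cofactors_eq_of_eq (hr : r ≤ n) (e : Fin r) {M M' : Matrix (Fin r) (Fin n) ℂ}
    (h : ∀ i, i ≠ e → M i = M' i) : cofactors hr e M e = cofactors hr e M' e := by
  rw [cofactors, cofactors, Matrix.adjugate_apply, Matrix.adjugate_apply]
  congr 1
  ext i k
  by_cases hi : i = e
  · subst hi
    rw [Matrix.updateRow_self, Matrix.updateRow_self]
  · rw [Matrix.updateRow_ne hi, Matrix.updateRow_ne hi, Matrix.submatrix_apply,
      Matrix.submatrix_apply, id, h i hi]

lemma cofactors_ne (hr : r ≤ n) {e i : Fin r} (hi : i ≠ e) {M : Matrix (Fin r) (Fin n) ℂ}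
    (h : M e = 0) : cofactors hr e M i = 0 := by
  rw [cofactors, Matrix.adjugate_apply]
  refine Matrix.det_eq_zero_of_row_eq_zero e fun k => ?_
  rw [Matrix.updateRow_ne hi.symm, Matrix.submatrix_apply, id, h, Pi.zero_apply]

lemma polyFun_cofactors (hr : r ≤ n) (e i : Fin r) :
    (fun f : Fin r → R n => cofactors hr e (grad f) i) ∈ polyFun (Fin r → R n) := by
  simp only [cofactors, Matrix.adjugate_apply]
  refine polyFun_det fun k j => ?_
  by_cases hk : k = i
  · subst hk
    simp only [Matrix.updateRow_self]
    exact const_mem_polyFun _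
  · simp only [Matrix.updateRow_ne hk, Matrix.submatrix_apply, id]
    exact dual_mem_polyFun
      { toFun := fun f : Fin r → R n => dv n (Fin.castLE hr j) (f k)
        map_add' := fun _ _ => map_add _ _ _
        map_smul' := fun z f => (dv n _).map_smul z (f k) }

/-- Separates the dependence on `l`, which makes the normal form visibly polynomial in `f` once `l`
is given by cofactors. -/
lemma normalMatrix_mulVec_eq (a : Fin r → ℤ) (e : Fin r) (l : Fin r → ℂ) (f : Fin r → R n) :
    (normalMatrix n a e l).mulVec f = (normalMatrix n a e 0).mulVec f +
      ∑ k, l k • (Pi.single e (X 0 ^ (a e - a k).toNat * f k) : Fin r → R n) := by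
  funext i
  rw [Pi.add_apply, Finset.sum_apply]
  by_cases h : i = e
  · subst h
    rw [normalMatrix_mulVec_self, normalMatrix_mulVec_self]
    simp [C_mul']
  · rw [normalMatrix_mulVec_ne h, normalMatrix_mulVec_ne h]
    simp [h]

lemma polyFun_normalMatrix_mulVec (hr : r ≤ n) (a : Fin r → ℤ) (e : Fin r)
    {p : (Fin r → R n) → ℂ} (hp : p ∈ polyFun (Fin r → R n)) :
    (fun f => p ((normalMatrix n a e (cofactors hr e (grad f))).mulVec f)) ∈
      polyFun (Fin r → R n) := by
  refine polyFun_comp (fun ψ => ?_) hp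
  simp only [normalMatrix_mulVec_eq a e (cofactors hr e _), map_add, map_sum, map_smul, smul_eq_mul]
  refine polyFun_add ?_ (polyFun_sum _ fun k _ => polyFun_mul (polyFun_cofactors hr e k) ?_)
  · let L : (Fin r → R n) →ₗ[ℂ] (Fin r → R n) :=
      { toFun := fun f => (normalMatrix n a e 0).mulVec f
        map_add' := fun _ _ => Matrix.mulVec_add _ _ _
        map_smul' := fun _ _ => Matrix.mulVec_smul _ _ _ }
    have h := dual_mem_polyFun (W := Fin r → R n) (ψ ∘ₗ L)
    exact h
  · let L : (Fin r → R n) →ₗ[ℂ] (Fin r → R n) :=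
      { toFun := fun f => Pi.single e (X 0 ^ (a e - a k).toNat * f k)
        map_add' := fun f g => by rw [Pi.add_apply, mul_add, Pi.single_add]
        map_smul' := fun z f => by
          rw [Pi.smul_apply, mul_smul_comm, Pi.single_smul, RingHom.id_apply] }
    have h := dual_mem_polyFun (W := Fin r → R n) (ψ ∘ₗ L)
    exact h

lemma mulVecLin_mem_homZero_Na {a : Fin r → ℤ} {b : Fin s → ℤ} {A : Matrix (Fin r) (Fin s) (R n)}
    (hA : IsGradedMatrix a b A) (h0 : ∀ i : Fin r, (i : ℕ) + 1 = r → ∀ j, ev n (A i j) = 0) :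
    A.mulVecLin ∈ homZero n b a (Na n r) := by
  refine mem_homZero_Na_iff.mpr ⟨fun i j => ?_, fun i hi j => ?_⟩
  · rw [entry_mulVecLin]
    exact hA i j
  · rw [entry_mulVecLin]
    exact h0 i hi j

/-- A singular complete intersection containing a smooth one has a normal form in the image of
`(g, h) ↦ h(g)`. -/
lemma exists_pairing_eq {a : Fin r → ℤ} {b : Fin s → ℤ} {A : Matrix (Fin r) (Fin s) (R n)}
    (hA : IsGradedMatrix a b A) {g : Fin s → R n} (hg : g ∈ piece n b 0)
    (hg0 : ∀ j, ev n (g j) = 0) (hgi : LinearIndependent ℂ (grad g).row)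
    (hAg : A.mulVec g ∈ degZero n a (Io n • Na n r)) :
    ∃ x : V n a b, (pairing n a b x x : Fin r → R n) = A.mulVec g := by
  refine ⟨⟨(g, A.mulVecLin), mem_V_iff.mpr ⟨mem_degZero_Io_top_iff.mpr ⟨hg, hg0⟩,
    mulVecLin_mem_homZero_Na hA fun i hi => ?_⟩⟩, rfl⟩
  rw [mem_degZero_Io_Na_iff] at hAg
  -- The gradient of the last coordinate of `A g` is the combination of the gradients of `g` whose
  -- coefficients are the values at `o` of the last row of `A`. It is zero, so by independence these
  -- values vanish and `A` maps into `N_a`.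
  by_contra! h
  obtain ⟨j, hj⟩ := h
  refine absurd hgi ((not_linearIndependent_row_iff _).mpr
    ⟨fun j => ev n (A i j), fun h => hj (congrFun h j), fun k => ?_⟩)
  have h1 := hAg.2.2 i hi k
  have h2 := congrFun (congrFun (grad_mulVec A hg0) i) k
  rw [Matrix.mul_apply] at h2
  exact h2.symm.trans h1

end IncidenceCI

end

noncomputable section

/-! ## Dominance of `Ξ_o → Γ_o` -/

namespace IncidenceCI

open MvPolynomial

variable {n r s : ℕ}

lemma mulVec_mem_polyFun {m : ℕ} (A : Matrix (Fin m) (Fin r) (R n)) {p : (Fin m → R n) → ℂ}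
    (hp : p ∈ polyFun (Fin m → R n)) : (fun f => p (A.mulVec f)) ∈ polyFun (Fin r → R n) := by
  let L : (Fin r → R n) →ₗ[ℂ] (Fin m → R n) :=
    { toFun := fun f => A.mulVec f
      map_add' := fun _ _ => Matrix.mulVec_add _ _ _
      map_smul' := fun _ _ => Matrix.mulVec_smul _ _ _ }
  exact polyFun_comp_linear L hp

lemma restrict_mem_polyFun (S : Submodule ℂ (Fin r → R n)) {p : (Fin r → R n) → ℂ}
    (hp : p ∈ polyFun (Fin r → R n)) : (fun f : S => p f.1) ∈ polyFun S :=
  polyFun_comp_linear S.subtype hp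

/-- Two systems of generators of a complete intersection differ by an invertible graded matrix. The
preimage under `q` is therefore the union over such matrices `A` of the open loci `P(A f) ≠ 0`. -/
lemma isOpen_image_q {a : Fin r → ℤ} (ha1 : ∀ i, 1 ≤ a i) (hmono : Monotone a) (hr : r ≤ n)
    {P : (Fin r → R n) → ℂ} (hP : P ∈ polyFun (Fin r → R n)) :
    IsOpen {Y : H n a | ∃ f : ciLocus n a, q n a f = Y ∧ P f.1.1 ≠ 0} := by
  let _ := zariski (piece n a 0)
  rw [isOpen_coinduced, isOpen_induced_iff]
  refine ⟨⋃ A : {A : Matrix (Fin r) (Fin r) (R n) // IsGradedMatrix a a A ∧ IsUnit A.det},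
    {f | P (A.1.mulVec f.1) ≠ 0}, ?_, ?_⟩
  · refine isOpen_iUnion fun A => ?_
    exact isOpen_ne_zero (restrict_mem_polyFun _ (mulVec_mem_polyFun A.1 hP))
  · ext f
    simp only [Set.mem_preimage, Set.mem_iUnion, Set.mem_ofPred_eq]
    constructor
    · rintro ⟨⟨A, hA, hAu⟩, hPA⟩
      have hJ := J_mulVec_eq_of_isUnit_det hAu f.1.1
      let f' : ciLocus n a := ⟨⟨A.mulVec f.1.1, hA.mulVec_mem f.1.2⟩, by
        change (J (A.mulVec f.1.1)).height = r
        rw [hJ]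
        exact f.2⟩
      exact ⟨f', (q_eq_q_iff ha1 hr).mpr hJ, hPA⟩
    · rintro ⟨f', hf', hPf'⟩
      obtain ⟨A, hA, hAf, hAu⟩ := exists_isUnit_det_of_J_eq ha1 hmono f.1.2 f.2 f'.1.2
        ((q_eq_q_iff ha1 hr).mp hf').symm
      exact ⟨⟨A, hA, hAu⟩, by rwa [hAf]⟩

/-- A neighbourhood of a point of `H_c` contains the image of a basic open set. -/
lemma exists_polyFun_of_isOpen_H {a : Fin r → ℤ} {O : Set (H n a)} (hO : IsOpen O)
    {f : ciLocus n a} (hf : q n a f ∈ O) :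
    ∃ P ∈ polyFun (Fin r → R n), P f.1.1 ≠ 0 ∧
      ∀ f' : ciLocus n a, P f'.1.1 ≠ 0 → q n a f' ∈ O := by
  let _ := zariski (piece n a 0)
  rw [isOpen_coinduced, isOpen_induced_iff] at hO
  obtain ⟨U, hU, hUO⟩ := hO
  obtain ⟨p, hp, hpf, hpU⟩ := exists_polyFun_of_isOpen hU (x := f.1) (by
    change f ∈ Subtype.val ⁻¹' U
    rw [hUO]
    exact hf)
  obtain ⟨P, hP, hPp⟩ := exists_polyFun_extension _ hp
  refine ⟨P, hP, by rwa [hPp], fun f' hf' => ?_⟩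
  rw [hPp] at hf'
  change f' ∈ q n a ⁻¹' O
  rw [← hUO]
  exact hpU _ hf'

/-- When `X = V(f)` contains a `Z = V(g)` smooth at `o`, the normal form of `f` is a graded matrix
times `g` and lies in `W`, so it is a value of the quadratic map, where `P` vanishes. -/
lemma eval_normalMatrix_eq_zero {a : Fin r → ℤ} {b : Fin s → ℤ} (hb1 : ∀ j, 1 ≤ b j)
    (hr : r ≤ n) (hs : s ≤ n) {e : Fin r} (he : (e : ℕ) + 1 = r) (hae : ∀ k, a k ≤ a e)
    {P : (Fin r → R n) → ℂ} (hP : ∀ x : V n a b, P (pairing n a b x x) = 0)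
    {f : ciLocus n a} {ξ : Xi n a b} (hξ : (alphaXi n a b ξ).1 = q n a f) :
    P ((normalMatrix n a e (cofactors hr e (grad f.1.1))).mulVec f.1.1) = 0 := by
  obtain ⟨⟨Z, X⟩, hZo, hXZ, hX, hZ⟩ := ξ
  obtain rfl : X = q n a f := hξ
  obtain ⟨_, g, hg, rfl⟩ := Z
  rw [q_mem_Gamma_iff] at hX
  have hg0 : ∀ j, ev n (g.1 j) = 0 := (J_le_Io_iff g.2).mp (saturation_le_Io_iff.mp hZo)
  have hgi : LinearIndependent ℂ (grad g.1).row := by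
    by_contra h
    exact hZ ((q_mem_Gamma_iff ⟨g, hg⟩).mpr ⟨hg0, h⟩)
  have hJ : J f.1.1 ≤ J g.1 := by
    refine Ideal.span_le.mpr ?_
    rintro _ ⟨i, rfl⟩
    exact mem_J_of_mem_saturation hb1 hs g.2 hg (mem_piece_zero.mp f.1.2 i)
      (hXZ (le_saturation _ (mem_J_self _ i)))
  obtain ⟨A, hA, hAg⟩ := exists_isGradedMatrix f.1.2 g.2 hJ
  have hW := normalMatrix_mulVec_mem hae he f.1.2 hX.1 (sum_cofactors_mul hr e hX.2)
  rw [← hAg, Matrix.mulVec_mulVec, hAg] at hW ⊢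
  obtain ⟨x, hx⟩ := exists_pairing_eq ((isGradedMatrix_normalMatrix hae _).mul hA) g.2 hg0 hgi hW
  rw [← hx]
  exact hP x

/-- The linear automorphism of `(I_o N_a)_0` scaling the `e`-th coordinate. -/
lemma update_mem_W {a : Fin r → ℤ} {f : Fin r → R n} (hf : f ∈ degZero n a (Io n • Na n r))
    (e : Fin r) (z : ℂ) : Function.update f e (z • f e) ∈ degZero n a (Io n • Na n r) := by
  rw [mem_degZero_Io_Na_iff, mem_piece_zero] at hf ⊢
  refine ⟨fun i => ?_, fun i => ?_, fun i hi j => ?_⟩ <;> by_cases h : i = e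
  · subst h
    rw [Function.update_self]
    exact Submodule.smul_mem _ _ (hf.1 i)
  · rw [Function.update_of_ne h]
    exact hf.1 i
  · subst h
    rw [Function.update_self, map_smul, hf.2.1, smul_zero]
  · rw [Function.update_of_ne h]
    exact hf.2.1 i
  · subst h
    rw [Function.update_self, map_smul, hf.2.2 i hi, smul_zero]
  · rw [Function.update_of_ne h]
    exact hf.2.2 i hi j

lemma grad_row_eq_zero {a : Fin r → ℤ} {e : Fin r} (he : (e : ℕ) + 1 = r) {f : Fin r → R n}
    (hf : f ∈ degZero n a (Io n • Na n r)) : grad f e = 0 := by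
  have h := (mem_degZero_Io_Na_iff.mp hf).2.2 e he
  funext j
  exact h j

/-- On `W` the last gradient is zero, so all cofactors but the `e`-th vanish and passing to the
normal form only rescales the last coordinate. -/
lemma normalMatrix_mulVec_of_mem_W {a : Fin r → ℤ} (hr : r ≤ n) {e : Fin r}
    (he : (e : ℕ) + 1 = r) {f : Fin r → R n} (hf : f ∈ degZero n a (Io n • Na n r)) :
    (normalMatrix n a e (cofactors hr e (grad f))).mulVec f =
      Function.update f e (cofactors hr e (grad f) e • f e) := by
  funext i
  by_cases h : i = e
  · subst h
    rw [normalMatrix_mulVec_self, Function.update_self, Finset.sum_eq_single i]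
    · simp [C_mul']
    · intro k _ hk
      rw [cofactors_ne hr hk (grad_row_eq_zero he hf), C_0, zero_mul, zero_mul]
    · simp
  · rw [normalMatrix_mulVec_ne h, Function.update_of_ne h]

lemma exists_cofactors_ne_zero {a : Fin r → ℤ} (ha1 : ∀ i, 1 ≤ a i) (hr : r ≤ n) {e : Fin r}
    (he : (e : ℕ) + 1 = r) :
    ∃ f : degZero n a (Io n • Na n r), cofactors hr e (grad f.1) e ≠ 0 := by
  let f : Fin r → R n := Function.update
    (fun i => X 0 ^ (a i - 1).toNat * X (i.castLE hr).succ) e 0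
  have hf : f ∈ degZero n a (Io n • Na n r) := by
    refine mem_degZero_Io_Na_iff.mpr ⟨mem_piece_zero.mpr fun i => ?_, fun i => ?_, fun i hi j => ?_⟩
    · by_cases h : i = e
      · subst h
        simp only [f, Function.update_self]
        exact zero_mem _
      · simp only [f, Function.update_of_ne h]
        exact X_zero_pow_mul_X_mem_homog (ha1 i) _
    · by_cases h : i = e
      · subst h
        simp [f]
      · simp [f, Function.update_of_ne h]
    · obtain rfl : i = e := Fin.ext (by omega)
      simp [f]
  refine ⟨⟨f, hf⟩, ?_⟩
  have : ((grad f).submatrix id (Fin.castLE hr)).updateRow e (Pi.single e 1) = 1 := by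
    ext i k
    by_cases h : i = e
    · subst h
      rw [Matrix.updateRow_self, Matrix.one_apply, Pi.single_apply]
      simp only [eq_comm]
    · rw [Matrix.updateRow_ne h]
      simp [grad, f, Function.update_of_ne h, dv_X_zero_pow_mul_X, Matrix.one_apply, Fin.ext_iff]
  rw [cofactors, Matrix.adjugate_apply]
  change (((grad f).submatrix id (Fin.castLE hr)).updateRow e (Pi.single e 1)).det ≠ 0
  rw [this, Matrix.det_one]
  exact one_ne_zero

/-- Complete intersections are general in `W`, so the vanishing extends to all normal forms of
elements of `W`. These are rescalings of the last coordinate, which can be undone where the `e`-th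
cofactor is nonzero, again a general condition. -/
lemma eq_zero_of_eval_normalMatrix_eq_zero {a : Fin r → ℤ} (ha2 : ∀ i, 2 ≤ a i) (hr : r ≤ n)
    {e : Fin r} (he : (e : ℕ) + 1 = r) {P : (Fin r → R n) → ℂ} (hP : P ∈ polyFun (Fin r → R n))
    (h : ∀ f ∈ degZero n a (Io n • Na n r), (J f).height = r →
      P ((normalMatrix n a e (cofactors hr e (grad f))).mulVec f) = 0)
    (f : Fin r → R n) (hf : f ∈ degZero n a (Io n • Na n r)) : P f = 0 := by
  have hPN := restrict_mem_polyFun (degZero n a (Io n • Na n r))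
    (polyFun_normalMatrix_mulVec hr a e hP)
  have h0 : ∀ f ∈ degZero n a (Io n • Na n r),
      P ((normalMatrix n a e (cofactors hr e (grad f))).mulVec f) = 0 := by
    by_contra! h0
    obtain ⟨f, hf, hPf⟩ := h0
    obtain ⟨w, hw, hw'⟩ := ((forGeneral_height_Io_Na ha2 hr).and
      (.of_polyFun hPN (x := ⟨f, hf⟩) hPf fun _ h => h)).exists
    exact hw' (h w.1 w.2 hw)
  have h1 : ∀ f ∈ degZero n a (Io n • Na n r), cofactors hr e (grad f) e ≠ 0 → P f = 0 := by
    intro f hf hfe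
    set z := cofactors hr e (grad f) e with hz
    have hf' := update_mem_W hf e z⁻¹
    -- The `e`-th cofactor does not involve the `e`-th row, so dividing the last coordinate by `z`
    -- beforehand leaves it equal to `z`.
    have hcof : cofactors hr e (grad (Function.update f e (z⁻¹ • f e))) e = z := by
      refine cofactors_eq_of_eq hr e fun i hi => ?_
      funext j
      simp [grad, Function.update_of_ne hi]
    have := h0 _ hf'
    rw [normalMatrix_mulVec_of_mem_W hr he hf', hcof, Function.update_self, smul_smul,
      mul_inv_cancel₀ hfe, one_smul, Function.update_idem, Function.update_eq_self] at this
    exact this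
  by_contra hPf
  obtain ⟨f', hf'⟩ := exists_cofactors_ne_zero (fun i => by linarith [ha2 i]) hr he (a := a)
  obtain ⟨w, hw, hw'⟩ := exists_mul_ne_zero (restrict_mem_polyFun (degZero n a (Io n • Na n r)) hP)
    (restrict_mem_polyFun _ (polyFun_cofactors hr e e)) (x := ⟨f, hf⟩) (y := f') hPf hf'
  exact hw (h1 w.1 w.2 hw')

lemma mem_Gamma_of_mem_W {a : Fin r → ℤ} {e : Fin r} (he : (e : ℕ) + 1 = r) {f : ciLocus n a}
    (hf : f.1.1 ∈ degZero n a (Io n • Na n r)) : q n a f ∈ Gamma n a := by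
  refine (q_mem_Gamma_iff f).mpr ⟨(mem_degZero_Io_Na_iff.mp hf).2.1,
    (not_linearIndependent_row_iff _).mpr ⟨Pi.single e 1, by simp, fun j => ?_⟩⟩
  have := congrFun (grad_row_eq_zero he hf) j
  simpa [Pi.single_apply] using this

/-- If `p` vanishes on all `h(g)` but its extension does not vanish on the normal form of some
complete intersection in `W`, the nonvanishing locus defines an open subset of `H_a` that meets
`Γ_o` and misses the image of `Ξ_o`. -/
theorem pairing_dominant_of_denseRange {a : Fin r → ℤ} {b : Fin s → ℤ} (hmono : Monotone a)
    (ha2 : ∀ i, 2 ≤ a i) (hb1 : ∀ j, 1 ≤ b j) (hr : r ≤ n) (hs : s ≤ n) {e : Fin r}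
    (he : (e : ℕ) + 1 = r) (h : DenseRange (alphaXi n a b))
    {p : degZero n a (Io n • Na n r) → ℂ} (hp : p ∈ polyFun (degZero n a (Io n • Na n r)))
    (hp0 : ∀ x : V n a b, p (pairing n a b x x) = 0) : p = 0 := by
  have hae : ∀ k, a k ≤ a e := fun k => hmono (Fin.le_def.mpr (by have := k.2; omega))
  have ha1 : ∀ i, 1 ≤ a i := fun i => by linarith [ha2 i]
  obtain ⟨P, hP, hPp⟩ := exists_polyFun_extension _ hp
  have hP0 : ∀ x : V n a b, P (pairing n a b x x) = 0 := fun x => (hPp _).trans (hp0 x)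
  funext w
  rw [← hPp]
  refine eq_zero_of_eval_normalMatrix_eq_zero ha2 hr he hP (fun f hf hht => ?_) w.1 w.2
  by_contra hne
  have hopen := isOpen_image_q ha1 hmono hr (polyFun_normalMatrix_mulVec hr a e hP)
  let f' : ciLocus n a := ⟨⟨f, hf.2⟩, hht⟩
  have hΓ : q n a f' ∈ Gamma n a := mem_Gamma_of_mem_W he hf
  obtain ⟨ξ, f'', hf'', hne''⟩ := h.exists_mem_open (hopen.preimage continuous_subtype_val)
    ⟨⟨q n a f', hΓ⟩, f', rfl, hne⟩
  exact hne'' (eval_normalMatrix_eq_zero hb1 hr hs he hae hP0 hf''.symm)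

end IncidenceCI

end

/-! ### From dominance of the quadratic map to density of the image of `Ξ_o` -/

noncomputable section

namespace IncidenceCI

open MvPolynomial

lemma polyFun_bilinear {X W : Type*} [AddCommGroup X] [Module ℂ X] [FiniteDimensional ℂ X]
    [AddCommGroup W] [Module ℂ W] (B : X →ₗ[ℂ] X →ₗ[ℂ] W) {p : W → ℂ} (hp : p ∈ polyFun W) :
    (fun x => p (B x x)) ∈ polyFun X := by
  refine polyFun_comp (fun ψ => ?_) hp
  let v := Module.finBasis ℂ X
  have : (fun x => ψ (B x x)) = fun x => ∑ i, v.coord i x * (ψ ∘ₗ B (v i)) x := by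
    funext x
    have hx : B x = ∑ i, v.repr x i • B (v i) := by
      conv_lhs => rw [← v.sum_repr x]
      simp only [map_sum, map_smul]
    rw [hx, LinearMap.sum_apply, map_sum]
    simp
  rw [this]
  exact polyFun_sum _ fun i _ => polyFun_mul (dual_mem_polyFun _) (dual_mem_polyFun _)

variable {n r s : ℕ}

/-- The vector `Pi.single e 2 - l` has entry `1` at `e` and `-l k` elsewhere, so it encodes the
inverse of the unipotent change of generators. -/
lemma normalMatrix_mulVec_normalMatrix_mulVec {a : Fin r → ℤ} {e : Fin r} {l : Fin r → ℂ}
    (hl : l e = 1) (f : Fin r → R n) :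
    (normalMatrix n a e (Pi.single e 2 - l)).mulVec ((normalMatrix n a e l).mulVec f) = f := by
  funext i
  by_cases h : i = e
  · subst h
    rw [normalMatrix_mulVec_self, ← Finset.add_sum_erase _ _ (Finset.mem_univ i),
      normalMatrix_mulVec_self, ← Finset.add_sum_erase _ _ (Finset.mem_univ i)]
    have : ∀ k ∈ Finset.univ.erase i, C ((Pi.single i 2 - l : Fin r → ℂ) k) *
        X 0 ^ (a i - a k).toNat * (normalMatrix n a i l).mulVec f k =
          -(C (l k) * X 0 ^ (a i - a k).toNat * f k) := by
      intro k hk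
      have hki := (Finset.mem_erase.mp hk).1
      rw [normalMatrix_mulVec_ne hki]
      simp [hki]
    rw [Finset.sum_congr rfl this, Finset.sum_neg_distrib, Pi.sub_apply, Pi.single_eq_same, hl,
      show (2 - 1 : ℂ) = 1 by norm_num]
    simp only [C_1, sub_self, Int.toNat_zero, pow_zero, one_mul]
    ring
  · rw [normalMatrix_mulVec_ne h, normalMatrix_mulVec_ne h]

/-- A small deformation of a singular system of equations such that the last gradient depends on
the other ones. -/
lemma exists_deformation {a : Fin r → ℤ} (ha1 : ∀ i, 1 ≤ a i) (e : Fin r) {f : Fin r → R n}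
    (hf : f ∈ piece n a 0) (hf0 : ∀ i, ev n (f i) = 0) {l : Fin r → ℂ} (hl : l ≠ 0)
    (hlf : ∀ j, ∑ i, l i * grad f i j = 0) {P : (Fin r → R n) → ℂ}
    (hP : P ∈ polyFun (Fin r → R n)) (hPf : P f ≠ 0) :
    ∃ f' ∈ piece n a 0, (∀ i, ev n (f' i) = 0) ∧ P f' ≠ 0 ∧
      ∃ l' : Fin r → ℂ, l' e = 1 ∧ ∀ j, ∑ i, l' i * grad f' i j = 0 := by
  suffices ∃ f' ∈ piece n a 0, (∀ i, ev n (f' i) = 0) ∧ P f' ≠ 0 ∧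
      ∃ l' : Fin r → ℂ, l' e ≠ 0 ∧ ∀ j, ∑ i, l' i * grad f' i j = 0 by
    obtain ⟨f', h1, h2, h3, l', hle, hlf⟩ := this
    refine ⟨f', h1, h2, h3, (l' e)⁻¹ • l', inv_mul_cancel₀ hle, fun j => ?_⟩
    simp only [Pi.smul_apply, smul_eq_mul, mul_assoc, ← Finset.mul_sum, hlf, mul_zero]
  by_cases hle : l e = 0
  · obtain ⟨k, hk⟩ := Function.ne_iff.mp hl
    rw [Pi.zero_apply] at hk
    -- `u` has the gradient of `f_e` but the degree of `f_k`. Adding `-z u / l_k` to `f_k` changes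
    -- the relation by `-z grad f_e`, which is compensated by giving `f_e` the coefficient `z`; any
    -- `z ≠ 0` outside the roots of `P` on this line will do.
    let u : R n := ∑ j : Fin n, grad f e j • (X 0 ^ (a k - 1).toNat * X j.succ)
    have hu : u ∈ homog n (a k) := sum_mem fun j _ =>
      Submodule.smul_mem _ _ (X_zero_pow_mul_X_mem_homog (ha1 k) j)
    have hu0 : ev n u = 0 := by simp [u]
    have hud : ∀ j, dv n j u = grad f e j := by
      intro j
      simp [u, dv_X_zero_pow_mul_X]
    let v : Fin r → R n := Pi.single k (-(l k)⁻¹ • u)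
    have hv : v ∈ piece n a 0 := by
      refine mem_piece_zero.mpr fun i => ?_
      by_cases h : i = k
      · subst h
        simp only [v, Pi.single_eq_same]
        exact Submodule.smul_mem _ _ hu
      · simp only [v, Pi.single_eq_of_ne h]
        exact zero_mem _
    have hv0 : ∀ i, ev n (v i) = 0 := by
      intro i
      by_cases h : i = k
      · subst h
        simp [v, hu0]
      · simp [v, h]
    obtain ⟨Q, hQ⟩ := polyFun_line hP f v
    have hQ0 : Q ≠ 0 := by
      rintro rfl
      have := hQ 0
      rw [zero_smul, add_zero, Polynomial.eval_zero] at this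
      exact hPf this.symm
    obtain ⟨z, hz⟩ := Infinite.exists_notMem_finset (insert 0 Q.roots.toFinset)
    rw [Finset.mem_insert, not_or, Multiset.mem_toFinset, Polynomial.mem_roots hQ0] at hz
    refine ⟨f + z • v, add_mem hf (Submodule.smul_mem _ _ hv), fun i => ?_, ?_, l + Pi.single e z,
      ?_, fun j => ?_⟩
    · rw [Pi.add_apply, Pi.smul_apply, map_add, map_smul, hf0, hv0, smul_zero, add_zero]
    · rw [← hQ]
      exact hz.2
    · simpa [hle] using hz.1
    · have hke : k ≠ e := by
        rintro rfl
        exact hk hle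
      have hg : ∀ i, grad (f + z • v) i j = grad f i j + z * dv n j (v i) := by
        intro i
        simp [grad]
      have hvj : ∀ i, dv n j (v i) = if i = k then -(l k)⁻¹ * grad f e j else 0 := by
        intro i
        by_cases h : i = k
        · subst h
          simp [v, hud]
        · simp [v, h]
      simp only [hg, hvj, Pi.add_apply, add_mul, mul_add, Finset.sum_add_distrib, hlf j]
      simp [Pi.single_apply, hke]
      field_simp
      ring
  · exact ⟨f, hf, hf0, hPf, l, hle, hlf⟩

/-- An open set meeting `Γ_o` contains a basic one, given by some `P`. After a deformation the last
generator can be replaced so as to land in `W`, by a change of generators with inverse `A'`. Then `P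
∘ A'` is nonzero on `W`, so it is nonzero at some `h(g)`, and `(g, h)` can be taken general. -/
theorem denseRange_of_pairing_dominant {a : Fin r → ℤ} {b : Fin s → ℤ} (hmono : Monotone a)
    (ha2 : ∀ i, 2 ≤ a i) (hb1 : ∀ j, 1 ≤ b j) (hr : r ≤ n) (hs : s ≤ n) {e : Fin r}
    (he : (e : ℕ) + 1 = r)
    (h : ∀ p ∈ polyFun (degZero n a (Io n • Na n r)),
      (∀ x : V n a b, p (pairing n a b x x) = 0) → p = 0) : DenseRange (alphaXi n a b) := by
  have hae : ∀ k, a k ≤ a e := fun k => hmono (Fin.le_def.mpr (by have := k.2; omega))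
  have ha1 : ∀ i, 1 ≤ a i := fun i => by linarith [ha2 i]
  rintro ⟨Y, hY⟩
  rw [mem_closure_iff]
  rintro o ho hYo
  obtain ⟨O, hO, rfl⟩ := isOpen_induced_iff.mp ho
  obtain ⟨_, f, hf, rfl⟩ := Y
  obtain ⟨P, hP, hPf, hPO⟩ := exists_polyFun_of_isOpen_H hO (f := ⟨f, hf⟩) hYo
  obtain ⟨hf0, hfl⟩ := (q_mem_Gamma_iff ⟨f, hf⟩).mp hY
  obtain ⟨l, hl, hlf⟩ := (not_linearIndependent_row_iff _).mp hfl
  obtain ⟨f', hf', hf'0, hPf', l', hle, hlf'⟩ :=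
    exists_deformation ha1 e f.2 hf0 hl hlf hP hPf
  let A := normalMatrix n a e l'
  let A' := normalMatrix n a e (Pi.single e 2 - l')
  have hAu : IsUnit A'.det := by
    rw [det_normalMatrix, Pi.sub_apply, Pi.single_eq_same, hle, show (2 - 1 : ℂ) = 1 by norm_num,
      C_1]
    exact isUnit_one
  have hAA : A'.mulVec (A.mulVec f') = f' := normalMatrix_mulVec_normalMatrix_mulVec hle f'
  have hAg : IsGradedMatrix a a A' := isGradedMatrix_normalMatrix hae _
  have hw := normalMatrix_mulVec_mem hae he hf' hf'0 hlf'
  have hPA := restrict_mem_polyFun (degZero n a (Io n • Na n r)) (mulVec_mem_polyFun A' hP)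
  obtain ⟨p2, hp2, ⟨w2, hw2⟩, hp2'⟩ := (forGeneral_height_Io_Na ha2 hr).exists_polyFun
  have hp := polyFun_mul hPA hp2
  have hne : (fun w : degZero n a (Io n • Na n r) => P (A'.mulVec w.1) * p2 w) ≠ 0 := by
    obtain ⟨w, h1, h2⟩ := exists_mul_ne_zero hPA hp2 (x := ⟨A.mulVec f', hw⟩) (y := w2) (by
      rwa [hAA]) hw2
    exact fun h0 => mul_ne_zero h1 h2 (congrFun h0 w)
  have hex : ∃ x : V n a b, P (A'.mulVec (pairing n a b x x : Fin r → R n)) *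
      p2 (pairing n a b x x) ≠ 0 := by
    by_contra! h0
    exact hne (h _ hp h0)
  obtain ⟨x, hx⟩ := hex
  -- The requirements on `Z` (complete intersection, smooth at `o`) involve `g` alone, so `h = 0`
  -- suffices to show them nonempty on `V`; irreducibility of `V` combines them with those on `X`.
  obtain ⟨p3, hp3, ⟨g3, hg3⟩, hp3'⟩ := ((forGeneral_height_Io hb1 hs).and
    (forGeneral_linearIndependent_grad hb1 hs)).exists_polyFun
  let π : V n a b →ₗ[ℂ] degZero n b (Io n • ⊤) :=
    { toFun := fun x => ⟨x.1.1, x.2.1⟩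
      map_add' := fun _ _ => rfl
      map_smul' := fun _ _ => rfl }
  have hg3V : (g3.1, (0 : (Fin s → R n) →ₗ[R n] (Fin r → R n))) ∈ V n a b :=
    mem_V_iff.mpr ⟨g3.2, zero_mem _⟩
  have hp3π := polyFun_comp_linear (W := degZero n b (Io n • ⊤)) (W' := V n a b) π hp3
  have hpx := polyFun_bilinear (X := V n a b) (W := degZero n a (Io n • Na n r))
    (pairing n a b) hp
  obtain ⟨y, hy, hy3⟩ := exists_mul_ne_zero hpx hp3π (x := x) (y := ⟨_, hg3V⟩) hx hg3
  have hyW := (pairing n a b y y).2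
  rw [coe_pairing] at hyW
  have hfci := hp2' _ (right_ne_zero_of_mul hy)
  have hPy := left_ne_zero_of_mul hy
  rw [coe_pairing] at hPy hfci
  obtain ⟨hgci, hgi⟩ := hp3' _ hy3
  have hg := mem_degZero_Io_top_iff.mp y.2.1
  let F : ciLocus n a := ⟨⟨y.1.2 y.1.1, hyW.2⟩, hfci⟩
  let G : ciLocus n b := ⟨⟨y.1.1, hg.1⟩, hgci⟩
  have hJ : J (A'.mulVec F.1.1) = J F.1.1 := J_mulVec_eq_of_isUnit_det hAu _
  let F' : ciLocus n a := ⟨⟨A'.mulVec F.1.1, hAg.mulVec_mem F.1.2⟩, by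
    change (J (A'.mulVec F.1.1)).height = r
    rw [hJ]
    exact F.2⟩
  have hFF' : q n a F' = q n a F := (q_eq_q_iff ha1 hr).mpr hJ
  have hJFG : J F.1.1 ≤ J G.1.1 := by
    refine Ideal.span_le.mpr ?_
    rintro _ ⟨i, rfl⟩
    exact mem_J_iff.mpr ⟨entry y.1.2 i, (apply_eq_sum_entry _ _ _).symm⟩
  have hξ : (q n b G, q n a F) ∈ Xi n a b :=
    ⟨saturation_le_Io_iff.mpr ((J_le_Io_iff hg.1).mpr hg.2), saturation_mono hJFG,
      mem_Gamma_of_mem_W he hyW, fun h => ((q_mem_Gamma_iff G).mp h).2 hgi⟩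
  refine ⟨alphaXi n a b ⟨_, hξ⟩, ?_, ⟨_, rfl⟩⟩
  change q n a F ∈ O
  rw [← hFF']
  exact hPO F' hPy

end IncidenceCI

end

noncomputable section

/-! ## Dimension counts -/

namespace IncidenceCI

open MvPolynomial

lemma finrank_map_add_finrank_inf_ker {E F : Type*} [AddCommGroup E] [Module ℂ E] [AddCommGroup F]
    [Module ℂ F] (T : E →ₗ[ℂ] F) (K : Submodule ℂ E) [FiniteDimensional ℂ K] :
    Module.finrank ℂ (K.map T) + Module.finrank ℂ (K ⊓ LinearMap.ker T : Submodule ℂ E) =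
      Module.finrank ℂ K := by
  have h := LinearMap.finrank_range_add_finrank_ker (T.domRestrict K)
  rw [LinearMap.range_domRestrict] at h
  rw [← h, ← Submodule.map_comap_subtype, ← (Submodule.equivMapOfInjective K.subtype
    K.injective_subtype ((LinearMap.ker T).comap K.subtype)).finrank_eq, LinearMap.ker_domRestrict]

variable {n r s : ℕ}

lemma comp_mem_Io (d : ℤ) {F : R n} (hF : F ∈ Io n) : comp n d F ∈ Io n :=
  comp_mem_J (c := fun _ : Fin n => 1) (f := fun j => X j.succ)
    (mem_piece_zero.mpr fun _ => X_mem_homog _) d hF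

/-- The degree zero part of `J_g M_a + I_o h(M_b)` is the image of `δ` on
`(I_o M_b)_0 × Hom(M_b, M_a)_0`. -/
lemma inf_piece_eq_map_delta {a : Fin r → ℤ} {b : Fin s → ℤ} {g : Fin s → R n}
    (hg : g ∈ degZero n b (Io n • ⊤)) {h : (Fin s → R n) →ₗ[R n] (Fin r → R n)}
    (hh : h ∈ homZero n b a ⊤) :
    piece n a 0 ⊓ (J g • (⊤ : Submodule (R n) (Fin r → R n)) ⊔
      Io n • LinearMap.range h).restrictScalars ℂ =
    ((degZero n b (Io n • ⊤)).prod (homZero n b a ⊤)).map (delta g h) := by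
  rw [mem_homZero_top_iff] at hh
  have hg := (mem_degZero_Io_top_iff.mp hg).1
  ext f
  rw [Submodule.mem_inf, Submodule.restrictScalars_mem, Submodule.mem_map]
  constructor
  · rintro ⟨hf, hf'⟩
    rw [mem_piece_zero] at hf
    obtain ⟨u, hu, v, hv, huv⟩ := Submodule.mem_sup.mp hf'
    rw [mem_ideal_smul_top_iff] at hu
    rw [LinearMap.range_eq_map, ← Submodule.map_smul'', Submodule.mem_map] at hv
    obtain ⟨G, hG, rfl⟩ := hv
    rw [mem_ideal_smul_top_iff] at hG
    have hM : ∀ i, ∃ c : Fin s → R n, (∀ j, c j ∈ homog n (a i - b j)) ∧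
        ∑ j, c j * g j = comp n (a i) (u i) := fun i => exists_homog_coeffs hg (a i) (hu i)
    choose M' hM hMu using hM
    let M : Matrix (Fin r) (Fin s) (R n) := M'
    let G' : Fin s → R n := fun j => comp n (b j) (G j)
    refine ⟨(G', M.mulVecLin), ⟨⟨?_, ?_⟩, mem_homZero_top_iff.mpr fun i j => ?_⟩, ?_⟩
    · exact (mem_ideal_smul_top_iff _).mpr fun j => comp_mem_Io _ (hG j)
    · exact mem_piece_zero.mpr fun j => comp_mem _ _
    · change entry M.mulVecLin i j ∈ _
      rw [entry_mulVecLin]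
      exact hM i j
    · funext i
      change ∑ j, M i j * g j + h G' i = f i
      rw [← comp_eq_self (hf i), ← huv, Pi.add_apply, map_add, hMu, apply_eq_sum_entry h G,
        map_sum, apply_eq_sum_entry h G']
      congr 1
      refine Finset.sum_congr rfl fun j _ => ?_
      rw [mul_comm, mul_comm _ (G j), comp_mul _ (hh i j), sub_sub_cancel]
  · rintro ⟨⟨G, H⟩, ⟨hG, hH⟩, rfl⟩
    rw [SetLike.mem_coe, mem_homZero_top_iff] at hH
    change H g + h G ∈ _ ∧ H g + h G ∈ _
    refine ⟨add_mem (apply_mem_piece hH hg) (apply_mem_piece hh hG.2),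
      Submodule.add_mem_sup ((mem_ideal_smul_top_iff _).mpr fun i => ?_) ?_⟩
    · exact mem_J_iff.mpr ⟨_, (apply_eq_sum_entry H g i).symm⟩
    · rw [LinearMap.range_eq_map, ← Submodule.map_smul'']
      exact Submodule.mem_map_of_mem hG.1

lemma quotDim_add_finrank {a : Fin r → ℤ} {b : Fin s → ℤ} (x : V n a b) :
    quotDim a x.1.1 x.1.2 + Module.finrank ℂ (((degZero n b (Io n • ⊤)).prod
      (homZero n b a ⊤)).map (delta x.1.1 x.1.2)) = Module.finrank ℂ (piece n a 0) := by
  have hh : x.1.2 ∈ homZero n b a ⊤ := ⟨x.2.2.1, fun _ => trivial⟩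
  rw [← inf_piece_eq_map_delta x.2.1 hh, ← finrank_map_add_finrank_inf_ker
    ((J x.1.1 • (⊤ : Submodule (R n) (Fin r → R n)) ⊔
      Io n • LinearMap.range x.1.2).mkQ.restrictScalars ℂ) (piece n a 0)]
  have : LinearMap.ker ((J x.1.1 • (⊤ : Submodule (R n) (Fin r → R n)) ⊔
      Io n • LinearMap.range x.1.2).mkQ.restrictScalars ℂ) =
      (J x.1.1 • (⊤ : Submodule (R n) (Fin r → R n)) ⊔
      Io n • LinearMap.range x.1.2).restrictScalars ℂ := by
    ext f
    rw [LinearMap.mem_ker, LinearMap.restrictScalars_apply, Submodule.mkQ_apply,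
      Submodule.Quotient.mk_eq_zero, Submodule.restrictScalars_mem]
  rw [this]
  rfl

/-- The gradient of the `e`-th coordinate. -/
def gradAt (n : ℕ) (e : Fin r) : (Fin r → R n) →ₗ[ℂ] (Fin n → ℂ) :=
  LinearMap.pi fun j => dv n j ∘ₗ (LinearMap.proj e : (Fin r → R n) →ₗ[ℂ] R n)

/-- The values of all coordinates. -/
def evAll (n r : ℕ) : (Fin r → R n) →ₗ[ℂ] (Fin r → ℂ) :=
  LinearMap.pi fun i => (ev n).toLinearMap ∘ₗ (LinearMap.proj i : (Fin r → R n) →ₗ[ℂ] R n)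

lemma gradAt_apply (e : Fin r) (f : Fin r → R n) (j : Fin n) : gradAt n e f j = dv n j (f e) := by
  simp [gradAt]

lemma evAll_apply (f : Fin r → R n) (i : Fin r) : evAll n r f i = ev n (f i) := by
  simp [evAll]

/-- `W` is cut out in `(M_a)_0` by the `r` values at `o` and the `n` derivatives of the last
coordinate. These are independent, as the forms `x₀^{a_i}` and `x₀^{a_e - 1} x_j` show. -/
lemma finrank_piece_eq {a : Fin r → ℤ} (ha1 : ∀ i, 1 ≤ a i) {e : Fin r} (he : (e : ℕ) + 1 = r) :
    Module.finrank ℂ (piece n a 0) =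
      Module.finrank ℂ (degZero n a (Io n • Na n r)) + n + r := by
  let S : (Fin r → R n) →ₗ[ℂ] (Fin r → ℂ) × (Fin n → ℂ) := (evAll n r).prod (gradAt n e)
  have hker : piece n a 0 ⊓ LinearMap.ker S = degZero n a (Io n • Na n r) := by
    ext f
    rw [Submodule.mem_inf, mem_degZero_Io_Na_iff, LinearMap.mem_ker]
    refine and_congr_right fun _ => ?_
    rw [LinearMap.prod_apply, Function.prod_apply, Prod.mk_eq_zero, funext_iff, funext_iff]
    simp only [gradAt_apply, evAll_apply, Pi.zero_apply]
    refine and_congr Iff.rfl ⟨fun h i hi j => ?_, fun h => h e he⟩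
    obtain rfl : i = e := Fin.ext (by omega)
    exact h j
  have hmap : (piece n a 0).map S = ⊤ := by
    rw [eq_top_iff]
    rintro ⟨u, v⟩ -
    let w : R n := ∑ j, v j • (X 0 ^ (a e - 1).toNat * X j.succ)
    have hw : w ∈ homog n (a e) := sum_mem fun j _ =>
      Submodule.smul_mem _ _ (X_zero_pow_mul_X_mem_homog (ha1 e) j)
    have hdvX : ∀ (j : Fin n) (k : ℕ), dv n j (X 0 ^ k) = 0 := by
      intro j k
      rw [← mul_one (X 0 ^ k), dv_X_zero_pow_mul, dv_apply]
      simp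
    refine ⟨(fun i => u i • X 0 ^ (a i).toNat) + Pi.single e w, mem_piece_zero.mpr fun i => ?_,
      Prod.ext (funext fun i => ?_) (funext fun j => ?_)⟩
    · refine add_mem (Submodule.smul_mem _ _ (X_pow_mem_homog 0 (by linarith [ha1 i]))) ?_
      by_cases h : i = e
      · subst h
        rwa [Pi.single_eq_same]
      · rw [Pi.single_eq_of_ne h]
        exact zero_mem _
    · refine (evAll_apply _ _).trans ?_
      rw [Pi.add_apply]
      by_cases h : i = e
      · subst h
        simp [w]
      · simp [h]
    · refine (gradAt_apply _ _ _).trans ?_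
      rw [Pi.add_apply, map_add, map_smul, hdvX, smul_zero, zero_add, Pi.single_eq_same]
      simp [w, dv_X_zero_pow_mul_X]
  have := finrank_map_add_finrank_inf_ker S (piece n a 0)
  rw [hker, hmap, finrank_top, Module.finrank_prod, Module.finrank_fin_fun,
    Module.finrank_fin_fun] at this
  omega

/-- The homomorphisms that span a complement of `Hom(M_b, N_a)_0` in `Hom(M_b, M_a)_0`. -/
def lastHom (n : ℕ) (a : Fin r → ℤ) (b : Fin s → ℤ) (e : Fin r) (j : Fin s) :
    (Fin s → R n) →ₗ[R n] (Fin r → R n) :=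
  (Matrix.single e j (X 0 ^ (a e - b j).toNat)).mulVecLin

lemma entry_lastHom (a : Fin r → ℤ) (b : Fin s → ℤ) (e i : Fin r) (j k : Fin s) :
    entry (lastHom n a b e j) i k = if e = i ∧ j = k then X 0 ^ (a e - b j).toNat else 0 := by
  rw [lastHom, entry_mulVecLin, Matrix.single_apply]

lemma lastHom_apply (a : Fin r → ℤ) (b : Fin s → ℤ) (e : Fin r) (j : Fin s) (g : Fin s → R n) :
    lastHom n a b e j g = Pi.single e (X 0 ^ (a e - b j).toNat * g j) := by
  funext i
  rw [apply_eq_sum_entry]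
  simp only [entry_lastHom]
  by_cases h : e = i
  · subst h
    simp
  · simp [h, Ne.symm h]

lemma lastHom_mem {a : Fin r → ℤ} {b : Fin s → ℤ} {e : Fin r} (hab : ∀ j, b j ≤ a e) (j : Fin s) :
    lastHom n a b e j ∈ homZero n b a ⊤ := by
  refine mem_homZero_top_iff.mpr fun i k => ?_
  rw [entry_lastHom]
  split_ifs with h
  · obtain ⟨rfl, rfl⟩ := h
    exact X_pow_mem_homog 0 (by linarith [hab j])
  · exact zero_mem _

/-- Subtracting from `H` the multiples of `lastHom` by the values at `o` of its last row leaves a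
homomorphism into `N_a`. The condition `b j ≤ a e` provides the powers of `x₀` needed. -/
lemma map_delta_prod_eq {a : Fin r → ℤ} {b : Fin s → ℤ} {e : Fin r} (he : (e : ℕ) + 1 = r)
    (hab : ∀ j, b j ≤ a e) (g : Fin s → R n) (h : (Fin s → R n) →ₗ[R n] (Fin r → R n)) :
    ((degZero n b (Io n • ⊤)).prod (homZero n b a ⊤)).map (delta g h) =
      (V n a b).map (delta g h) ⊔ Submodule.span ℂ (Set.range fun j => lastHom n a b e j g) := by
  apply le_antisymm
  · rintro _ ⟨⟨G, H⟩, ⟨hG, hH⟩, rfl⟩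
    let H' := ∑ j, ev n (entry H e j) • lastHom n a b e j
    have hH' : H - H' ∈ homZero n b a (Na n r) := by
      have hHH : H - H' ∈ homZero n b a ⊤ := sub_mem hH (sum_mem fun j _ =>
        Submodule.smul_mem _ _ (lastHom_mem hab j))
      refine mem_homZero_Na_iff.mpr ⟨mem_homZero_top_iff.mp hHH, fun i hi k => ?_⟩
      obtain rfl : i = e := Fin.ext (by omega)
      have h1 : entry (H - H') i k =
          entry H i k - ∑ j, ev n (entry H i j) • entry (lastHom n a b i j) i k := by
        simp [entry, H', LinearMap.sum_apply]
      rw [h1]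
      simp [entry_lastHom]
    have hV : (G, H - H') ∈ V n a b := mem_V_iff.mpr ⟨hG, hH'⟩
    have h1 : delta g h (G, H) = delta g h (G, H - H') + H' g := by
      change H g + h G = (H g - H' g) + h G + H' g
      abel
    rw [h1]
    refine Submodule.add_mem_sup ⟨_, hV, rfl⟩ ?_
    rw [LinearMap.sum_apply]
    exact sum_mem fun j _ => Submodule.smul_mem _ _ (Submodule.subset_span ⟨j, rfl⟩)
  · refine sup_le (Submodule.map_mono (Submodule.prod_mono le_rfl fun H hH =>
      ⟨hH.1, fun _ => trivial⟩)) (Submodule.span_le.mpr ?_)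
    rintro _ ⟨j, rfl⟩
    exact ⟨(0, lastHom n a b e j), ⟨zero_mem _, lastHom_mem hab j⟩, by
      change lastHom n a b e j g + h 0 = _
      rw [map_zero, add_zero]⟩

instance (a : Fin r → ℤ) (b : Fin s → ℤ) (φ : ((Fin s → R n) ×
    ((Fin s → R n) →ₗ[R n] (Fin r → R n))) →ₗ[ℂ] (Fin r → R n)) :
    FiniteDimensional ℂ ((V n a b).map φ) := by
  rw [FiniteDimensional, Module.Finite.iff_fg]
  exact (Module.Finite.iff_fg.mp inferInstance).map _

lemma finrank_map_delta_prod_le {a : Fin r → ℤ} {b : Fin s → ℤ} {e : Fin r}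
    (he : (e : ℕ) + 1 = r) (hab : ∀ j, b j ≤ a e) (x : V n a b) :
    Module.finrank ℂ (((degZero n b (Io n • ⊤)).prod (homZero n b a ⊤)).map
      (delta x.1.1 x.1.2)) ≤ Module.finrank ℂ ((V n a b).map (delta x.1.1 x.1.2)) + s := by
  rw [map_delta_prod_eq he hab]
  have : FiniteDimensional ℂ (Submodule.span ℂ (Set.range fun j => lastHom n a b e j x.1.1)) :=
    FiniteDimensional.span_of_finite ℂ (Set.finite_range _)
  refine (Submodule.finrank_add_le_finrank_add_finrank _ _).trans (Nat.add_le_add_left ?_ _)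
  refine (finrank_range_le_card _).trans ?_
  rw [Fintype.card_fin]

/-- The gradient of the last coordinate kills `δ(V)` and sends the `s` additional vectors to the
gradients of the `g_j`, which are independent. -/
lemma le_finrank_map_delta_prod {a : Fin r → ℤ} {b : Fin s → ℤ} {e : Fin r}
    (he : (e : ℕ) + 1 = r) (hab : ∀ j, b j ≤ a e) (x : V n a b)
    (hx : LinearIndependent ℂ (grad x.1.1).row) :
    Module.finrank ℂ ((V n a b).map (delta x.1.1 x.1.2)) + s ≤
      Module.finrank ℂ (((degZero n b (Io n • ⊤)).prod (homZero n b a ⊤)).map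
      (delta x.1.1 x.1.2)) := by
  rw [map_delta_prod_eq he hab]
  set K := (V n a b).map (delta x.1.1 x.1.2)
  set L := Submodule.span ℂ (Set.range fun j => lastHom n a b e j x.1.1)
  have : FiniteDimensional ℂ L := FiniteDimensional.span_of_finite ℂ (Set.finite_range _)
  rw [← finrank_map_add_finrank_inf_ker (gradAt n e) (K ⊔ L), add_comm]
  refine Nat.add_le_add ?_ (Submodule.finrank_mono (le_inf le_sup_left fun f hf => ?_))
  · have h1 : Submodule.span ℂ (Set.range (grad x.1.1).row) ≤ (K ⊔ L).map (gradAt n e) := by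
      refine Submodule.span_le.mpr ?_
      rintro _ ⟨j, rfl⟩
      refine ⟨_, Submodule.mem_sup_right (Submodule.subset_span ⟨j, rfl⟩), ?_⟩
      funext k
      change _ = dv n k (x.1.1 j)
      rw [gradAt_apply]
      change dv n k (lastHom n a b e j x.1.1 e) = _
      rw [lastHom_apply, Pi.single_eq_same, dv_X_zero_pow_mul]
    have h2 := Submodule.finrank_mono h1
    rwa [finrank_span_eq_card hx, Fintype.card_fin] at h2
  · refine LinearMap.mem_ker.mpr (funext fun j => ?_)
    rw [gradAt_apply]
    exact congrFun (grad_row_eq_zero he (map_delta_le x hf)) j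

end IncidenceCI

end

/-! ### Assembling the equivalences -/

noncomputable section

namespace IncidenceCI

variable {n r s : ℕ}

lemma forGeneral_V_fst {a : Fin r → ℤ} {b : Fin s → ℤ} {Q : (Fin s → R n) → Prop}
    (h : ForGeneral (degZero n b (Io n • ⊤)) fun g => Q g.1) :
    ForGeneral (V n a b) fun x => Q x.1.1 := by
  obtain ⟨p, hp, ⟨g, hg⟩, hpQ⟩ := h.exists_polyFun
  let π : V n a b →ₗ[ℂ] degZero n b (Io n • ⊤) :=
    { toFun := fun x => ⟨x.1.1, x.2.1⟩
      map_add' := fun _ _ => rfl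
      map_smul' := fun _ _ => rfl }
  have hV : (g.1, (0 : (Fin s → R n) →ₗ[R n] (Fin r → R n))) ∈ V n a b :=
    mem_V_iff.mpr ⟨g.2, zero_mem _⟩
  have hpπ := polyFun_comp_linear (W := degZero n b (Io n • ⊤)) (W' := V n a b) π hp
  exact .of_polyFun hpπ (x := ⟨_, hV⟩) hg fun y hy => hpQ _ hy

lemma quotDim_eq_of_map_delta_eq {a : Fin r → ℤ} {b : Fin s → ℤ} (ha1 : ∀ i, 1 ≤ a i) {e : Fin r}
    (he : (e : ℕ) + 1 = r) (hab : ∀ j, b j ≤ a e) (x : V n a b)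
    (hx : LinearIndependent ℂ (grad x.1.1).row)
    (h : (V n a b).map (delta x.1.1 x.1.2) = degZero n a (Io n • Na n r)) :
    (quotDim a x.1.1 x.1.2 : ℤ) = n + r - s := by
  have h1 := quotDim_add_finrank x
  have h2 := finrank_piece_eq (n := n) ha1 he
  have h3 := finrank_map_delta_prod_le he hab x
  have h4 := le_finrank_map_delta_prod he hab x hx
  rw [h] at h3 h4
  omega

/-- Only the upper bound on the contribution of the additional vectors enters, so independence of
the gradients of `g` is not needed and a single point suffices. -/
lemma map_delta_eq_of_quotDim_le {a : Fin r → ℤ} {b : Fin s → ℤ} (ha1 : ∀ i, 1 ≤ a i) {e : Fin r}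
    (he : (e : ℕ) + 1 = r) (hab : ∀ j, b j ≤ a e) (x : V n a b)
    (h : (quotDim a x.1.1 x.1.2 : ℤ) ≤ n + r - s) :
    (V n a b).map (delta x.1.1 x.1.2) = degZero n a (Io n • Na n r) := by
  have h1 := quotDim_add_finrank x
  have h2 := finrank_piece_eq (n := n) ha1 he
  have h3 := finrank_map_delta_prod_le he hab x
  exact Submodule.eq_of_le_of_finrank_le (map_delta_le x) (by omega)

/-- Both sides are equivalent to dominance of `(g, h) ↦ h(g)`: the left by the comparison with
normal forms, the right by the Jacobian criterion. -/
lemma denseRange_alphaXi_iff {a : Fin r → ℤ} {b : Fin s → ℤ} (hmono : Monotone a)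
    (ha2 : ∀ i, 2 ≤ a i) (hb1 : ∀ j, 1 ≤ b j) (hr : r ≤ n) (hs : s ≤ n) {e : Fin r}
    (he : (e : ℕ) + 1 = r) :
    DenseRange (alphaXi n a b) ↔
      ∃ x : V n a b, (V n a b).map (delta x.1.1 x.1.2) = degZero n a (Io n • Na n r) := by
  have h1 : DenseRange (alphaXi n a b) ↔ ∀ p ∈ polyFun (degZero n a (Io n • Na n r)),
      (∀ x : V n a b, p (pairing n a b x x) = 0) → p = 0 :=
    ⟨fun h p hp => pairing_dominant_of_denseRange hmono ha2 hb1 hr hs he h hp,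
      denseRange_of_pairing_dominant hmono ha2 hb1 hr hs he⟩
  have h2 := exists_surjective_differential_iff (V := V n a b) (W := degZero n a (Io n • Na n r))
    (pairing n a b)
  rw [h1, ← h2]
  exact exists_congr fun x => (map_delta_eq_iff x).symm

end IncidenceCI

end

theorem mainTheorem5 (n r s : ℕ) (hn : 4 ≤ n) (hr : 0 < r) (hrs : r < s) (hsn : s < n)
    (a : Fin r → ℤ) (b : Fin s → ℤ)
    (ha : Monotone a) (ha2 : ∀ i, 2 ≤ a i) (hb : Monotone b) (hb1 : ∀ j, 1 ≤ b j)
    (hab : b ⟨s - 1, by omega⟩ ≤ a ⟨r - 1, by omega⟩) :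
    List.TFAE [
      DenseRange (alphaXi n a b),
      ForGeneral (V n a b) fun p =>
        (V n a b).map (delta p.1.1 p.1.2) = degZero n a (Io n • Na n r),
      ForGeneral (V n a b) fun p => (quotDim a p.1.1 p.1.2 : ℤ) = n + r - s,
      ∃ p : V n a b, (quotDim a p.1.1 p.1.2 : ℤ) ≤ n + r - s] := by
  have hae : ∀ j, b j ≤ a ⟨r - 1, by omega⟩ := fun j =>
    (hb (Fin.le_def.mpr (by have := j.2; dsimp only; omega))).trans hab
  have he : ((⟨r - 1, by omega⟩ : Fin r) : ℕ) + 1 = r := by dsimp only; omega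
  have ha1 : ∀ i, 1 ≤ a i := fun i => by linarith [ha2 i]
  tfae_have 1 ↔ 2 := by
    rw [denseRange_alphaXi_iff ha ha2 hb1 (by omega) hsn.le he]
    exact ⟨fun ⟨x, hx⟩ => forGeneral_map_delta_eq hx, fun h => h.exists⟩
  tfae_have 2 → 3 := fun h =>
    (h.and (forGeneral_V_fst (Q := fun g => LinearIndependent ℂ (grad g).row)
      (forGeneral_linearIndependent_grad hb1 hsn.le))).mono fun x hx =>
      quotDim_eq_of_map_delta_eq ha1 he hae x hx.2 hx.1
  tfae_have 3 → 4 := fun h => h.exists.imp fun x hx => hx.le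
  tfae_have 4 → 2 := fun ⟨x, hx⟩ =>
    forGeneral_map_delta_eq (map_delta_eq_of_quotDim_le ha1 he hae x hx)
  tfae_finish
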